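/- An instance of knapsack interdiction with $n\ge 1$ items and $t$ capacity constraints consists of profits $p_i\in\mathbb{Z}_{\ge0}$, interdiction costs $c_i\in\mathbb{Z}_{\ge0}$ and weight vectors $w_i\in\mathbb{Z}_{\ge0}^t$ for $i=1,\dots,n$, a budget $B\in\mathbb{Z}_{\ge0}$ and a capacity vector $C\in\mathbb{Z}_{\ge0}^t$, where $w_{ij}\le C_j$ for all $i,j$. For $x\in\{0,1\}^n$ let $$K(x)=\max\Big\{p^\top y:\ y\in\{0,1\}^n,\ \sum_i w_{ij}y_i\le C_j\text{ for all }j,\ y\le\mathbf 1-x\Big\},\qquad \mathrm{OPT}_{\mathrm I}=\min\{K(x):\ x\in\{0,1\}^n,\ c^\top x\le B\}.$$ Theorem. For every fixed $t$ there is an algorithm which, for every such instance and every real $\varepsilon>0$, computes an interdiction vector $\tilde x\in\{0,1\}^n$ with $c^\top\tilde x\le B$ and $$K(\tilde x)\le(1+t+\varepsilon)\,\mathrm{OPT}_{\mathrm I}$$ in time $$O\big(n^{t+2}\,\varepsilon^{-1}\log(\varepsilon^{-1}\log\textstyle\sum_i p_i)\big),$$ where the hidden constant depends only on $t$. In this bound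 $\varepsilon^{-1}$ is read as $\max(1,\varepsilon^{-1})$ in both places, and the outer logarithm as $1$ wherever it is less than $1$ or undefined; that is, the number of steps is at most $$A_t\, n^{t+2}\,\max(1,\varepsilon^{-1})\,\max\big(1,\log(\max(1,\varepsilon^{-1})\log\textstyle\sum_i p_i)\big).$$ Here time is the number of steps of a fixed program, depending only on $t$, on a word RAM with unit-cost addition, subtraction, multiplication, integer division, comparison and random memory access on integers. The instance is given as integers in memory, and $\varepsilon$ by two positive integers $a,b$ with $a/b\le\varepsilon\le 2a/b$ (for example $\varepsilon=a/b$ if $\varepsilon$ is rational). All integers occurring in the computation are bounded in absolute value by $N^{k_t}$, where $N$ is $2$ plus the sum of all numbers in the input (including $n,a,b$) and $k_t$ depends only on $t$. -/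

import Mathlib

namespace KnapsackInterdiction

/-! ## The optimization problem -/

/-- An instance with `n` items and `t` capacity constraints: item `i` has profit `p i`,
interdiction cost `c i` and weight vector `w i`; `B` is the interdiction budget and `C` the
capacity vector. -/
structure Instance (n t : ℕ) where
  p : Fin n → ℕ
  c : Fin n → ℕ
  w : Fin n → Fin t → ℕ
  B : ℕ
  C : Fin t → ℕ

namespace Instance

variable {n t : ℕ} (I : Instance n t)

/-- The interdiction vector `x ∈ {0,1}ⁿ` respects the budget: `cᵀ x ≤ B`. -/
def Affordable (x : Fin n → Fin 2) : Prop :=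
  ∑ i, I.c i * (x i : ℕ) ≤ I.B

/-- `y ∈ {0,1}ⁿ` is a packing of the items that remain after the interdiction `x`:
`W y ≤ C` and `y ≤ 1 - x`. -/
def Packable (x y : Fin n → Fin 2) : Prop :=
  (∀ j, ∑ i, I.w i j * (y i : ℕ) ≤ I.C j) ∧ ∀ i, (y i : ℕ) ≤ 1 - (x i : ℕ)

open Classical in
/-- `K(x) = max {pᵀ y : W y ≤ C, y ≤ 1 - x, y ∈ {0,1}ⁿ}`. -/
noncomputable def K (x : Fin n → Fin 2) : ℕ :=
  (Finset.univ.filter fun y => I.Packable x y).sup fun y => ∑ i, I.p i * (y i : ℕ)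

/-- `OPT = min {K(x) : cᵀ x ≤ B, x ∈ {0,1}ⁿ}`. -/
noncomputable def opt : ℕ :=
  sInf {v | ∃ x, I.Affordable x ∧ I.K x = v}

/-- `K x` is a maximum that is attained. -/
theorem K_isGreatest (x : Fin n → Fin 2) :
    IsGreatest {v | ∃ y, I.Packable x y ∧ ∑ i, I.p i * (y i : ℕ) = v} (I.K x) := by
  classical
  constructor
  · have hne : (Finset.univ.filter fun y => I.Packable x y).Nonempty :=
      ⟨fun _ => 0, Finset.mem_filter.2 ⟨Finset.mem_univ _, by simp [Packable]⟩⟩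
    obtain ⟨y, hy, h⟩ :=
      Finset.exists_mem_eq_sup _ hne fun y : Fin n → Fin 2 => ∑ i, I.p i * (y i : ℕ)
    exact ⟨y, by simpa using hy, by unfold K; convert h.symm⟩
  · rintro v ⟨y, hy, rfl⟩
    unfold K
    exact Finset.le_sup (f := fun y : Fin n → Fin 2 => ∑ i, I.p i * (y i : ℕ)) (by simpa using hy)

/-- `opt` is a minimum that is attained. -/
theorem opt_isLeast : IsLeast {v | ∃ x, I.Affordable x ∧ I.K x = v} I.opt :=
  ⟨Nat.sInf_mem ⟨_, fun _ => 0, by simp [Affordable], rfl⟩, fun _ h => Nat.sInf_le h⟩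

end Instance

/-! ## The machine model

A word RAM, programmed in a structured language. The memory consists of arrays of integers; a
program is a fixed finite text, so it can name only finitely many of them. A scalar variable is an
array that is used at index `0` only. Every operation (constant, memory access, arithmetic,
comparison, assignment, branch) costs one step. The machine has a word bound `M`: a run in which
some computed value exceeds `M` in absolute value, or in which an address is negative, is not a
run at all. -/

/-- `σ a i` is the content of cell `i` of array `a`. -/
abbrev Memory := ℕ → ℕ → ℤ

/-- Arithmetic expressions. -/
inductive Expr where
  | lit (z : ℤ)
  | read (a : ℕ) (i : Expr)
  | add (e f : Expr)
  | sub (e f : Expr)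
  | mul (e f : Expr)
  | div (e f : Expr)
  | lt (e f : Expr)
  | eq (e f : Expr)

namespace Expr

/-- The value of an expression; `div` is integer division, comparisons return `0` or `1`. -/
def val (σ : Memory) : Expr → ℤ
  | lit z => z
  | read a i => σ a (i.val σ).toNat
  | add e f => e.val σ + f.val σ
  | sub e f => e.val σ - f.val σ
  | mul e f => e.val σ * f.val σ
  | div e f => e.val σ / f.val σ
  | lt e f => if e.val σ < f.val σ then 1 else 0
  | eq e f => if e.val σ = f.val σ then 1 else 0

/-- The number of operations that the evaluation of an expression takes. -/
def cost : Expr → ℕ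
  | lit _ => 1
  | read _ i => i.cost + 1
  | add e f => e.cost + f.cost + 1
  | sub e f => e.cost + f.cost + 1
  | mul e f => e.cost + f.cost + 1
  | div e f => e.cost + f.cost + 1
  | lt e f => e.cost + f.cost + 1
  | eq e f => e.cost + f.cost + 1

/-- The evaluation succeeds with word bound `M`: every value computed on the way is at most `M` in
absolute value, and no address is negative. -/
def Fits (M : ℕ) (σ : Memory) : Expr → Prop
  | lit z => |z| ≤ M
  | read a i => i.Fits M σ ∧ 0 ≤ i.val σ ∧ |(read a i).val σ| ≤ M
  | add e f => e.Fits M σ ∧ f.Fits M σ ∧ |(add e f).val σ| ≤ M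
  | sub e f => e.Fits M σ ∧ f.Fits M σ ∧ |(sub e f).val σ| ≤ M
  | mul e f => e.Fits M σ ∧ f.Fits M σ ∧ |(mul e f).val σ| ≤ M
  | div e f => e.Fits M σ ∧ f.Fits M σ ∧ |(div e f).val σ| ≤ M
  | lt e f => e.Fits M σ ∧ f.Fits M σ ∧ |(lt e f).val σ| ≤ M
  | eq e f => e.Fits M σ ∧ f.Fits M σ ∧ |(eq e f).val σ| ≤ M

end Expr

/-- Programs. `write a i e` assigns the value of `e` to cell `i` of array `a`; `ite` and `loop`
(a while loop) take a nonzero value of the test as true. -/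
inductive Program where
  | skip
  | write (a : ℕ) (i e : Expr)
  | seq (P Q : Program)
  | ite (b : Expr) (P Q : Program)
  | loop (b : Expr) (P : Program)

/-- `Run M P σ τ T`: with word bound `M`, program `P` started in memory `σ` halts in memory `τ`
after `T` steps. -/
inductive Run (M : ℕ) : Program → Memory → Memory → ℕ → Prop
  | skip (σ : Memory) : Run M .skip σ σ 1
  | write (a : ℕ) (i e : Expr) (σ : Memory) (hi : i.Fits M σ) (h0 : 0 ≤ i.val σ)
      (he : e.Fits M σ) :
      Run M (.write a i e) σ
        (Function.update σ a (Function.update (σ a) (i.val σ).toNat (e.val σ)))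
        (i.cost + e.cost + 1)
  | seq {P Q : Program} {σ τ ρ : Memory} {S T : ℕ} (hP : Run M P σ τ S) (hQ : Run M Q τ ρ T) :
      Run M (.seq P Q) σ ρ (S + T)
  | ite_true {b : Expr} {P Q : Program} {σ τ : Memory} {T : ℕ} (hf : b.Fits M σ)
      (hb : b.val σ ≠ 0) (hP : Run M P σ τ T) : Run M (.ite b P Q) σ τ (b.cost + 1 + T)
  | ite_false {b : Expr} {P Q : Program} {σ τ : Memory} {T : ℕ} (hf : b.Fits M σ)
      (hb : b.val σ = 0) (hQ : Run M Q σ τ T) : Run M (.ite b P Q) σ τ (b.cost + 1 + T)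
  | loop_true {b : Expr} {P : Program} {σ τ ρ : Memory} {S T : ℕ} (hf : b.Fits M σ)
      (hb : b.val σ ≠ 0) (hP : Run M P σ τ S) (hL : Run M (.loop b P) τ ρ T) :
      Run M (.loop b P) σ ρ (b.cost + 1 + S + T)
  | loop_false {b : Expr} {P : Program} {σ : Memory} (hf : b.Fits M σ) (hb : b.val σ = 0) :
      Run M (.loop b P) σ σ (b.cost + 1)

/-! ## Input and output -/

/-- The array that holds a finite vector in its first cells and `0` elsewhere. -/
def arrayOf {m : ℕ} (f : Fin m → ℕ) : ℕ → ℤ :=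
  fun i => if h : i < m then (f ⟨i, h⟩ : ℤ) else 0

/-- The initial memory. Array `0` holds `n, B, a, b`, where `a / b` is the rational number given as
accuracy; arrays `1`, `2`, `3`, `4` hold `p`, `c`, `w` (with `w i j` in cell `t * i + j`) and `C`;
all other cells are `0`. -/
def Instance.input {n t : ℕ} (I : Instance n t) (a b : ℕ) : Memory
  | 0 => arrayOf ![n, I.B, a, b]
  | 1 => arrayOf I.p
  | 2 => arrayOf I.c
  | 3 => arrayOf fun k : Fin (n * t) =>
      I.w (finProdFinEquiv.symm k).1 (finProdFinEquiv.symm k).2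
  | 4 => arrayOf I.C
  | _ => 0

/-- The final memory holds `x` in the first `n` cells of array `5`. -/
def IsOutput {n : ℕ} (τ : Memory) (x : Fin n → Fin 2) : Prop :=
  ∀ i : Fin n, τ 5 i = (x i : ℕ)

/-- The sum of all numbers in the input, plus `2`. A word bound `I.magnitude a b ^ k` means that
a word has `k` times as many bits as are needed for the numbers in the input. -/
def Instance.magnitude {n t : ℕ} (I : Instance n t) (a b : ℕ) : ℕ :=
  2 + n + I.B + a + b + ∑ i, I.p i + ∑ i, I.c i + ∑ i, ∑ j, I.w i j + ∑ j, I.C j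

end KnapsackInterdiction

/-! Fix an interdiction `x`. Moving along kernel directions turns a feasible point of the relaxed
packing problem into one that is no worse and has at most `t` fractional coordinates. The
coordinates equal to `1` form a packing, and each fractional item fits alone because `w i j ≤ C j`.
Hence the relaxation is at most `(1 + t) * K x` (`relaxed_le`). Separation in `ℝᵗ × ℝ` carries this
over to the dual (`le_K_of_le_dual`), while `K_le_dual` is weak duality. So up to the factor `1 + t`
it suffices to minimize `C · v + ∑ max(0, pᵢ - wᵢ · v)(1 - xᵢ)` jointly over affordable `x` and `v ≥
0`.

For fixed `x` this function is piecewise linear in `v` and attains its minimum at a vertex of the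
arrangement of the `n + t` hyperplanes `wᵢ · v = pᵢ` and `vⱼ = 0`. The arrangement does not depend
on `x`, so `(n + t) ^ t` candidates suffice for all `x` (`exists_point_min`). For fixed `v` the
minimization over `x` is a knapsack cover problem.

With a guess `V`, all terms are rounded down to multiples of `V / Q`, and the cover problem becomes
a dynamic program with `O(n Q)` entries. There are `n + 1` rounded terms, so with `Q = (n + 1) κ`
the error is at most `V / κ`. A guess without a solution of rounded value at most `Q` certifies that
the true minimum exceeds `V`. A binary search on the exponents of powers of two ends with a
successful guess `2 V` such that `V = 1` or `V` fails, after `J + 1` tests, where `J` is doubly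
logarithmic in the total profit. The choice of `κ` of order `(1 + t) / ε` makes the error at most `ε
OPT` (`approximation`), and `Q = O(n / ε)` gives the running time.

The programs are verified by triples `Tri` that record result, time, unchanged arrays and a bound
`R` on all cells. Intermediate values are bounded by a power of `R` whose exponent depends only on
the program text. -/

namespace KnapsackInterdiction

/-! ## Reasoning about programs -/

namespace Expr

/-- All addresses that occur in the evaluation are nonnegative. -/
def Addr (σ : Memory) : Expr → Prop
  | lit _ => True
  | read _ i => i.Addr σ ∧ 0 ≤ i.val σ
  | add e f => e.Addr σ ∧ f.Addr σ
  | sub e f => e.Addr σ ∧ f.Addr σ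
  | mul e f => e.Addr σ ∧ f.Addr σ
  | div e f => e.Addr σ ∧ f.Addr σ
  | lt e f => e.Addr σ ∧ f.Addr σ
  | eq e f => e.Addr σ ∧ f.Addr σ

/-- An exponent that bounds the values of an expression in terms of the cells of the memory. -/
def wt : Expr → ℕ
  | lit z => z.natAbs + 1
  | read _ i => i.wt + 1
  | add e f => e.wt + f.wt
  | sub e f => e.wt + f.wt
  | mul e f => e.wt + f.wt
  | div e f => e.wt + f.wt
  | lt e f => e.wt + f.wt
  | eq e f => e.wt + f.wt

theorem one_le_wt (e : Expr) : 1 ≤ e.wt := by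
  induction e <;> simp only [wt] <;> omega

/-- Both powers are at least `2`, and the sum of two such numbers is at most their product. -/
theorem add_le_pow_add {R x y : ℤ} {m k : ℕ} (hR : 2 ≤ R) (hm : 1 ≤ m) (hk : 1 ≤ k)
    (hx : x ≤ R ^ m) (hy : y ≤ R ^ k) : x + y ≤ R ^ (m + k) := by
  have h1 : R ^ 1 ≤ R ^ m := pow_le_pow_right₀ (by omega) hm
  have h2 : R ^ 1 ≤ R ^ k := pow_le_pow_right₀ (by omega) hk
  rw [pow_add]
  nlinarith

/-- Literals enter through `|z| < 2 ^ |z|`, integer division does not increase the absolute value,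
and comparisons return `0` or `1`. -/
theorem abs_val_le {R : ℕ} (hR : 2 ≤ R) {σ : Memory} (hσ : ∀ a i, |σ a i| ≤ R) (e : Expr) :
    |e.val σ| ≤ (R : ℤ) ^ e.wt := by
  have hR' : (2 : ℤ) ≤ R := by exact_mod_cast hR
  have one : ∀ k : ℕ, (1 : ℤ) ≤ (R : ℤ) ^ k := fun k => one_le_pow₀ (by omega)
  induction e with
  | lit z =>
    simp only [val, wt]
    have h1 : z.natAbs < 2 ^ z.natAbs := Nat.lt_two_pow_self
    have h2 : 2 ^ z.natAbs ≤ R ^ (z.natAbs + 1) :=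
      (Nat.pow_le_pow_left hR _).trans (Nat.pow_le_pow_right (by omega) (by omega))
    rw [Int.abs_eq_natAbs]
    exact_mod_cast (h1.le.trans h2)
  | read a i ih =>
    simp only [val, wt]
    refine (hσ _ _).trans ?_
    exact le_self_pow₀ (by omega) (by omega)
  | add e f he hf =>
    exact (abs_add_le _ _).trans (add_le_pow_add hR' e.one_le_wt f.one_le_wt he hf)
  | sub e f he hf =>
    exact (abs_sub _ _).trans (add_le_pow_add hR' e.one_le_wt f.one_le_wt he hf)
  | mul e f he hf =>
    simp only [val, wt, abs_mul, pow_add]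
    exact mul_le_mul he hf (abs_nonneg _) (by positivity)
  | div e f he hf =>
    simp only [val, wt]
    exact (Int.abs_ediv_le_abs _ _).trans
      (he.trans (pow_le_pow_right₀ (by omega) (by omega)))
  | lt e f he hf =>
    simp only [val, wt]
    split_ifs <;> simp [one]
  | eq e f he hf =>
    simp only [val, wt]
    split_ifs <;> simp [one]

/-- The word bound becomes a condition on the syntax: subexpressions have smaller weight, so for
bounded cells only the signs of addresses remain to be checked. -/
theorem fits_of_addr {M R k : ℕ} (hR : 2 ≤ R) (hM : R ^ k ≤ M) {σ : Memory}
    (hσ : ∀ a i, |σ a i| ≤ R) (e : Expr) (ha : e.Addr σ) (hk : e.wt ≤ k) : e.Fits M σ := by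
  have key : ∀ e : Expr, e.wt ≤ k → |e.val σ| ≤ (M : ℤ) := fun e he =>
    (abs_val_le hR hσ e).trans (by
      have h : R ^ e.wt ≤ M := (Nat.pow_le_pow_right (by omega) he).trans hM
      exact_mod_cast h)
  induction e with
  | lit z => exact key _ hk
  | read a i ih =>
    have h := key _ hk
    simp only [wt] at hk
    exact ⟨ih ha.1 (by omega), ha.2, h⟩
  | add e f he hf | sub e f he hf | mul e f he hf | div e f he hf | lt e f he hf
  | eq e f he hf =>
    have h := key _ hk
    simp only [wt] at hk
    exact ⟨he ha.1 (by omega), hf ha.2 (by omega), h⟩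

end Expr

namespace Memory

/-- The memory `σ` after the assignment of `z` to cell `i` of array `a`. -/
def set (σ : Memory) (a i : ℕ) (z : ℤ) : Memory :=
  Function.update σ a (Function.update (σ a) i z)

theorem set_same (σ : Memory) (a i : ℕ) (z : ℤ) : σ.set a i z a i = z := by
  simp [set]

theorem set_idx (σ : Memory) (a i j : ℕ) (z : ℤ) :
    σ.set a i z a j = if j = i then z else σ a j := by
  simp [set, Function.update_apply]

theorem set_ne (σ : Memory) {a a' : ℕ} (h : a' ≠ a) (i : ℕ) (z : ℤ) : σ.set a i z a' = σ a' := by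
  simp [set, h]

theorem abs_set_le {σ : Memory} {R : ℤ} (hσ : ∀ a i, |σ a i| ≤ R) (a i : ℕ) {z : ℤ}
    (hz : |z| ≤ R) (a' i' : ℕ) : |σ.set a i z a' i'| ≤ R := by
  by_cases h : a' = a
  · subst h
    rw [set_idx]
    split_ifs
    · exact hz
    · exact hσ _ _
  · rw [set_ne _ h]
    exact hσ _ _

end Memory

namespace Program

/-- The arrays that a program may modify. -/
def mods : Program → List ℕ
  | skip => []
  | write a _ _ => [a]
  | seq P Q => P.mods ++ Q.mods
  | ite _ P Q => P.mods ++ Q.mods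
  | loop _ P => P.mods

end Program

/-- Started in `σ`, a memory with cells of absolute value at most `R`, the program halts within `T`
steps in a memory that satisfies `Q`, and the cells remain bounded by `R`. -/
def Tri (M R : ℕ) (P : Program) (σ : Memory) (T : ℕ) (Q : Memory → Prop) : Prop :=
  (∀ a i, |σ a i| ≤ R) → ∃ τ S, Run M P σ τ S ∧ S ≤ T ∧ (∀ a i, |τ a i| ≤ R) ∧
    (∀ a ∉ P.mods, τ a = σ a) ∧ Q τ

/-! ### Proof rules for triples with time and size bounds -/

section Rules

variable {M R k : ℕ} (hR : 2 ≤ R) (hM : R ^ k ≤ M)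

theorem Tri.skip {σ : Memory} {Q : Memory → Prop} (h : Q σ) : Tri M R .skip σ 1 Q :=
  fun hσ => ⟨σ, 1, .skip σ, le_rfl, hσ, fun _ _ => rfl, h⟩

theorem Tri.mono {P : Program} {σ : Memory} {S T : ℕ} {Q Q' : Memory → Prop} (h : Tri M R P σ S Q)
    (hT : S ≤ T) (hQ : ∀ τ, (∀ a ∉ P.mods, τ a = σ a) → Q τ → Q' τ) : Tri M R P σ T Q' :=
  fun hσ =>
    let ⟨τ, S', h1, h2, h3, h4, h5⟩ := h hσ
    ⟨τ, S', h1, h2.trans hT, h3, h4, hQ τ h4 h5⟩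

include hR hM in
theorem Tri.write {σ : Memory} {a : ℕ} {i e : Expr} {Q : Memory → Prop}
    (hi : i.Addr σ) (hik : i.wt ≤ k) (h0 : 0 ≤ i.val σ) (he : e.Addr σ) (hek : e.wt ≤ k)
    (hz : |e.val σ| ≤ R) (hQ : Q (σ.set a (i.val σ).toNat (e.val σ))) :
    Tri M R (.write a i e) σ (i.cost + e.cost + 1) Q :=
  fun hσ => ⟨_, _, .write a i e σ (i.fits_of_addr hR hM hσ hi hik) h0
    (e.fits_of_addr hR hM hσ he hek), le_rfl, Memory.abs_set_le hσ _ _ hz,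
    fun b hb => Memory.set_ne σ (by simpa [Program.mods] using hb) _ _, hQ⟩

theorem Tri.seq {σ : Memory} {P P' : Program} {S T : ℕ} {Q Q' : Memory → Prop}
    (hP : Tri M R P σ S Q)
    (hP' : ∀ τ, (∀ a ∉ P.mods, τ a = σ a) → Q τ → Tri M R P' τ T Q') :
    Tri M R (.seq P P') σ (S + T) Q' := by
  intro hσ
  obtain ⟨τ, S', h1, h2, h3, h4, h5⟩ := hP hσ
  obtain ⟨ρ, T', g1, g2, g3, g4, g5⟩ := hP' τ h4 h5 h3
  refine ⟨ρ, _, .seq h1 g1, add_le_add h2 g2, g3, fun a ha => ?_, g5⟩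
  simp only [Program.mods, List.mem_append, not_or] at ha
  rw [g4 a ha.2, h4 a ha.1]

include hR hM in
theorem Tri.ite {σ : Memory} {b : Expr} {P P' : Program} {T : ℕ} {Q : Memory → Prop}
    (hb : b.Addr σ) (hbk : b.wt ≤ k)
    (hP : b.val σ ≠ 0 → Tri M R P σ T Q) (hP' : b.val σ = 0 → Tri M R P' σ T Q) :
    Tri M R (.ite b P P') σ (b.cost + 1 + T) Q := by
  intro hσ
  have hf := b.fits_of_addr hR hM hσ hb hbk
  by_cases h : b.val σ = 0
  · obtain ⟨τ, S', h1, h2, h3, h4, h5⟩ := hP' h hσ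
    refine ⟨τ, _, .ite_false hf h h1, by omega, h3, fun a ha => h4 a fun h' => ha ?_, h5⟩
    simp [Program.mods, h']
  · obtain ⟨τ, S', h1, h2, h3, h4, h5⟩ := hP h hσ
    refine ⟨τ, _, .ite_true hf h h1, by omega, h3, fun a ha => h4 a fun h' => ha ?_, h5⟩
    simp [Program.mods, h']

include hR hM in
/-- A loop with a variant `m` that decreases by one in each round. -/
theorem Tri.loop {b : Expr} {P : Program} {c : ℕ} (hbk : b.wt ≤ k) (Inv : ℕ → Memory → Prop)
    (σ₀ : Memory)
    (hadr : ∀ m σ, (∀ a ∉ P.mods, σ a = σ₀ a) → Inv m σ → b.Addr σ)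
    (h0 : ∀ σ, (∀ a ∉ P.mods, σ a = σ₀ a) → Inv 0 σ → b.val σ = 0)
    (h1 : ∀ m σ, (∀ a ∉ P.mods, σ a = σ₀ a) → Inv (m + 1) σ → b.val σ ≠ 0)
    (hP : ∀ m σ, (∀ a ∉ P.mods, σ a = σ₀ a) → Inv (m + 1) σ → Tri M R P σ c (Inv m))
    (m : ℕ) {σ : Memory} (hσ₀ : ∀ a ∉ P.mods, σ a = σ₀ a) (hI : Inv m σ) :
    Tri M R (.loop b P) σ (m * (b.cost + 1 + c) + (b.cost + 1)) (Inv 0) := by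
  induction m generalizing σ with
  | zero =>
    intro hσ
    exact ⟨σ, _, .loop_false (b.fits_of_addr hR hM hσ (hadr _ _ hσ₀ hI) hbk) (h0 _ hσ₀ hI),
      by omega, hσ, fun _ _ => rfl, hI⟩
  | succ m ih =>
    intro hσ
    obtain ⟨τ, S, g1, g2, g3, g4, g5⟩ := hP m σ hσ₀ hI hσ
    obtain ⟨ρ, T, f1, f2, f3, f4, f5⟩ := ih (fun a ha => (g4 a ha).trans (hσ₀ a ha)) g5 g3
    refine ⟨ρ, _, .loop_true (b.fits_of_addr hR hM hσ (hadr _ _ hσ₀ hI) hbk) (h1 _ _ hσ₀ hI)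
      g1 f1, ?_, f3, fun a ha => (f4 a ha).trans (g4 a ha), f5⟩
    rw [Nat.succ_mul]
    omega

end Rules

/-- The scalar variable `a`. -/
def sc (a : ℕ) : Expr := .read a (.lit 0)

/-- Assignment to a scalar variable. -/
def assign (a : ℕ) (e : Expr) : Program := .write a (.lit 0) e

/-- `for a in 0, …, e - 1 do P`. -/
def forLoop (a : ℕ) (e : Expr) (P : Program) : Program :=
  .seq (assign a (.lit 0)) (.loop (.lt (sc a) e) (.seq P (assign a (.add (sc a) (.lit 1)))))

@[simp] theorem sc_val (σ : Memory) (a : ℕ) : (sc a).val σ = σ a 0 := by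
  simp [sc, Expr.val]

@[simp] theorem sc_addr (σ : Memory) (a : ℕ) : (sc a).Addr σ := by
  simp [sc, Expr.Addr, Expr.val]

@[simp] theorem sc_wt (a : ℕ) : (sc a).wt = 2 := rfl

@[simp] theorem sc_cost (a : ℕ) : (sc a).cost = 2 := rfl

@[simp] theorem assign_mods (a : ℕ) (e : Expr) : (assign a e).mods = [a] := rfl

section Rules

variable {M R k : ℕ} (hR : 2 ≤ R) (hM : R ^ k ≤ M)

include hR hM in
theorem Tri.assign {σ : Memory} {a : ℕ} {e : Expr} {Q : Memory → Prop}
    (he : e.Addr σ) (hek : e.wt ≤ k) (hz : |e.val σ| ≤ R) (hQ : Q (σ.set a 0 (e.val σ))) :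
    Tri M R (assign a e) σ (e.cost + 2) Q :=
  (Tri.write hR hM (i := .lit 0) trivial
    (show 1 ≤ k from e.one_le_wt.trans hek) le_rfl he hek hz hQ).mono
    (show 1 + e.cost + 1 ≤ _ by omega) fun _ _ h => h

include hR hM in
-- The bound `e` is evaluated anew in every round, so its value must depend only on arrays that the
-- loop leaves alone. The body is required to establish the invariant for the memory in which the
-- counter has already advanced.
theorem Tri.forLoop {a : ℕ} {e : Expr} {P : Program} {c m : ℕ} {σ₀ : Memory}
    (hk : 4 ≤ k) (hek : e.wt + 2 ≤ k) (ha : a ∉ P.mods) (hm : m ≤ R)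
    (he : ∀ σ, (∀ b, b ≠ a → b ∉ P.mods → σ b = σ₀ b) → e.Addr σ ∧ e.val σ = m)
    (Inv : ℕ → Memory → Prop) (h0 : Inv 0 (σ₀.set a 0 0))
    (hP : ∀ j σ, j < m → (∀ b, b ≠ a → b ∉ P.mods → σ b = σ₀ b) → σ a 0 = (j : ℤ) → Inv j σ →
      Tri M R P σ c fun τ => Inv (j + 1) (τ.set a 0 (j + 1))) :
    Tri M R (forLoop a e P) σ₀ (m * (e.cost + c + 10) + (e.cost + 10))
      (fun τ => Inv m τ) := by
  refine ((Tri.assign hR hM (e := .lit 0) (Q := fun τ => τ = σ₀.set a 0 0) trivial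
    (by simp [Expr.wt]; omega) (by simp [Expr.val]) (by simp [Expr.val])).seq ?_).mono
    (S := 3 + (m * ((2 + e.cost + 1) + 1 + (c + 6)) + ((2 + e.cost + 1) + 1))) ?_
    fun _ _ h => h
  · rintro τ - rfl
    set P' := Program.seq P (KnapsackInterdiction.assign a (.add (sc a) (.lit 1))) with hP'
    have hmods : ∀ b, b ≠ a → b ∉ P.mods → b ∉ P'.mods := by
      intro b h1 h2
      simp [hP', Program.mods, h1, h2]
    have hfr : ∀ σ : Memory, (∀ b ∉ P'.mods, σ b = (σ₀.set a 0 0) b) →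
        ∀ b, b ≠ a → b ∉ P.mods → σ b = σ₀ b := by
      intro σ h b h1 h2
      rw [h b (hmods b h1 h2), Memory.set_ne _ h1]
    -- `Tri.loop` counts the remaining rounds downwards, whereas `Inv` counts the completed rounds.
    let J : ℕ → Memory → Prop := fun r σ => r ≤ m ∧ σ a 0 = ((m - r : ℕ) : ℤ) ∧ Inv (m - r) σ
    have := Tri.loop hR hM (b := .lt (sc a) e) (P := P') (c := c + 6)
      (by simp [Expr.wt]; omega) J (σ₀.set a 0 0)
      (fun r σ h _ => ⟨by simp, (he σ (hfr σ h)).1⟩)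
      (fun σ h hJ => by
        simp only [Expr.val, sc_val, (he σ (hfr σ h)).2, hJ.2.1]
        simp)
      (fun r σ h hJ => by
        have := hJ.1
        simp only [Expr.val, sc_val, (he σ (hfr σ h)).2, hJ.2.1]
        rw [if_pos (by omega)]
        simp)
      (fun r σ h hJ => by
        obtain ⟨h1, h2, h3⟩ := hJ
        refine ((hP (m - (r + 1)) σ (by omega) (hfr σ h) h2 h3).seq
          (T := 6) (Q' := J r) ?_)
        intro τ hτ hI
        have e1 : τ a 0 = ((m - (r + 1) : ℕ) : ℤ) := by rw [hτ a ha, h2]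
        have e2 : m - (r + 1) + 1 = m - r := by omega
        have e3 : ((m - (r + 1) : ℕ) : ℤ) + 1 = ((m - r : ℕ) : ℤ) := by omega
        refine Tri.assign hR hM (by simp [Expr.Addr]) (by simp [Expr.wt]; omega) ?_ ?_
        · simp only [Expr.val, sc_val, e1]
          rw [abs_of_nonneg (by omega)]
          omega
        · simp only [Expr.val, sc_val, e1]
          rw [e2] at hI
          refine ⟨by omega, ?_, ?_⟩
          · rw [Memory.set_same, e3]
          · rw [e3] at hI ⊢
            exact hI)
      m (σ := σ₀.set a 0 0) (fun _ _ => rfl)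
      ⟨le_rfl, by simp [Memory.set_same], by simpa using h0⟩
    refine this.mono le_rfl fun τ _ h => ?_
    simpa using h.2.2
  · nlinarith

end Rules

/-! ## Compound expressions -/

namespace Expr

/-- The absolute value. -/
def absE (e : Expr) : Expr := .mul e (.sub (.lit 1) (.mul (.lit 2) (.lt e (.lit 0))))

/-- The positive part. -/
def posE (e : Expr) : Expr := .mul e (.lt (.lit 0) e)

/-- The minimum. -/
def minE (e f : Expr) : Expr := .add e (.mul (.sub f e) (.lt f e))

/-- A power with fixed exponent. -/
def powE (e : Expr) : ℕ → Expr
  | 0 => .lit 1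
  | r + 1 => .mul (powE e r) e

/-- A sum with a fixed number of terms. -/
def sumE : (r : ℕ) → (Fin r → Expr) → Expr
  | 0, _ => .lit 0
  | r + 1, f => .add (f 0) (sumE r fun j => f j.succ)

/-- The determinant of a matrix of fixed size, by expansion along the first row. -/
def detE : (r : ℕ) → (Fin r → Fin r → Expr) → Expr
  | 0, _ => .lit 1
  | r + 1, A => sumE (r + 1) fun j =>
      .mul (.mul (.lit ((-1) ^ (j : ℕ))) (A 0 j)) (detE r fun x y => A x.succ (j.succAbove y))

variable (σ : Memory) (e f : Expr)

@[simp] theorem absE_val : (absE e).val σ = |e.val σ| := by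
  change e.val σ * (1 - 2 * (if e.val σ < 0 then 1 else 0)) = _
  rcases lt_or_ge (e.val σ) 0 with h | h
  · rw [if_pos h, abs_of_neg h]; ring
  · rw [if_neg h.not_gt, abs_of_nonneg h]; ring

@[simp] theorem posE_val : (posE e).val σ = max 0 (e.val σ) := by
  change e.val σ * (if 0 < e.val σ then 1 else 0) = _
  rcases lt_or_ge 0 (e.val σ) with h | h
  · rw [if_pos h, max_eq_right h.le]; ring
  · rw [if_neg h.not_gt, max_eq_left h]; ring

@[simp] theorem minE_val : (minE e f).val σ = min (e.val σ) (f.val σ) := by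
  simp only [minE, val]
  split_ifs with h
  · rw [min_eq_right h.le]; ring
  · rw [min_eq_left (by omega)]; ring

@[simp] theorem powE_val (r : ℕ) : (powE e r).val σ = e.val σ ^ r := by
  induction r with
  | zero => simp [powE, val]
  | succ r ih => simp [powE, val, ih, pow_succ]

@[simp] theorem sumE_val {r : ℕ} (g : Fin r → Expr) :
    (sumE r g).val σ = ∑ j, (g j).val σ := by
  induction r with
  | zero => simp [sumE, val]
  | succ r ih => simp [sumE, val, ih, Fin.sum_univ_succ]

theorem detE_val {r : ℕ} (A : Fin r → Fin r → Expr) :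
    (detE r A).val σ = (Matrix.of fun x y => (A x y).val σ).det := by
  induction r with
  | zero => simp [detE, val]
  | succ r ih =>
    rw [Matrix.det_succ_row_zero]
    simp only [detE, sumE_val, val, ih]
    rfl

variable {σ e f}

theorem absE_addr (h : e.Addr σ) : (absE e).Addr σ := by simp [absE, Addr, h]

theorem posE_addr (h : e.Addr σ) : (posE e).Addr σ := by simp [posE, Addr, h]

theorem minE_addr (h : e.Addr σ) (h' : f.Addr σ) : (minE e f).Addr σ := by
  simp [minE, Addr, h, h']

theorem powE_addr (h : e.Addr σ) (r : ℕ) : (powE e r).Addr σ := by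
  induction r with
  | zero => simp [powE, Addr]
  | succ r ih => simp [powE, Addr, ih, h]

theorem sumE_addr {r : ℕ} {g : Fin r → Expr} (h : ∀ j, (g j).Addr σ) : (sumE r g).Addr σ := by
  induction r with
  | zero => simp [sumE, Addr]
  | succ r ih => exact ⟨h 0, ih fun j => h j.succ⟩

theorem detE_addr {r : ℕ} {A : Fin r → Fin r → Expr} (h : ∀ x y, (A x y).Addr σ) :
    (detE r A).Addr σ := by
  induction r with
  | zero => simp [detE, Addr]
  | succ r ih => exact sumE_addr fun j => ⟨⟨trivial, h _ _⟩, ih fun x y => h _ _⟩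

end Expr

/-! ## The input as functions on the natural numbers -/

namespace Instance

variable {n t : ℕ} (I : Instance n t)

/-- The profit of item `i`, and `0` if there is no such item. -/
def pN (i : ℕ) : ℕ := if h : i < n then I.p ⟨i, h⟩ else 0

/-- The cost of item `i`, and `0` if there is no such item. -/
def cN (i : ℕ) : ℕ := if h : i < n then I.c ⟨i, h⟩ else 0

/-- The weights of item `i`, and `0` if there is no such item. -/
def wN (i : ℕ) (j : Fin t) : ℕ := if h : i < n then I.w ⟨i, h⟩ j else 0

@[simp] theorem pN_val (i : Fin n) : I.pN i = I.p i := by simp [pN]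
@[simp] theorem cN_val (i : Fin n) : I.cN i = I.c i := by simp [cN]
@[simp] theorem wN_val (i : Fin n) (j : Fin t) : I.wN i j = I.w i j := by simp [wN]

variable (a b : ℕ)

theorem input_p (i : ℕ) : I.input a b 1 i = I.pN i := by
  simp only [input, arrayOf, pN]; split_ifs <;> simp

theorem input_c (i : ℕ) : I.input a b 2 i = I.cN i := by
  simp only [input, arrayOf, cN]; split_ifs <;> simp

theorem input_C (j : Fin t) : I.input a b 4 j = I.C j := by
  simp [input, arrayOf]

theorem input_w (i : ℕ) (j : Fin t) : I.input a b 3 (t * i + j) = I.wN i j := by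
  have hj := j.2
  have ht : 0 < t := by omega
  simp only [input, arrayOf, wN]
  have h1 : (t * i + j) / t = i := by
    rw [Nat.mul_add_div ht, Nat.div_eq_of_lt hj, add_zero]
  have h2 : (t * i + j) % t = j := by
    rw [Nat.mul_add_mod, Nat.mod_eq_of_lt hj]
  by_cases h : i < n
  · have h3 : t * i + j < n * t := by
      have : t * (i + 1) ≤ t * n := Nat.mul_le_mul_left _ h
      rw [mul_comm n]
      linarith
    rw [dif_pos h3, dif_pos h]
    congr 2
    · simp [finProdFinEquiv, Fin.divNat, h1]
    · simp [finProdFinEquiv, Fin.modNat, h2]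
  · have h3 : ¬ t * i + j < n * t := by
      have : t * n ≤ t * i := Nat.mul_le_mul_left _ (by omega)
      rw [mul_comm n]
      omega
    rw [dif_neg h3, dif_neg h]
    simp

theorem input_hdr : I.input a b 0 0 = n ∧ I.input a b 0 1 = I.B ∧ I.input a b 0 2 = a ∧
    I.input a b 0 3 = b := by
  simp [input, arrayOf]

theorem input_of_five_le {x : ℕ} (hx : 5 ≤ x) : I.input a b x = 0 := by
  obtain ⟨y, rfl⟩ := Nat.exists_eq_add_of_le' hx
  rfl

/-! ## Candidates for the dual solution

The numbers below `(n + t) ^ t` encode `t`-tuples of hyperplanes in `ℝᵗ`. The hyperplane with number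
`d < n` is `w d ⬝ᵥ v = p d`, the one with number `n + j` is `v j = 0`. The intersection point of a
tuple is given by Cramer's rule; the definitions make sense of every tuple. -/

/-- Coefficients of the hyperplane with number `d`. -/
def hyp (d : ℕ) (j : Fin t) : ℕ := I.wN d j + if d = n + j then 1 else 0

/-- The `r`-th hyperplane in the tuple with code `q`. -/
def digit (_I : Instance n t) (q : ℕ) (r : Fin t) : ℕ := q / (n + t) ^ (r : ℕ) % (n + t)

/-- The coefficient matrix of a tuple of hyperplanes. -/
def mat (q : ℕ) : Matrix (Fin t) (Fin t) ℤ := .of fun r j => (I.hyp (I.digit q r) j : ℤ)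

/-- The right-hand sides of a tuple of hyperplanes. -/
def rhs (q : ℕ) (r : Fin t) : ℤ := I.pN (I.digit q r)

/-- The common denominator of the candidate `q`. -/
def den (q : ℕ) : ℕ := (I.mat q).det.natAbs + if (I.mat q).det = 0 then 1 else 0

/-- The numerators of the candidate `q`. -/
def num (q : ℕ) (j : Fin t) : ℕ := ((I.mat q).updateCol j (I.rhs q)).det.natAbs

/-- The reduced profit of item `i` under the candidate `q`, times the denominator. -/
def gain (q i : ℕ) : ℕ := I.den q * I.pN i - ∑ j, I.num q j * I.wN i j

/-- The value of the capacities under the candidate `q`, times the denominator. -/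
def base (q : ℕ) : ℕ := ∑ j, I.num q j * I.C j

/-- Reduced profits, rounded to multiples of `V / Q`. -/
def scaled (Q V q i : ℕ) : ℕ := I.gain q i * Q / (V * I.den q)

/-- The value of the capacities, rounded to a multiple of `V / Q` and truncated. -/
def scaledBase (Q V q : ℕ) : ℕ := min (I.base q * Q / (V * I.den q)) (Q + 1)

/-- Singular tuples are not filtered out. A positive denominator and numerators taken in absolute
value make every code a nonnegative point, at which weak duality holds, so useless candidates do no
harm. -/
theorem den_pos (q : ℕ) : 0 < I.den q := by
  unfold den
  split_ifs with h
  · omega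
  · have := Int.natAbs_pos.2 h
    omega

theorem gain_le (q i : ℕ) : I.gain q i ≤ I.den q * I.pN i := Nat.sub_le _ _

/-- The denominator cancels. Thus determinants occur only while an expression is evaluated, and the
stored cells need no bound in terms of them. -/
theorem scaled_le (Q V q i : ℕ) : I.scaled Q V q i ≤ I.pN i * Q := by
  unfold scaled
  rcases Nat.eq_zero_or_pos V with rfl | hV
  · simp
  refine Nat.div_le_of_le_mul ?_
  calc I.gain q i * Q ≤ I.den q * I.pN i * Q := Nat.mul_le_mul_right _ (I.gain_le q i)
    _ = 1 * I.den q * (I.pN i * Q) := by ring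
    _ ≤ V * I.den q * (I.pN i * Q) := by gcongr; exact hV

end Instance

/-! ## Expressions for the candidates

Here array `6` holds the code of the candidate, array `7` an item, array `13` the number `Q + 1` and
array `14` the number `V`. -/

/-- The number of items. -/
def nE : Expr := .read 0 (.lit 0)

/-- The number of hyperplanes. -/
def hypE (t : ℕ) : Expr := .add nE (.lit t)

def digitE (t r : ℕ) : Expr :=
  .sub (.div (sc 6) (.powE (hypE t) r))
    (.mul (.div (.div (sc 6) (.powE (hypE t) r)) (hypE t)) (hypE t))

def entryE (t r j : ℕ) : Expr :=
  .add (.read 3 (.add (.mul (.lit t) (digitE t r)) (.lit j)))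
    (.eq (digitE t r) (.add nE (.lit j)))

def detE (t : ℕ) : Expr := .detE t fun r j => entryE t r j

def denE (t : ℕ) : Expr := .add (.absE (detE t)) (.eq (detE t) (.lit 0))

def numE (t : ℕ) (j : Fin t) : Expr :=
  .absE (.detE t fun r j' => if j' = j then .read 1 (digitE t r) else entryE t r j')

def QE : Expr := .sub (sc 13) (.lit 1)

def scaledE (t : ℕ) : Expr :=
  .div (.mul (.posE (.sub (.mul (denE t) (.read 1 (sc 7)))
    (.sumE t fun j => .mul (numE t j) (.read 3 (.add (.mul (.lit t) (sc 7)) (.lit j)))))) QE)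
    (.mul (sc 14) (denE t))

def scaledBaseE (t : ℕ) : Expr :=
  .minE (.div (.mul (.sumE t fun j => .mul (numE t j) (.read 4 (.lit j))) QE)
    (.mul (sc 14) (denE t))) (sc 13)

/-- The memory still contains the input. -/
def HasInput {n t : ℕ} (I : Instance n t) (a b : ℕ) (σ : Memory) : Prop :=
  ∀ x ≤ 4, σ x = I.input a b x

namespace HasInput

variable {n t : ℕ} {I : Instance n t} {a b : ℕ} {σ : Memory} (h : HasInput I a b σ)

include h

theorem n_eq : σ 0 0 = n := by rw [h 0 (by omega), (I.input_hdr a b).1]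

theorem B_eq : σ 0 1 = I.B := by rw [h 0 (by omega), (I.input_hdr a b).2.1]

theorem a_eq : σ 0 2 = a := by rw [h 0 (by omega), (I.input_hdr a b).2.2.1]

theorem b_eq : σ 0 3 = b := by rw [h 0 (by omega), (I.input_hdr a b).2.2.2]

theorem p_eq (i : ℕ) : σ 1 i = I.pN i := by rw [h 1 (by omega), I.input_p]

theorem c_eq (i : ℕ) : σ 2 i = I.cN i := by rw [h 2 (by omega), I.input_c]

theorem w_eq (i : ℕ) (j : Fin t) : σ 3 (t * i + j) = I.wN i j := by rw [h 3 (by omega), I.input_w]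

theorem C_eq (j : Fin t) : σ 4 j = I.C j := by rw [h 4 (by omega), I.input_C]

theorem mono {τ : Memory} (hτ : ∀ x ≤ 4, τ x = σ x) : HasInput I a b τ :=
  fun x hx => (hτ x hx).trans (h x hx)

theorem nE_val : nE.val σ = n := by
  simp [nE, Expr.val, h.n_eq]

omit h in
theorem nE_addr : nE.Addr σ := by simp [nE, Expr.Addr, Expr.val]

theorem hypE_val : (hypE t).val σ = ((n + t : ℕ) : ℤ) := by
  simp [hypE, Expr.val, h.nE_val]

omit h in
theorem hypE_addr : (hypE t).Addr σ := by simp [hypE, Expr.Addr, nE_addr]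

variable {q : ℕ} (hq : σ 6 0 = q)

include hq

theorem digitE_val (r : Fin t) : (digitE t r).val σ = I.digit q r := by
  simp only [digitE, Expr.val, Expr.powE_val, sc_val, hq, h.hypE_val, Instance.digit]
  push_cast
  -- The machine has no remainder operation; the digit is programmed as `z - z / m * m`.
  rw [Int.emod_def]
  ring

omit h hq in
theorem digitE_addr (r : Fin t) : (digitE t r).Addr σ := by
  simp [digitE, Expr.Addr, Expr.powE_addr, hypE_addr]

theorem entryE_val (r j : Fin t) : (entryE t r j).val σ = I.mat q r j := by
  simp only [entryE, Expr.val, h.digitE_val hq, h.nE_val, Instance.mat, Instance.hyp,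
    Matrix.of_apply]
  have : ((t : ℤ) * (I.digit q r : ℤ) + ((j : ℕ) : ℤ)).toNat = t * I.digit q r + j := by
    zify
    rw [Int.toNat_of_nonneg (by positivity)]
  rw [this, h.w_eq]
  push_cast
  congr 2
  exact propext (by exact_mod_cast Iff.rfl)

theorem entryE_addr (r j : Fin t) : (entryE t r j).Addr σ := by
  simp only [entryE, Expr.Addr, Expr.val, digitE_addr, h.digitE_val hq, nE_addr, and_self,
    true_and, and_true]
  positivity

theorem detE_val : (detE t).val σ = (I.mat q).det := by
  rw [detE, Expr.detE_val]
  congr 1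
  ext r j
  exact h.entryE_val hq r j

theorem detE_addr : (detE t).Addr σ := Expr.detE_addr fun r j => h.entryE_addr hq r j

theorem denE_val : (denE t).val σ = I.den q := by
  simp only [denE, Expr.val, Expr.absE_val, h.detE_val hq, Instance.den]
  push_cast
  rfl

theorem denE_addr : (denE t).Addr σ :=
  ⟨Expr.absE_addr (h.detE_addr hq), h.detE_addr hq, trivial⟩

theorem numE_val (j : Fin t) : (numE t j).val σ = I.num q j := by
  rw [numE, Expr.absE_val, Expr.detE_val, Instance.num, Int.natCast_natAbs]
  congr 2
  ext r j'
  simp only [Matrix.of_apply, Matrix.updateCol_apply]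
  split_ifs
  · simp [Expr.val, h.digitE_val hq, Instance.rhs, h.p_eq]
  · exact h.entryE_val hq r j'

theorem numE_addr (j : Fin t) : (numE t j).Addr σ := by
  refine Expr.absE_addr (Expr.detE_addr fun r j' => ?_)
  split_ifs
  · exact ⟨digitE_addr r, by rw [h.digitE_val hq]; positivity⟩
  · exact h.entryE_addr hq r j'

variable {Q V : ℕ} (hQ : σ 13 0 = Q + 1) (hV : σ 14 0 = V)

theorem scaledE_addr {i : ℕ} (hi : σ 7 0 = i) : (scaledE t).Addr σ := by
  refine ⟨⟨Expr.posE_addr ⟨⟨h.denE_addr hq, by simp [Expr.Addr, hi]⟩, Expr.sumE_addr fun j =>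
    ⟨h.numE_addr hq j, ?_⟩⟩, by simp [QE, Expr.Addr]⟩, by simp, h.denE_addr hq⟩
  simp only [Expr.Addr, sc_addr, Expr.val, sc_val, hi, and_self, true_and]
  positivity

theorem scaledBaseE_addr : (scaledBaseE t).Addr σ :=
  Expr.minE_addr ⟨⟨Expr.sumE_addr fun j => ⟨h.numE_addr hq j, by simp [Expr.Addr, Expr.val]⟩,
    by simp [QE, Expr.Addr]⟩, by simp, h.denE_addr hq⟩ (by simp)

include hQ hV

theorem scaledE_val {i : ℕ} (hi : σ 7 0 = i) : (scaledE t).val σ = I.scaled Q V q i := by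
  have e : ∀ j : Fin t, ((t : ℤ) * (i : ℤ) + ((j : ℕ) : ℤ)).toNat = t * i + j := fun j => by
    zify
    rw [Int.toNat_of_nonneg (by positivity)]
  simp only [scaledE, Expr.val, Expr.posE_val, Expr.sumE_val, h.denE_val hq, h.numE_val hq, sc_val,
    hi, e, h.w_eq, QE, hQ, hV, h.p_eq, Instance.scaled, Int.toNat_natCast]
  push_cast
  congr 2
  · rw [Instance.gain]
    set x := I.den q * I.pN i
    have : (∑ j, (I.num q j : ℤ) * (I.wN i j : ℤ)) = ((∑ j, I.num q j * I.wN i j : ℕ) : ℤ) := by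
      push_cast; rfl
    rw [this, ← Nat.cast_mul]
    omega
  · ring

theorem scaledBaseE_val : (scaledBaseE t).val σ = I.scaledBase Q V q := by
  simp only [scaledBaseE, Expr.val, Expr.minE_val, Expr.sumE_val, h.denE_val hq, h.numE_val hq,
    sc_val, h.C_eq, QE, hQ, hV, Instance.scaledBase, Int.toNat_natCast, Instance.base]
  push_cast
  simp

end HasInput

/-! ## Dynamic programming for the knapsack cover problem -/

/-- The least cost of a subset of the first `i` items such that the sizes of the remaining ones of
these items sum up to at most `v`. -/
def tab (s c : ℕ → ℕ) : ℕ → ℕ → ℕ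
  | 0, _ => 0
  | i + 1, v => if s i ≤ v ∧ tab s c i (v - s i) < tab s c i v + c i then tab s c i (v - s i)
      else tab s c i v + c i

/-- This is the optimality half of the recursion. That the table value is attained is shown by the
reconstruction in `reconstructP_tri`. -/
theorem tab_le (s c x : ℕ → ℕ) (hx : ∀ i, x i ≤ 1) (k v : ℕ)
    (h : ∑ i ∈ Finset.range k, s i * (1 - x i) ≤ v) :
    tab s c k v ≤ ∑ i ∈ Finset.range k, c i * x i := by
  induction k generalizing v with
  | zero => simp [tab]
  | succ k ih =>
    rw [Finset.sum_range_succ] at h ⊢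
    have hx' := hx k
    interval_cases hxk : x k
    · simp only [Nat.sub_zero, mul_one, mul_zero, add_zero] at h ⊢
      have h1 := ih (v - s k) (by omega)
      rw [tab]
      split_ifs with h2
      · exact h1
      · have : s k ≤ v := by omega
        have h3 : ¬ tab s c k (v - s k) < tab s c k v + c k := fun h => h2 ⟨this, h⟩
        omega
    · simp only [Nat.sub_self, mul_one, mul_zero, add_zero] at h ⊢
      have h1 := ih v h
      rw [tab]
      split_ifs <;> omega

/-- Interdicting everything leaves total size `0`, so it is admissible for every `v`; this bounds
the table entries. -/
theorem tab_le_sum (s c : ℕ → ℕ) (k v : ℕ) : tab s c k v ≤ ∑ i ∈ Finset.range k, c i := by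
  simpa using tab_le s c 1 (by simp) k v (by simp)

/-! ## The program -/

def scaleP (t : ℕ) : Program := forLoop 7 nE (.write 8 (sc 7) (scaledE t))

def colE : Expr := .sub (sc 7) (.mul (.div (sc 7) (sc 13)) (sc 13))

def sizeE : Expr := .read 8 (.div (sc 7) (sc 13))

def fitE : Expr := .lt sizeE (.add colE (.lit 1))

/-- The factor `fitE` replaces the address by `0` if the item does not fit, where the shifted
address could be negative. -/
def keepE : Expr := .read 9 (.mul (.sub (sc 7) sizeE) fitE)

def dropE : Expr := .add (.read 9 (sc 7)) (.read 2 (.div (sc 7) (sc 13)))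

/-- A conditional written as arithmetic: the product of the two tests switches from the entry for an
interdicted item to the entry for a kept one. -/
def tableE : Expr := .add dropE (.mul (.sub keepE dropE) (.mul fitE (.lt keepE dropE)))

/-- The table is stored row by row with row length `Q + 1`, so cell `j + (Q + 1)` lies one row below
cell `j` in the same column. Row `0` is never written and relies on the initial zeros. -/
def tableP : Program :=
  forLoop 7 (.mul nE (sc 13)) (.write 9 (.add (sc 7) (sc 13)) tableE)

/-- The counter advances only while its own column is too expensive, so it stops for good at the
first affordable column, and at `Q + 1` if there is none. -/
def findP : Program :=
  .seq (assign 10 (.lit 0)) (forLoop 7 (sc 13) (assign 10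
    (.add (sc 10) (.lt (.read 0 (.lit 1)) (.read 9 (.add (.mul nE (sc 13)) (sc 10)))))))

def itemE : Expr := .sub (.sub nE (.lit 1)) (sc 7)

/-- An item is interdicted exactly if doing so accounts for the table entry; ties are resolved in
favour of interdiction. -/
def choiceE : Expr :=
  .eq (.read 9 (.add (.mul (.add itemE (.lit 1)) (sc 13)) (sc 10)))
    (.add (.read 9 (.add (.mul itemE (sc 13)) (sc 10))) (.read 2 itemE))

def reconstructP : Program :=
  forLoop 7 nE (.seq (.write 5 itemE choiceE)
    (assign 10 (.sub (sc 10) (.mul (.sub (.lit 1) (.read 5 itemE)) (.read 8 itemE)))))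

def candidateP (t : ℕ) : Program :=
  .seq (scaleP t) (.seq tableP (.seq findP (.seq (assign 12 (scaledBaseE t))
    (.ite (.lt (.add (sc 12) (sc 10)) (sc 11))
      (.seq (assign 11 (.add (sc 12) (sc 10))) reconstructP) .skip))))

/-- The program that determines the best rounded solution for the guess in array `14`. -/
def testP (t : ℕ) : Program :=
  .seq (assign 11 (sc 13)) (forLoop 6 (sc 19) (candidateP t))

/-- Bounds for the numbers that occur in `testP`. -/
structure Bounds {n t : ℕ} (I : Instance n t) (Q M R k : ℕ) : Prop where
  two_le : 2 ≤ R
  pow_le : R ^ k ≤ M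
  wt_le : 100 + (scaledE t).wt + (scaledBaseE t).wt ≤ k
  table_le : (n + 1) * (Q + 1) ≤ R
  cost_le : ∑ i ∈ Finset.range n, I.cN i ≤ R
  profit_le : ∀ i, I.pN i * Q ≤ R
  count_le : (n + t) ^ t ≤ R

/-! ### Correctness of the dynamic program for one candidate -/

section

variable {n t : ℕ} {I : Instance n t} {a b Q M R k V q : ℕ} (hB : Bounds I Q M R k)

include hB

theorem scaleP_tri {σ : Memory} (h : HasInput I a b σ) (hq : σ 6 0 = q)
    (hQ : σ 13 0 = Q + 1) (hV : σ 14 0 = V) :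
    Tri M R (scaleP t) σ (n * ((scaledE t).cost + 15) + 12)
      fun τ => ∀ i < n, τ 8 i = I.scaled Q V q i := by
  obtain ⟨hR, hM, hk, hT, -, hp, -⟩ := hB
  have hn : n ≤ R := by nlinarith
  have fr : ∀ τ : Memory, (∀ b, b ≠ 7 → b ∉ (Program.write 8 (sc 7) (scaledE t)).mods →
      τ b = σ b) → HasInput I a b τ ∧ τ 6 0 = q ∧ τ 13 0 = Q + 1 ∧ τ 14 0 = V := by
    intro τ hτ
    refine ⟨h.mono fun x hx => hτ x (by omega) (by simp [Program.mods]; omega), ?_, ?_, ?_⟩ <;>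
    rwa [hτ _ (by omega) (by simp [Program.mods])]
  refine (Tri.forLoop hR hM (m := n) (by omega) (by simp [nE, Expr.wt]; omega)
    (by simp [Program.mods]) hn (fun τ hτ => ⟨HasInput.nE_addr, (fr τ hτ).1.nE_val⟩)
    (fun j τ => ∀ i < j, τ 8 i = I.scaled Q V q i) (by simp)
    (c := (scaledE t).cost + 3) ?_).mono ?_ fun _ _ h => h
  · intro j τ hj hτ hj7 hI
    obtain ⟨h1, h2, h3, h4⟩ := fr τ hτ
    refine (Tri.write hR hM (by simp) (by simp; omega) (by simp [hj7])
      (h1.scaledE_addr h2 hj7) (by omega) ?_ ?_).mono (by simp; omega) fun _ _ h => h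
    · rw [h1.scaledE_val h2 h3 h4 hj7, Nat.abs_cast]
      exact_mod_cast (I.scaled_le Q V q j).trans (hp j)
    · intro i hi
      rw [h1.scaledE_val h2 h3 h4 hj7, Memory.set_ne _ (by omega), Memory.set_idx]
      simp only [sc_val, hj7, Int.toNat_natCast]
      split_ifs with hij
      · rw [hij]
      · exact hI i (by omega)
  · simp only [nE, Expr.cost]
    nlinarith

theorem tableP_tri {σ : Memory} (h : HasInput I a b σ) (hQ : σ 13 0 = Q + 1) {s : ℕ → ℕ}
    (hs : ∀ i < n, σ 8 i = s i) (h9 : ∀ v < Q + 1, σ 9 v = 0) :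
    Tri M R tableP σ (n * (Q + 1) * (tableE.cost + 30) + 20)
      fun τ => ∀ l < (n + 1) * (Q + 1), τ 9 l = tab s I.cN (l / (Q + 1)) (l % (Q + 1)) := by
  obtain ⟨hR, hM, hk, hT, hc, -, -⟩ := hB
  have hn : n * (Q + 1) ≤ R := by nlinarith
  have hQ' : σ 13 0 = ((Q + 1 : ℕ) : ℤ) := by rw [hQ]; push_cast; rfl
  set W := Q + 1 with hW
  have fr : ∀ τ : Memory, (∀ b, b ≠ 7 → b ∉ (Program.write 9 (.add (sc 7) (sc 13)) tableE).mods →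
      τ b = σ b) → HasInput I a b τ ∧ τ 13 0 = (W : ℤ) ∧ ∀ i < n, τ 8 i = s i := by
    intro τ hτ
    refine ⟨h.mono fun x hx => hτ x (by omega) (by simp [Program.mods]; omega), ?_, ?_⟩ <;>
    rwa [hτ _ (by omega) (by simp [Program.mods])]
  have hW0 : 0 < W := by omega
  refine (Tri.forLoop hR hM (m := n * W) (by omega) (by simp [nE, Expr.wt]; omega)
    (by simp [Program.mods]) hn (fun τ hτ => ⟨show Expr.Addr τ (.mul nE (sc 13)) from ⟨HasInput.nE_addr, by simp⟩, ?_⟩)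
    (fun j τ => ∀ l < j + W, τ 9 l = tab s I.cN (l / W) (l % W)) ?_
    (c := tableE.cost + 7) ?_).mono ?_ ?_
  · simp [Expr.val, (fr τ hτ).1.nE_val, (fr τ hτ).2.1]
  · intro l hl
    rw [Memory.set_ne _ (by omega), h9 l (by omega), Nat.div_eq_of_lt (by omega)]
    simp [tab]
  · intro j τ hj hτ hj7 hI
    obtain ⟨h1, h2, h3⟩ := fr τ hτ
    have hjW : j / W < n := Nat.div_lt_of_lt_mul (by rwa [mul_comm])
    have hmod : j % W < W := Nat.mod_lt _ hW0
    have hdm := Nat.div_add_mod j W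
    set i := j / W with hi
    set v := j % W with hv
    have ediv : (Expr.div (sc 7) (sc 13)).val τ = i := by
      simp [Expr.val, hj7, h2, hi]
    have ecol : colE.val τ = v := by
      simp only [colE, Expr.val, sc_val, hj7, h2, hv]
      push_cast
      rw [Int.emod_def]
      ring
    have esize : sizeE.val τ = s i := by
      change τ 8 ((Expr.div (sc 7) (sc 13)).val τ).toNat = _
      rw [ediv, Int.toNat_natCast, h3 i hjW]
    have efit : fitE.val τ = if s i ≤ v then 1 else 0 := by
      change (if sizeE.val τ < colE.val τ + 1 then (1 : ℤ) else 0) = _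
      rw [esize, ecol]
      congr 1
      exact propext (by omega)
    have edrop : dropE.val τ = ((tab s I.cN i v + I.cN i : ℕ) : ℤ) := by
      change τ 9 ((sc 7).val τ).toNat + τ 2 ((Expr.div (sc 7) (sc 13)).val τ).toNat = _
      rw [ediv, sc_val, hj7, Int.toNat_natCast, Int.toNat_natCast, h1.c_eq, hI j (by omega)]
      push_cast
      rfl
    -- Column `v` of an entry is at most its linear index `j`, so `s i ≤ v` makes the subtraction
    -- exact.
    have ekeepidx : (Expr.mul (.sub (sc 7) sizeE) fitE).val τ =
        ((if s i ≤ v then j - s i else 0 : ℕ) : ℤ) := by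
      change ((sc 7).val τ - sizeE.val τ) * fitE.val τ = _
      rw [sc_val, hj7, esize, efit]
      have : v ≤ j := Nat.mod_le _ _
      split_ifs <;> simp
      omega
    have ekeep : s i ≤ v → keepE.val τ = tab s I.cN i (v - s i) := by
      intro hsv
      change τ 9 ((Expr.mul (.sub (sc 7) sizeE) fitE).val τ).toNat = _
      rw [ekeepidx, Int.toNat_natCast, if_pos hsv, hI _ (by omega)]
      -- Since `s i ≤ v`, the shift stays inside row `i`.
      have e1 : j - s i = (v - s i) + W * i := by omega
      rw [e1, Nat.add_mul_div_left _ _ hW0, Nat.add_mul_mod_self_left,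
        Nat.div_eq_of_lt (by omega), Nat.mod_eq_of_lt (by omega), zero_add]
    have etable : tableE.val τ = tab s I.cN (i + 1) v := by
      change dropE.val τ + (keepE.val τ - dropE.val τ) *
        (fitE.val τ * (if keepE.val τ < dropE.val τ then 1 else 0)) = _
      rw [efit, tab]
      by_cases hsv : s i ≤ v
      · rw [edrop, ekeep hsv]
        simp only [hsv, true_and, if_true]
        by_cases hlt : tab s I.cN i (v - s i) < tab s I.cN i v + I.cN i
        · rw [if_pos (by exact_mod_cast hlt), if_pos hlt]
          ring
        · rw [if_neg (by exact_mod_cast hlt), if_neg hlt]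
          ring
      · rw [edrop, if_neg hsv, if_neg (fun h' : _ ∧ _ => hsv h'.1)]
        ring
    have adiv : (Expr.div (sc 7) (sc 13)).Addr τ := ⟨by simp, by simp⟩
    have acol : colE.Addr τ := by simp [colE, Expr.Addr]
    have asize : sizeE.Addr τ := ⟨adiv, by rw [ediv]; positivity⟩
    have afit : fitE.Addr τ := ⟨asize, acol, trivial⟩
    have akeep : keepE.Addr τ := ⟨⟨⟨by simp, asize⟩, afit⟩, by rw [ekeepidx]; positivity⟩
    have adrop : dropE.Addr τ :=
      ⟨⟨by simp, by simp [hj7]⟩, adiv, by rw [ediv]; positivity⟩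
    have eidx : (Expr.add (sc 7) (sc 13)).val τ = ((j + W : ℕ) : ℤ) := by
      simp [Expr.val, hj7, h2]
    refine (Tri.write hR hM (i := .add (sc 7) (sc 13)) (e := tableE) ⟨by simp, by simp⟩ (by simp [Expr.wt]; omega)
      (by rw [eidx]; positivity) ⟨adrop, ⟨akeep, adrop⟩, afit, akeep, adrop⟩
      (by simp [tableE, dropE, keepE, fitE, colE, sizeE, Expr.wt]; omega) ?_ ?_).mono
      (by simp [Expr.cost]; omega) fun _ _ h => h
    · rw [etable, Nat.abs_cast]
      exact_mod_cast (tab_le_sum s I.cN (i + 1) v).trans ((Finset.sum_le_sum_of_subset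
        (by simpa using hjW)).trans hc)
    · intro l hl
      rw [etable, eidx, Int.toNat_natCast, Memory.set_ne _ (by omega), Memory.set_idx]
      split_ifs with hl'
      · rw [hl', Nat.add_div_right _ hW0, Nat.add_mod_right]
      · exact hI l (by omega)
  · simp only [nE, Expr.cost, sc_cost]
    nlinarith
  · intro τ _ hτ l hl
    exact hτ l (by rw [add_mul] at hl; omega)

theorem findP_tri {σ : Memory} (h : HasInput I a b σ) (hQ : σ 13 0 = Q + 1) {F : ℕ → ℕ}
    (hF : ∀ v < Q + 1, σ 9 (n * (Q + 1) + v) = F v) :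
    Tri M R findP σ ((Q + 1) * 40 + 20)
      fun τ => ∃ r : ℕ, τ 10 0 = r ∧ (∀ v < r, I.B < F v) ∧
        (r = Q + 1 ∨ r < Q + 1 ∧ F r ≤ I.B) := by
  obtain ⟨hR, hM, hk, hT, -, -, -⟩ := hB
  have hn : Q + 1 ≤ R := by nlinarith
  have hQ' : σ 13 0 = ((Q + 1 : ℕ) : ℤ) := by rw [hQ]; push_cast; rfl
  set W := Q + 1 with hW
  refine ((Tri.assign hR hM (e := .lit 0) (Q := fun τ => τ 10 0 = 0) trivial (by simp [Expr.wt]; omega)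
    (by simp [Expr.val]) (by simp [Memory.set_same, Expr.val])).seq
    (T := W * 40 + 17) fun σ₁ hσ₁ h10 => ?_).mono (by simp [Expr.cost]; omega) fun _ _ h => h
  set e : Expr := .add (sc 10) (.lt (.read 0 (.lit 1)) (.read 9 (.add (.mul nE (sc 13)) (sc 10))))
    with he
  have fr : ∀ τ : Memory, (∀ b, b ≠ 7 → b ∉ (assign 10 e).mods → τ b = σ₁ b) →
      HasInput I a b τ ∧ τ 13 0 = (W : ℤ) ∧ ∀ v < W, τ 9 (n * W + v) = F v := by
    intro τ hτ
    refine ⟨h.mono fun x hx => (hτ x (by omega) (by simp; omega)).trans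
      (hσ₁ x (by simp; omega)), ?_, ?_⟩ <;>
    rwa [hτ _ (by omega) (by simp), hσ₁ _ (by simp)]
  refine (Tri.forLoop hR hM (m := W) (by omega) (by simp; omega) (by simp) hn
    (fun τ hτ => ⟨by simp, by simpa using (fr τ hτ).2.1⟩)
    -- Either every column inspected so far was too expensive, and `r = j`, or `r` already rests at
    -- the first affordable one.
    (fun j τ => ∃ r : ℕ, τ 10 0 = r ∧ r ≤ j ∧ (∀ v < r, I.B < F v) ∧
        (r = j ∨ r < j ∧ F r ≤ I.B)) ⟨0, ?_⟩ (c := e.cost + 2) ?_).mono ?_ ?_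
  · rw [Memory.set_ne _ (by omega)]
    simp [h10]
  · rintro j τ hj hτ hj7 ⟨r, hr, hrj, hlt, hor⟩
    obtain ⟨h1, h2, h3⟩ := fr τ hτ
    have eidx : (Expr.add (.mul nE (sc 13)) (sc 10)).val τ = ((n * W + r : ℕ) : ℤ) := by
      simp [Expr.val, h1.nE_val, h2, hr]
    have eread : (Expr.read 9 (.add (.mul nE (sc 13)) (sc 10))).val τ = F r := by
      rw [Expr.val, eidx, Int.toNat_natCast, h3 r (by omega)]
    have eval : e.val τ = ((if I.B < F r then r + 1 else r : ℕ) : ℤ) := by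
      change (sc 10).val τ + (if τ 0 1 < (Expr.read 9 (.add (.mul nE (sc 13)) (sc 10))).val τ then
        1 else 0) = _
      rw [eread, sc_val, hr, h1.B_eq]
      by_cases hlt : I.B < F r
      · rw [if_pos (by exact_mod_cast hlt), if_pos hlt]
        push_cast; rfl
      · rw [if_neg (by exact_mod_cast hlt), if_neg hlt]
        simp
    refine Tri.assign hR hM
      ⟨by simp, by simp [Expr.Addr, Expr.val], ⟨⟨HasInput.nE_addr, by simp⟩, by simp⟩, ?_⟩
      (by simp [he, nE, Expr.wt]; omega) ?_ ?_
    · rw [eidx]; positivity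
    · rw [eval, Nat.abs_cast]
      split_ifs <;> norm_cast <;> omega
    · rw [eval]
      refine ⟨_, by rw [Memory.set_ne _ (by omega), Memory.set_same], ?_⟩
      rcases hor with hor | hor
      · split_ifs with hlt'
        · refine ⟨by omega, fun v hv => ?_, Or.inl (by omega)⟩
          rcases Nat.lt_succ_iff_lt_or_eq.1 hv with hv | rfl
          · exact hlt v hv
          · exact hlt'
        · exact ⟨by omega, hlt, Or.inr ⟨by omega, by omega⟩⟩
      · rw [if_neg (by omega)]
        exact ⟨by omega, hlt, Or.inr ⟨by omega, hor.2⟩⟩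
  · simp [he, nE, Expr.cost]
    omega
  · rintro τ - ⟨r, h1, h2, h3, h4⟩
    exact ⟨r, h1, h3, h4⟩

theorem reconstructP_tri {σ : Memory} (h : HasInput I a b σ) (hQ : σ 13 0 = Q + 1) {s : ℕ → ℕ}
    (hs : ∀ i < n, σ 8 i = s i)
    (hF : ∀ i v, i ≤ n → v < Q + 1 → σ 9 (i * (Q + 1) + v) = tab s I.cN i v)
    {r : ℕ} (hr : r < Q + 1) (h10 : σ 10 0 = r) :
    Tri M R reconstructP σ (n * 100 + 12)
      fun τ => ∃ x : ℕ → ℕ, (∀ i, x i ≤ 1) ∧ (∀ i < n, τ 5 i = x i) ∧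
        ∑ i ∈ Finset.range n, s i * (1 - x i) ≤ r ∧
        ∑ i ∈ Finset.range n, I.cN i * x i = tab s I.cN n r := by
  obtain ⟨hR, hM, hk, hT, hc, -, -⟩ := hB
  have hn : n ≤ R := by nlinarith
  have hQR : Q + 1 ≤ R := by nlinarith
  have hQ' : σ 13 0 = ((Q + 1 : ℕ) : ℤ) := by rw [hQ]; push_cast; rfl
  set W := Q + 1 with hW
  set P : Program := .seq (.write 5 itemE choiceE)
    (assign 10 (.sub (sc 10) (.mul (.sub (.lit 1) (.read 5 itemE)) (.read 8 itemE)))) with hP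
  have hPm : P.mods = [5, 10] := rfl
  have fr : ∀ τ : Memory, (∀ b, b ≠ 7 → b ∉ P.mods → τ b = σ b) →
      HasInput I a b τ ∧ τ 13 0 = (W : ℤ) ∧ (∀ i < n, τ 8 i = s i) ∧
      ∀ i v, i ≤ n → v < W → τ 9 (i * W + v) = tab s I.cN i v := by
    intro τ hτ
    rw [hPm] at hτ
    refine ⟨h.mono fun x hx => hτ x (by omega) (by simp; omega), ?_, ?_, ?_⟩ <;>
    rwa [hτ _ (by omega) (by simp)]
  refine (Tri.forLoop hR hM (m := n) (by omega) (by simp [nE, Expr.wt]; omega)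
    (by simp [hPm]) hn (fun τ hτ => ⟨HasInput.nE_addr, (fr τ hτ).1.nE_val⟩)
    -- Items are decided from the last to the first. Here `ρ` is the size still available to the
    -- undecided items, and the cost already spent plus the entry for `(n - j, ρ)` remains equal to
    -- the optimal cost.
    (fun j τ => ∃ (x : ℕ → ℕ) (ρ : ℕ), τ 10 0 = ρ ∧ (∀ i, x i ≤ 1) ∧
      (∀ i < n, n - j ≤ i → τ 5 i = x i) ∧
      ∑ i ∈ Finset.Ico (n - j) n, s i * (1 - x i) + ρ = r ∧
      ∑ i ∈ Finset.Ico (n - j) n, I.cN i * x i + tab s I.cN (n - j) ρ = tab s I.cN n r)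
    ⟨0, r, ?_⟩ (c := 88) ?_).mono ?_ ?_
  · rw [Memory.set_ne _ (by omega), Memory.set_ne _ (by omega)]
    refine ⟨h10, by simp, fun i h1 h2 => by omega, by simp, by simp⟩
  · rintro j τ hj hτ hj7 ⟨x, ρ, hρ, hx, h5, hsum, hcost⟩
    obtain ⟨h1, h2, h3, h4⟩ := fr τ hτ
    obtain ⟨i, hi⟩ : ∃ i, n - j = i + 1 := ⟨n - j - 1, by omega⟩
    have hi' : n - (j + 1) = i := by omega
    have hin : i < n := by omega
    rw [hi] at h5 hsum hcost
    rw [hi']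
    have hρr : ρ ≤ r := by omega
    have eitem : ∀ τ : Memory, HasInput I a b τ → τ 7 0 = j → itemE.val τ = i := by
      intro τ h1 hj7
      simp only [itemE, Expr.val, h1.nE_val, sc_val, hj7]
      omega
    have aitem : ∀ τ : Memory, itemE.Addr τ := fun τ =>
      ⟨⟨HasInput.nE_addr, trivial⟩, by simp⟩
    have ei := eitem τ h1 hj7
    have eidx1 : (Expr.add (.mul (.add itemE (.lit 1)) (sc 13)) (sc 10)).val τ =
        (((i + 1) * W + ρ : ℕ) : ℤ) := by
      simp only [Expr.val, ei, sc_val, h2, hρ]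
      push_cast; rfl
    have eidx2 : (Expr.add (.mul itemE (sc 13)) (sc 10)).val τ = ((i * W + ρ : ℕ) : ℤ) := by
      simp only [Expr.val, ei, sc_val, h2, hρ]
      push_cast; rfl
    set d : ℕ := if tab s I.cN (i + 1) ρ = tab s I.cN i ρ + I.cN i then 1 else 0 with hd
    have echoice : choiceE.val τ = d := by
      change (if τ 9 ((Expr.add (.mul (.add itemE (.lit 1)) (sc 13)) (sc 10)).val τ).toNat =
        τ 9 ((Expr.add (.mul itemE (sc 13)) (sc 10)).val τ).toNat + τ 2 (itemE.val τ).toNat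
        then (1 : ℤ) else 0) = d
      rw [eidx1, eidx2, ei, Int.toNat_natCast, Int.toNat_natCast, Int.toNat_natCast, h1.c_eq,
        h4 _ _ (by omega) (by omega), h4 _ _ (by omega) (by omega), hd]
      push_cast
      congr 1
      exact propext (by exact_mod_cast Iff.rfl)
    have hd1 : d ≤ 1 := by rw [hd]; split_ifs <;> omega
    -- If the entry is not the one obtained by interdiction, the recursion took its other branch, so
    -- the item fits and the entry equals that of the smaller capacity.
    have htab : s i * (1 - d) ≤ ρ ∧
        I.cN i * d + tab s I.cN i (ρ - s i * (1 - d)) = tab s I.cN (i + 1) ρ := by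
      by_cases hdd : tab s I.cN (i + 1) ρ = tab s I.cN i ρ + I.cN i
      · rw [hd, if_pos hdd, hdd]
        simp [add_comm]
      · rw [hd, if_neg hdd]
        rw [tab] at hdd ⊢
        split_ifs at hdd ⊢ with hh
        · simpa using hh.1
        · exact absurd rfl hdd
    refine ((Tri.write hR hM (e := choiceE) (Q := fun ρ' => ρ' = τ.set 5 i d) (aitem τ)
      (by simp [itemE, nE, Expr.wt]; omega) (by rw [ei]; positivity)
      ⟨⟨⟨⟨⟨aitem τ, trivial⟩, by simp⟩, by simp⟩, by rw [eidx1]; positivity⟩,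
        ⟨⟨⟨aitem τ, by simp⟩, by simp⟩, by rw [eidx2]; positivity⟩, aitem τ,
        by rw [ei]; positivity⟩ (by simp [choiceE, itemE, nE, Expr.wt]; omega) ?_ ?_).seq
      (T := 40) ?_).mono ?_ fun _ _ h => h
    · rw [echoice, Nat.abs_cast]
      norm_cast
      omega
    · rw [echoice, ei, Int.toNat_natCast]
    · rintro τ' - rfl
      have g1 : HasInput I a b (τ.set 5 i d) :=
        h1.mono fun x hx => Memory.set_ne _ (by omega) _ _
      have ei' := eitem _ g1 (by rw [Memory.set_ne _ (by omega), hj7])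
      have eval : (Expr.sub (sc 10) (.mul (.sub (.lit 1) (.read 5 itemE)) (.read 8 itemE))).val
          (τ.set 5 i d) = ((ρ - s i * (1 - d) : ℕ) : ℤ) := by
        simp only [Expr.val, ei', sc_val, Int.toNat_natCast, Memory.set_same]
        rw [Memory.set_ne _ (by omega), Memory.set_ne _ (by omega), h3 i hin, hρ,
          Nat.cast_sub htab.1]
        push_cast [hd1]
        ring
      refine (Tri.assign hR hM (e := .sub (sc 10) (.mul (.sub (.lit 1) (.read 5 itemE))
        (.read 8 itemE))) ⟨by simp, ⟨trivial, aitem _, by rw [ei']; positivity⟩, aitem _,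
        by rw [ei']; positivity⟩ (by simp [itemE, nE, Expr.wt]; omega) ?_ ?_).mono
        (by simp [itemE, nE, Expr.cost]) fun _ _ h => h
      · rw [eval, Nat.abs_cast]
        norm_cast
        omega
      · rw [eval]
        refine ⟨Function.update x i d, ρ - s i * (1 - d), ?_, ?_, ?_, ?_, ?_⟩
        · rw [Memory.set_ne _ (by omega), Memory.set_same]
        · intro i'
          rw [Function.update_apply]
          split_ifs
          · exact hd1
          · exact hx i'
        · intro i' hi1 hi2
          rw [Memory.set_ne _ (by omega), Memory.set_ne _ (by omega), Memory.set_idx,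
            Function.update_apply]
          split_ifs with hii
          · rfl
          · exact h5 i' hi1 (by omega)
        · rw [Finset.sum_eq_sum_Ico_succ_bot hin, Function.update_self]
          have : ∑ i' ∈ Finset.Ico (i + 1) n, s i' * (1 - Function.update x i d i') =
              ∑ i' ∈ Finset.Ico (i + 1) n, s i' * (1 - x i') :=
            Finset.sum_congr rfl fun i' hi' => by
              rw [Function.update_of_ne (by have := (Finset.mem_Ico.1 hi').1; omega)]
          rw [this]
          have := htab.1
          omega
        · rw [Finset.sum_eq_sum_Ico_succ_bot hin, Function.update_self]
          have : ∑ i' ∈ Finset.Ico (i + 1) n, I.cN i' * Function.update x i d i' =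
              ∑ i' ∈ Finset.Ico (i + 1) n, I.cN i' * x i' :=
            Finset.sum_congr rfl fun i' hi' => by
              rw [Function.update_of_ne (by have := (Finset.mem_Ico.1 hi').1; omega)]
          rw [this]
          have := htab.2
          omega
    · simp [itemE, choiceE, nE, Expr.cost]
  · simp only [nE, Expr.cost]
    omega
  · rintro τ - ⟨x, ρ, h1, h2, h3, h4, h5⟩
    simp only [Nat.sub_self, zero_le, forall_const, tab, add_zero, ← Finset.range_eq_Ico]
      at h3 h4 h5
    exact ⟨x, h2, h3, by omega, h5⟩

end

/-! ### The best rounded solution over all candidates -/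

/-- The interdiction vector `x`, given as a function on all natural numbers, is affordable. -/
def Instance.AffordableN {n t : ℕ} (I : Instance n t) (x : ℕ → ℕ) : Prop :=
  (∀ i, x i ≤ 1) ∧ ∑ i ∈ Finset.range n, I.cN i * x i ≤ I.B

/-- The rounded objective value of the interdiction vector `x` under the candidate `q`. -/
def Instance.roundedValue {n t : ℕ} (I : Instance n t) (Q V q : ℕ) (x : ℕ → ℕ) : ℕ :=
  I.scaledBase Q V q + ∑ i ∈ Finset.range n, I.scaled Q V q i * (1 - x i)

/-- Array `11` holds the best value at most `Q` found among the first `q` candidates, and array `5`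
a solution of this value; if there is none, it holds `Q + 1`, and array `5` is still equal
to `x₀`. -/
def HoldsBest {n t : ℕ} (I : Instance n t) (Q V q : ℕ) (x₀ : ℕ → ℤ) (σ : Memory) : Prop :=
  ∃ best : ℕ, σ 11 0 = best ∧ best ≤ Q + 1 ∧
    (∀ q' < q, ∀ x, I.AffordableN x → best ≤ I.roundedValue Q V q' x) ∧
    ((best = Q + 1 ∧ σ 5 = x₀) ∨ (best < Q + 1 ∧ ∃ q' x, I.AffordableN x ∧
      (∀ i < n, σ 5 i = x i) ∧ I.roundedValue Q V q' x ≤ best))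

theorem HoldsBest.congr {n t : ℕ} {I : Instance n t} {Q V q : ℕ} {x₀ : ℕ → ℤ} {σ τ : Memory}
    (h : HoldsBest I Q V q x₀ σ) (h5 : τ 5 = σ 5) (h11 : τ 11 = σ 11) :
    HoldsBest I Q V q x₀ τ := by
  unfold HoldsBest at *
  rwa [h5, h11]

/-- A constant that bounds the time of `candidateP t`. -/
def candidateCost (t : ℕ) : ℕ := (scaledE t).cost + (scaledBaseE t).cost + tableE.cost + 400

section

variable {n t : ℕ} {I : Instance n t} {a b Q M R k V q : ℕ} (hB : Bounds I Q M R k)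

include hB

theorem candidateP_tri {σ : Memory} (h : HasInput I a b σ) (hq : σ 6 0 = q)
    (hQ : σ 13 0 = Q + 1) (hV : σ 14 0 = V) {x₀ : ℕ → ℤ} (hI : HoldsBest I Q V q x₀ σ)
    (h9 : ∀ v < Q + 1, σ 9 v = 0) :
    Tri M R (candidateP t) σ (candidateCost t * ((n + 1) * (Q + 1)))
      fun τ => HoldsBest I Q V (q + 1) x₀ τ ∧ ∀ v < Q + 1, τ 9 v = 0 := by
  have hR := hB.two_le
  have hM := hB.pow_le
  have hk := hB.wt_le
  have hQR : Q + 1 ≤ R := by nlinarith [hB.table_le]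
  set S := (scaledE t).cost with hS
  set S₀ := (scaledBaseE t).cost with hS₀
  refine ((scaleP_tri hB h hq hQ hV).seq (T := n * (Q + 1) * (tableE.cost + 30) + 20 +
    (((Q + 1) * 40 + 20) + ((S₀ + 2) + (8 + 1 + (7 + (n * 100 + 12)))))) ?_).mono ?_
      fun _ _ h => h
  swap
  · have e : candidateCost t * ((n + 1) * (Q + 1)) =
      (S + S₀ + tableE.cost + 400) * (n * Q + n + Q + 1) := by
        rw [candidateCost]; ring
    rw [e]
    have h1 : n * S ≤ (n * Q + n + Q + 1) * S := Nat.mul_le_mul_right _ (by omega)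
    have h2 : 1 * S₀ ≤ (n * Q + n + Q + 1) * S₀ :=
      Nat.mul_le_mul_right _ (by omega)
    have h3 : (n * Q + n) * tableE.cost ≤ (n * Q + n + Q + 1) * tableE.cost :=
      Nat.mul_le_mul_right _ (by omega)
    nlinarith
  intro σ₁ f₁ hs
  have f₁' : ∀ x, x ≠ 7 → x ≠ 8 → σ₁ x = σ x := fun x h1 h2 =>
    f₁ x (by rw [show (scaleP t).mods = [7, 8, 7] from rfl]; simp [h1, h2])
  have hF₁ : HasInput I a b σ₁ := h.mono fun x hx => f₁' x (by omega) (by omega)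
  refine (tableP_tri hB hF₁ (by rwa [f₁' _ (by omega) (by omega)]) hs
    (by rwa [f₁' _ (by omega) (by omega)])).seq ?_
  intro σ₂ f₂ htab
  have f₂' : ∀ x, x ≠ 7 → x ≠ 9 → σ₂ x = σ₁ x := fun x h1 h2 =>
    f₂ x (by rw [show tableP.mods = [7, 9, 7] from rfl]; simp [h1, h2])
  have hF₂ : HasInput I a b σ₂ := hF₁.mono fun x hx => f₂' x (by omega) (by omega)
  have htab' : ∀ i v, i ≤ n → v < Q + 1 →
      σ₂ 9 (i * (Q + 1) + v) = tab (I.scaled Q V q) I.cN i v := by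
    intro i v hi hv
    rw [htab _ (by nlinarith), mul_comm i, Nat.mul_add_div (by omega), Nat.mul_add_mod,
      Nat.div_eq_of_lt hv, Nat.mod_eq_of_lt hv, add_zero]
  have hQ₂ : σ₂ 13 0 = Q + 1 := by
    rwa [f₂' _ (by omega) (by omega), f₁' _ (by omega) (by omega)]
  refine (findP_tri hB hF₂ hQ₂ (fun v hv => htab' n v le_rfl hv)).seq ?_
  rintro σ₃ f₃ ⟨r, hr, hrlt, hror⟩
  have f₃' : ∀ x, x ≠ 7 → x ≠ 10 → σ₃ x = σ₂ x := fun x h1 h2 =>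
    f₃ x (by rw [show findP.mods = [10, 7, 10, 7] from rfl]; simp [h1, h2])
  have hF₃ : HasInput I a b σ₃ := hF₂.mono fun x hx => f₃' x (by omega) (by omega)
  have hQ₃ : σ₃ 13 0 = Q + 1 := by rwa [f₃' _ (by omega) (by omega)]
  have hq₃ : σ₃ 6 0 = q := by
    rwa [f₃' _ (by omega) (by omega), f₂' _ (by omega) (by omega), f₁' _ (by omega) (by omega)]
  have hV₃ : σ₃ 14 0 = V := by
    rwa [f₃' _ (by omega) (by omega), f₂' _ (by omega) (by omega), f₁' _ (by omega) (by omega)]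
  have ebase := hF₃.scaledBaseE_val hq₃ hQ₃ hV₃
  refine (Tri.assign hR hM (Q := fun τ => τ = σ₃.set 12 0 (I.scaledBase Q V q))
    (hF₃.scaledBaseE_addr hq₃) (by omega) ?_ (by rw [ebase])).seq ?_
  · rw [ebase, Nat.abs_cast]
    -- The truncation at `Q + 1` keeps the stored value small; it loses nothing, since values above
    -- `Q` are never accepted.
    exact_mod_cast (min_le_right _ _).trans hQR
  rintro σ₄ - rfl
  set σ₄ := σ₃.set 12 0 (I.scaledBase Q V q) with hσ₄
  have f₄' : ∀ x, x ≠ 12 → σ₄ x = σ₃ x := fun x hx => Memory.set_ne _ hx _ _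
  have hF₄ : HasInput I a b σ₄ := hF₃.mono fun x hx => f₄' x (by omega)
  obtain ⟨best, hb11, hbQ, hbmin, hbor⟩ := hI
  have h12 : σ₄ 12 0 = I.scaledBase Q V q := Memory.set_same _ _ _ _
  have h10 : σ₄ 10 0 = r := by rwa [f₄' _ (by omega)]
  have h11 : σ₄ 11 0 = best := by
    rwa [f₄' _ (by omega), f₃' _ (by omega) (by omega), f₂' _ (by omega) (by omega),
      f₁' _ (by omega) (by omega)]
  have h5 : σ₄ 5 = σ 5 := by
    rw [f₄' _ (by omega), f₃' _ (by omega) (by omega), f₂' _ (by omega) (by omega),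
      f₁' _ (by omega) (by omega)]
  have h9' : σ₄ 9 = σ₂ 9 := by
    rw [f₄' _ (by omega), f₃' _ (by omega) (by omega)]
  -- Row `0` is still zero, as the next candidate requires.
  have hzero : ∀ v < Q + 1, σ₂ 9 v = 0 := by
    intro v hv
    have := htab' 0 v (by omega) hv
    simpa [tab] using this
  -- A vector with smaller rounded value would make an earlier column affordable, by `tab_le`.
  have hmin : ∀ x, I.AffordableN x → I.scaledBase Q V q + r ≤ I.roundedValue Q V q x := by
    rintro x ⟨hx1, hx2⟩
    unfold Instance.roundedValue
    refine Nat.add_le_add_left ?_ _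
    by_contra hcon
    rw [not_le] at hcon
    have := hrlt _ hcon
    exact absurd ((tab_le (I.scaled Q V q) _ x hx1 n _ le_rfl).trans hx2) (by omega)
  have hval : (Expr.lt (.add (sc 12) (sc 10)) (sc 11)).val σ₄ =
      if I.scaledBase Q V q + r < best then 1 else 0 := by
    change (if (sc 12).val σ₄ + (sc 10).val σ₄ < (sc 11).val σ₄ then (1 : ℤ) else 0) = _
    rw [sc_val, sc_val, sc_val, h12, h10, h11]
    congr 1
    exact propext (by exact_mod_cast Iff.rfl)
  refine (Tri.ite hR hM (b := .lt (.add (sc 12) (sc 10)) (sc 11)) ⟨⟨by simp, by simp⟩, by simp⟩ (by simp [Expr.wt]; omega)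
    (T := 7 + (n * 100 + 12)) (fun hne => ?_) (fun heq => ?_)).mono (by simp [Expr.cost])
    fun _ _ h => h
  · have hlt : I.scaledBase Q V q + r < best := by
      by_contra hcon
      rw [hval, if_neg hcon] at hne
      exact hne rfl
    -- An improvement is strict and `best ≤ Q + 1`, so the failure value `Q + 1` of the scan cannot
    -- lead here.
    have hrQ : r < Q + 1 := by omega
    have hFr : tab (I.scaled Q V q) I.cN n r ≤ I.B := by
      rcases hror with h | h
      · omega
      · exact h.2
    have esum : (Expr.add (sc 12) (sc 10)).val σ₄ = ((I.scaledBase Q V q + r : ℕ) : ℤ) := by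
      simp [Expr.val, h12, h10]
    refine (Tri.assign hR hM (e := .add (sc 12) (sc 10))
      (Q := fun τ => τ = σ₄.set 11 0 ((I.scaledBase Q V q + r : ℕ) : ℤ)) ⟨by simp, by simp⟩
      (by simp [Expr.wt]; omega) ?_ (by rw [esum])).seq ?_
    · rw [esum, Nat.abs_cast]
      norm_cast
      omega
    rintro σ₅ - rfl
    set σ₅ := σ₄.set 11 0 ((I.scaledBase Q V q + r : ℕ) : ℤ) with hσ₅
    have f₅' : ∀ x, x ≠ 11 → σ₅ x = σ₄ x := fun x hx => Memory.set_ne _ hx _ _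
    refine (reconstructP_tri hB (hF₄.mono fun x hx => f₅' x (by omega))
      (by rwa [f₅' _ (by omega), f₄' _ (by omega)]) (s := I.scaled Q V q) ?_ ?_ hrQ
      (by rwa [f₅' _ (by omega)])).mono le_rfl ?_
    · rwa [f₅' _ (by omega), f₄' _ (by omega), f₃' _ (by omega) (by omega),
        f₂' _ (by omega) (by omega)]
    · rwa [f₅' _ (by omega), h9']
    · rintro τ fτ ⟨x, hx, hx5, hxs, hxc⟩
      have fτ' : ∀ y, y ≠ 5 → y ≠ 7 → y ≠ 10 → τ y = σ₅ y := fun y h1 h2 h3 =>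
        fτ y (by rw [show reconstructP.mods = [7, 5, 10, 7] from rfl]; simp [h1, h2, h3])
      refine ⟨⟨I.scaledBase Q V q + r, ?_, by omega, ?_, Or.inr ⟨by omega, q, x, ⟨hx, by omega⟩,
        hx5, ?_⟩⟩, ?_⟩
      · rw [fτ' _ (by omega) (by omega) (by omega)]
        exact Memory.set_same _ _ _ _
      · intro q' hq' y hy
        rcases Nat.lt_succ_iff_lt_or_eq.1 hq' with hq' | rfl
        · exact hlt.le.trans (hbmin q' hq' y hy)
        · exact hmin y hy
      · unfold Instance.roundedValue
        omega
      · rwa [fτ' _ (by omega) (by omega) (by omega), f₅' _ (by omega), h9']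
  · have hge : best ≤ I.scaledBase Q V q + r := by
      by_contra hcon
      rw [hval, if_pos (by omega)] at heq
      exact one_ne_zero heq
    refine (Tri.skip ?_).mono (by omega) fun _ _ h => h
    refine ⟨⟨best, h11, hbQ, ?_, ?_⟩, by rwa [h9']⟩
    · intro q' hq' y hy
      rcases Nat.lt_succ_iff_lt_or_eq.1 hq' with hq' | rfl
      · exact hbmin q' hq' y hy
      · exact hge.trans (hmin y hy)
    · rwa [h5]

omit hB in
theorem testP_mods (t : ℕ) {x : ℕ} (hx : x ≤ 4 ∨ 13 ≤ x) : x ∉ (testP t).mods := by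
  rw [show (testP t).mods = [11, 6, 7, 8, 7, 7, 9, 7, 10, 7, 10, 7, 12, 11, 7, 5, 10, 7, 6]
    from rfl]
  simp
  omega

theorem testP_tri {σ : Memory} (h : HasInput I a b σ) (hQ : σ 13 0 = Q + 1) (hV : σ 14 0 = V)
    (h19 : σ 19 0 = ((n + t) ^ t : ℕ)) (h9 : ∀ v < Q + 1, σ 9 v = 0) :
    Tri M R (testP t) σ
      ((n + t) ^ t * (candidateCost t * ((n + 1) * (Q + 1)) + 12) + 16)
      fun τ => HoldsBest I Q V ((n + t) ^ t) (σ 5) τ ∧ ∀ v < Q + 1, τ 9 v = 0 := by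
  have hR := hB.two_le
  have hM := hB.pow_le
  have hk := hB.wt_le
  have hQR : Q + 1 ≤ R := by nlinarith [hB.table_le]
  refine ((Tri.assign hR hM (e := sc 13) (Q := fun τ => τ = σ.set 11 0 (Q + 1)) (by simp)
    (by simp; omega) ?_ (by simp [hQ])).seq
    (T := (n + t) ^ t * (2 + (candidateCost t * ((n + 1) * (Q + 1))) + 10) + 12) ?_).mono ?_
    fun _ _ h => h
  · rw [sc_val, hQ, abs_of_nonneg (by positivity)]
    exact_mod_cast hQR
  · rintro σ₁ - rfl
    set σ₁ := σ.set 11 0 (Q + 1) with hσ₁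
    have f₁ : ∀ x, x ≠ 11 → σ₁ x = σ x := fun x hx => Memory.set_ne _ hx _ _
    have hmods : (candidateP t).mods = [7, 8, 7, 7, 9, 7, 10, 7, 10, 7, 12, 11, 7, 5, 10, 7] := rfl
    have fr : ∀ τ : Memory, (∀ b, b ≠ 6 → b ∉ (candidateP t).mods → τ b = σ₁ b) →
        HasInput I a b τ ∧ τ 13 0 = Q + 1 ∧ τ 14 0 = V ∧ τ 19 0 = ((n + t) ^ t : ℕ) := by
      intro τ hτ
      rw [hmods] at hτ
      refine ⟨h.mono fun x hx => (hτ x (by omega) (by simp; omega)).trans (f₁ x (by omega)),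
        ?_, ?_, ?_⟩ <;> rwa [hτ _ (by omega) (by simp), f₁ _ (by omega)]
    refine (Tri.forLoop hR hM (m := (n + t) ^ t) (by omega) (by simp; omega)
      (by rw [hmods]; simp) hB.count_le
      (fun τ hτ => ⟨by simp, by simpa using (fr τ hτ).2.2.2⟩)
      (fun j τ => HoldsBest I Q V j (σ 5) τ ∧ ∀ v < Q + 1, τ 9 v = 0) ?_
      (c := candidateCost t * ((n + 1) * (Q + 1))) ?_)
    · refine ⟨⟨Q + 1, ?_, le_rfl, by simp, Or.inl ⟨rfl, ?_⟩⟩, ?_⟩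
      · rw [Memory.set_ne _ (by omega), hσ₁, Memory.set_same]
        push_cast; rfl
      · rw [Memory.set_ne _ (by omega), f₁ _ (by omega)]
      · rwa [Memory.set_ne _ (by omega), f₁ _ (by omega)]
    · intro j τ hj hτ hj6 ⟨hI, hz⟩
      obtain ⟨g1, g2, g3, -⟩ := fr τ hτ
      refine (candidateP_tri hB g1 hj6 g2 g3 hI hz).mono le_rfl ?_
      rintro ρ - ⟨i1, i2⟩
      exact ⟨i1.congr (Memory.set_ne _ (by omega) _ _) (Memory.set_ne _ (by omega) _ _),
        by rwa [Memory.set_ne _ (by omega)]⟩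
  · simp only [sc_cost]
    ring_nf
    omega

end

/-! ### The search for the guess -/

/-- The number `Q + 1`, where `Q = (n + 1) * (3 * (1 + t) * (b / a + 1))`. -/
def sizesE (t : ℕ) : Expr :=
  .add (.mul (.add nE (.lit 1)) (.mul (.lit (3 * (1 + t)))
    (.add (.div (.read 0 (.lit 3)) (.read 0 (.lit 2))) (.lit 1)))) (.lit 1)

/-- The number of candidates. -/
def countE (t : ℕ) : Expr := .powE (hypE t) t

def profitP : Program := forLoop 7 nE (assign 18 (.add (sc 18) (.read 1 (sc 7))))

/-- Tabulate `2 ^ 2 ^ j` until it exceeds the sum of the profits. -/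
def squareP : Program :=
  .seq (.write 16 (.lit 0) (.lit 2)) (.loop (.lt (.read 16 (sc 17)) (.add (sc 18) (.lit 1)))
    (.seq (.write 16 (.add (sc 17) (.lit 1)) (.mul (.read 16 (sc 17)) (.read 16 (sc 17))))
      (assign 17 (.add (sc 17) (.lit 1)))))

/-- Array `15` holds the lower guess and array `17` the exponent `m` of the ratio `2 ^ 2 ^ m`. The
guess tested is the geometric mean of the lower guess and the upper one. -/
def stepP (t : ℕ) : Program :=
  .seq (assign 17 (.sub (sc 17) (.lit 1))) (.seq (assign 14 (.mul (sc 15) (.read 16 (sc 17))))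
    (.seq (testP t) (.ite (.eq (sc 11) (sc 13)) (assign 15 (sc 14)) .skip)))

def searchP (t : ℕ) : Program :=
  .seq (assign 15 (.lit 1)) (.seq (assign 14 (.read 16 (sc 17))) (.seq (testP t)
    (.loop (sc 17) (stepP t))))

def mainP (t : ℕ) : Program :=
  .seq profitP (.seq (assign 13 (sizesE t)) (.seq (assign 19 (countE t))
    (.seq squareP (searchP t))))

/-- No solution has rounded value at most `Q`. -/
def Instance.Fails {n t : ℕ} (I : Instance n t) (Q V : ℕ) : Prop :=
  ∀ q < (n + t) ^ t, ∀ y, I.AffordableN y → Q + 1 ≤ I.roundedValue Q V q y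

/-- The rounded value of `x` is at most `Q` and at most that of every solution. -/
def Instance.IsBest {n t : ℕ} (I : Instance n t) (Q V : ℕ) (x : ℕ → ℕ) : Prop :=
  I.AffordableN x ∧ ∃ q', I.roundedValue Q V q' x ≤ Q ∧ ∀ q < (n + t) ^ t, ∀ y, I.AffordableN y →
    I.roundedValue Q V q' x ≤ I.roundedValue Q V q y

/-- Array `5` holds a best solution. -/
def HoldsSolution {n t : ℕ} (I : Instance n t) (Q V : ℕ) (σ : Memory) : Prop :=
  ∃ x, I.IsBest Q V x ∧ ∀ i < n, σ 5 i = x i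

theorem HoldsSolution.congr {n t : ℕ} {I : Instance n t} {Q V : ℕ} {σ τ : Memory}
    (h : HoldsSolution I Q V σ) (h5 : τ 5 = σ 5) : HoldsSolution I Q V τ := by
  unfold HoldsSolution at *
  rwa [h5]

/-- A failed test leaves array `5` intact; the search uses this to retain the solution of an earlier
successful guess. -/
theorem HoldsBest.dichotomy {n t : ℕ} {I : Instance n t} {Q V : ℕ} {x₀ : ℕ → ℤ} {σ : Memory}
    (h : HoldsBest I Q V ((n + t) ^ t) x₀ σ) :
    (σ 11 0 = (Q + 1 : ℕ) ∧ σ 5 = x₀ ∧ I.Fails Q V) ∨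
      (σ 11 0 ≠ (Q + 1 : ℕ) ∧ HoldsSolution I Q V σ) := by
  obtain ⟨best, h1, h2, h3, ⟨rfl, h4⟩ | ⟨h4, q', x, h5, h6, h7⟩⟩ := h
  · exact Or.inl ⟨h1, h4, h3⟩
  · refine Or.inr ⟨by rw [h1]; norm_cast; omega, x, ⟨h5, q', by omega, fun q hq y hy => ?_⟩, h6⟩
    exact h7.trans (h3 q hq y hy)

/-! ### Correctness of the search -/

section

variable {n t : ℕ} {I : Instance n t} {a b Q M R k J : ℕ} (hB : Bounds I Q M R k)
  (hJ : ∑ i ∈ Finset.range n, I.pN i < 2 ^ 2 ^ J)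
  (hJmin : ∀ j < J, 2 ^ 2 ^ j ≤ ∑ i ∈ Finset.range n, I.pN i)
  (hJR : 2 ^ 2 ^ J ≤ R)

include hB

include hJ hJR in
theorem profitP_tri {σ : Memory} (h : HasInput I a b σ) (h18 : σ 18 0 = 0) :
    Tri M R profitP σ (n * 100 + 20)
      fun τ => τ 18 0 = (∑ i ∈ Finset.range n, I.pN i : ℕ) := by
  have hR := hB.two_le
  have hM := hB.pow_le
  have hk := hB.wt_le
  have hn : n ≤ R := by nlinarith [hB.table_le]
  have fr : ∀ τ : Memory, (∀ b, b ≠ 7 → b ∉ (assign 18 (.add (sc 18) (.read 1 (sc 7)))).mods →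
      τ b = σ b) → HasInput I a b τ :=
    fun τ hτ => h.mono fun x hx => hτ x (by omega) (by simp; omega)
  refine (Tri.forLoop hR hM (m := n) (by omega) (by simp [nE, Expr.wt]; omega)
    (by simp) hn (fun τ hτ => ⟨HasInput.nE_addr, (fr τ hτ).nE_val⟩)
    (fun j τ => τ 18 0 = (∑ i ∈ Finset.range j, I.pN i : ℕ)) ?_ (c := 50) ?_).mono
    (by simp [nE, Expr.cost]; omega) fun _ _ h => h
  · rw [Memory.set_ne _ (by omega)]
    simpa using h18
  · intro j τ hj hτ hj7 hI
    have ev : (Expr.add (sc 18) (.read 1 (sc 7))).val τ =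
        (∑ i ∈ Finset.range (j + 1), I.pN i : ℕ) := by
      rw [Finset.sum_range_succ, Nat.cast_add, ← hI, ← (fr τ hτ).p_eq]
      simp [Expr.val, hj7]
    refine (Tri.assign hR hM (e := .add (sc 18) (.read 1 (sc 7)))
      ⟨by simp, by simp, by simp [hj7]⟩ (by simp [Expr.wt]; omega) ?_
      ?_).mono (by simp [Expr.cost]) fun _ _ h => h
    · rw [ev, Nat.abs_cast]
      exact_mod_cast ((Finset.sum_le_sum_of_subset (by simpa using hj)).trans hJ.le).trans hJR
    · rw [ev, Memory.set_ne _ (by omega), Memory.set_same]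

include hJ hJmin hJR in
theorem squareP_tri {σ : Memory} (h17 : σ 17 0 = 0)
    (h18 : σ 18 0 = (∑ i ∈ Finset.range n, I.pN i : ℕ)) :
    Tri M R squareP σ (J * 100 + 20)
      fun τ => τ 17 0 = J ∧ ∀ j ≤ J, τ 16 j = (2 ^ 2 ^ j : ℕ) := by
  have hR := hB.two_le
  have hM := hB.pow_le
  have hk := hB.wt_le
  refine ((Tri.write hR hM (i := .lit 0) (e := .lit 2) (Q := fun τ => τ = σ.set 16 0 2) trivial
    (by simp [Expr.wt]; omega) le_rfl trivial (by simp [Expr.wt]; omega)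
    (by simpa [Expr.val] using hR) (by simp [Expr.val])).seq (T := J * 50 + 10) ?_).mono
    (by simp [Expr.cost]; omega) fun _ _ h => h
  rintro σ₁ - rfl
  set σ₁ := σ.set 16 0 2 with hσ₁
  set P := Program.seq (.write 16 (.add (sc 17) (.lit 1)) (.mul (.read 16 (sc 17))
    (.read 16 (sc 17)))) (assign 17 (.add (sc 17) (.lit 1))) with hP
  have hmods : P.mods = [16, 17] := rfl
  have hlt : ∀ τ : Memory, (∀ a ∉ P.mods, τ a = σ₁ a) →
      τ 18 0 = (∑ i ∈ Finset.range n, I.pN i : ℕ) := by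
    intro τ hτ
    rw [hmods] at hτ
    rwa [hτ _ (by simp), hσ₁, Memory.set_ne _ (by omega)]
  set S := ∑ i ∈ Finset.range n, I.pN i with hS
  have hval : ∀ (τ : Memory) (j : ℕ), (∀ a ∉ P.mods, τ a = σ₁ a) → τ 17 0 = j →
      τ 16 j = (2 ^ 2 ^ j : ℕ) →
      (Expr.lt (.read 16 (sc 17)) (.add (sc 18) (.lit 1))).val τ =
        if 2 ^ 2 ^ j ≤ S then 1 else 0 := by
    intro τ j hτ h1 h2
    change (if τ 16 ((sc 17).val τ).toNat < (sc 18).val τ + 1 then (1 : ℤ) else 0) = _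
    rw [sc_val, sc_val, h1, Int.toNat_natCast, h2, hlt τ hτ]
    congr 1
    refine propext ?_
    rw [Int.lt_add_one_iff]
    exact Nat.cast_le
  refine (Tri.loop hR hM (b := .lt (.read 16 (sc 17)) (.add (sc 18) (.lit 1))) (P := P) (c := 40)
    (by simp [Expr.wt]; omega)
    (fun m τ => m ≤ J ∧ τ 17 0 = (J - m : ℕ) ∧ ∀ j ≤ J - m, τ 16 j = (2 ^ 2 ^ j : ℕ)) σ₁
    ?_ ?_ ?_ ?_ J (fun _ _ => rfl) ⟨le_rfl, ?_, ?_⟩).mono ?_ ?_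
  · rintro m τ - ⟨-, h1, -⟩
    exact ⟨⟨by simp, by simp [h1]⟩, by simp, trivial⟩
  · rintro τ hτ ⟨-, h1, h2⟩
    rw [hval τ _ hτ h1 (h2 _ le_rfl), if_neg (by simpa using hJ)]
  · rintro m τ hτ ⟨h0, h1, h2⟩
    rw [hval τ _ hτ h1 (h2 _ le_rfl), if_pos (hJmin _ (by omega))]
    exact one_ne_zero
  · rintro m τ hτ ⟨h0, h1, h2⟩
    obtain ⟨j, hj⟩ : ∃ j, j = J - (m + 1) := ⟨_, rfl⟩
    have hj' : J - m = j + 1 := by omega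
    rw [← hj] at h1 h2
    rw [hj']
    have e1 : (Expr.add (sc 17) (.lit 1)).val τ = ((j + 1 : ℕ) : ℤ) := by
      simp [Expr.val, h1]
    have e2 : (Expr.mul (.read 16 (sc 17)) (.read 16 (sc 17))).val τ =
        ((2 ^ 2 ^ (j + 1) : ℕ) : ℤ) := by
      simp only [Expr.val, sc_val, h1, Int.toNat_natCast, h2 j le_rfl]
      push_cast
      ring
    refine ((Tri.write hR hM (i := .add (sc 17) (.lit 1))
      (e := .mul (.read 16 (sc 17)) (.read 16 (sc 17)))
      (Q := fun ρ => ρ = τ.set 16 (j + 1) (2 ^ 2 ^ (j + 1) : ℕ)) ⟨by simp, trivial⟩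
      (by simp [Expr.wt]; omega) (by rw [e1]; positivity)
      ⟨⟨by simp, by simp [h1]⟩, by simp, by simp [h1]⟩ (by simp [Expr.wt]; omega) ?_ ?_).seq
      (T := 6) ?_).mono (by simp [Expr.cost]) fun _ _ h => h
    · rw [e2, Nat.abs_cast]
      exact_mod_cast (Nat.pow_le_pow_right (by omega)
        (Nat.pow_le_pow_right (by omega) (by omega))).trans hJR
    · rw [e1, e2, Int.toNat_natCast]
    · rintro ρ - rfl
      have e3 : (Expr.add (sc 17) (.lit 1)).val (τ.set 16 (j + 1) (2 ^ 2 ^ (j + 1) : ℕ)) =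
          ((j + 1 : ℕ) : ℤ) := by
        simp [Expr.val, h1, Memory.set_ne]
      refine Tri.assign hR hM ⟨by simp, trivial⟩ (by simp [Expr.wt]; omega) ?_ ?_
      · rw [e3, Nat.abs_cast]
        -- The index itself must respect the cell bound; two exponentials lie above it.
        have h3 : j + 1 < 2 ^ (j + 1) := Nat.lt_two_pow_self
        have h4 : 2 ^ (j + 1) < 2 ^ 2 ^ (j + 1) := Nat.lt_two_pow_self
        have h5 : 2 ^ 2 ^ (j + 1) ≤ 2 ^ 2 ^ J := Nat.pow_le_pow_right (by omega)
          (Nat.pow_le_pow_right (by omega) (by omega))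
        exact_mod_cast (by omega : j + 1 ≤ R)
      · rw [e3]
        refine ⟨by omega, Memory.set_same _ _ _ _, fun i hi => ?_⟩
        rw [Memory.set_ne _ (by omega), Memory.set_idx]
        split_ifs with hij
        · rw [hij]
        · exact h2 i (by omega)
  · rw [hσ₁, Memory.set_ne _ (by omega), h17, Nat.sub_self]
    rfl
  · intro j hj
    obtain rfl : j = 0 := by omega
    rw [hσ₁, Memory.set_same]
    rfl
  · simp [Expr.cost]
    omega
  · rintro τ - ⟨-, h1, h2⟩
    exact ⟨h1, h2⟩

/-- A bound for the time of `testP`. -/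
def testCost (n t Q : ℕ) : ℕ := (n + t) ^ t * (candidateCost t * ((n + 1) * (Q + 1)) + 12) + 16

include hJR in
-- The lower guess is `1` or fails, and the upper one, `V * 2 ^ 2 ^ (m + 1)`, has a stored solution.
-- Replacing either of them by the geometric mean turns the ratio into its square root. The product
-- never exceeds `2 ^ 2 ^ J`, which bounds the cells.
theorem stepP_tri {m V : ℕ} {σ : Memory} (h : HasInput I a b σ) (hQ : σ 13 0 = Q + 1)
    (h19 : σ 19 0 = ((n + t) ^ t : ℕ)) (h9 : ∀ v < Q + 1, σ 9 v = 0)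
    (h17 : σ 17 0 = (m + 1 : ℕ)) (h16 : ∀ j ≤ J, σ 16 j = (2 ^ 2 ^ j : ℕ))
    (h15 : σ 15 0 = V) (hVJ : V * 2 ^ 2 ^ (m + 1) ≤ 2 ^ 2 ^ J) (hmJ : m + 1 ≤ J)
    (hV1 : 1 ≤ V) (hV : V = 1 ∨ I.Fails Q V)
    (hsol : HoldsSolution I Q (V * 2 ^ 2 ^ (m + 1)) σ) :
    Tri M R (stepP t) σ (testCost n t Q + 40)
      fun τ => τ 17 0 = m ∧ (∀ v < Q + 1, τ 9 v = 0) ∧ ∃ V' : ℕ, τ 15 0 = V' ∧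
        V' * 2 ^ 2 ^ m ≤ 2 ^ 2 ^ J ∧ 1 ≤ V' ∧ (V' = 1 ∨ I.Fails Q V') ∧
        HoldsSolution I Q (V' * 2 ^ 2 ^ m) τ := by
  have hR := hB.two_le
  have hM := hB.pow_le
  have hk := hB.wt_le
  have hpow : (2 ^ 2 ^ (m + 1) : ℕ) = 2 ^ 2 ^ m * 2 ^ 2 ^ m := by ring
  have hpos : 0 < 2 ^ 2 ^ m := by positivity
  have hle : V * 2 ^ 2 ^ m ≤ 2 ^ 2 ^ J := by
    refine le_trans ?_ hVJ
    rw [hpow]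
    exact Nat.mul_le_mul_left _ (Nat.le_mul_of_pos_left _ hpos)
  have e1 : (Expr.sub (sc 17) (.lit 1)).val σ = m := by
    simp [Expr.val, h17]
  refine ((Tri.assign hR hM (e := .sub (sc 17) (.lit 1)) (Q := fun τ => τ = σ.set 17 0 m)
    ⟨by simp, trivial⟩ (by simp [Expr.wt]; omega) ?_ (by rw [e1])).seq
    (T := 8 + (testCost n t Q + (6 + 4))) ?_).mono (by simp [Expr.cost]; omega) fun _ _ h => h
  · rw [e1, Nat.abs_cast]
    have h1 : m < 2 ^ m := Nat.lt_two_pow_self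
    have h2 : 2 ^ m < 2 ^ 2 ^ m := Nat.lt_two_pow_self
    have h3 : 2 ^ 2 ^ m ≤ V * 2 ^ 2 ^ m := Nat.le_mul_of_pos_left _ hV1
    exact_mod_cast (by omega : m ≤ R)
  rintro σ₁ - rfl
  set σ₁ := σ.set 17 0 m with hσ₁
  have f₁ : ∀ x, x ≠ 17 → σ₁ x = σ x := fun x hx => Memory.set_ne _ hx _ _
  have h17' : σ₁ 17 0 = m := Memory.set_same _ _ _ _
  have e2 : (Expr.mul (sc 15) (.read 16 (sc 17))).val σ₁ = ((V * 2 ^ 2 ^ m : ℕ) : ℤ) := by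
    simp only [Expr.val, sc_val, h17', Int.toNat_natCast]
    rw [f₁ _ (by omega), f₁ _ (by omega), h15, h16 m (by omega)]
    push_cast
    rfl
  refine ((Tri.assign hR hM (e := .mul (sc 15) (.read 16 (sc 17)))
    (Q := fun τ => τ = σ₁.set 14 0 (V * 2 ^ 2 ^ m : ℕ)) ⟨by simp, by simp, by simp [h17']⟩
    (by simp [Expr.wt]; omega) ?_ (by rw [e2])).mono (by simp [Expr.cost]) fun _ _ h => h).seq ?_
  · rw [e2, Nat.abs_cast]
    exact_mod_cast hle.trans hJR
  rintro σ₂ - rfl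
  set σ₂ := σ₁.set 14 0 (V * 2 ^ 2 ^ m : ℕ) with hσ₂
  have f₂ : ∀ x, x ≠ 14 → x ≠ 17 → σ₂ x = σ x := fun x hx hx' =>
    (Memory.set_ne _ hx _ _).trans (f₁ x hx')
  refine (testP_tri hB (h.mono fun x hx => f₂ x (by omega) (by omega)) (V := V * 2 ^ 2 ^ m)
    (by rwa [f₂ _ (by omega) (by omega)]) (Memory.set_same _ _ _ _)
    (by rwa [f₂ _ (by omega) (by omega)]) (by rwa [f₂ _ (by omega) (by omega)])).seq ?_
  rintro σ₃ f₃ ⟨hbest, hz⟩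
  have f₃' : ∀ x, 13 ≤ x → x ≠ 14 → x ≠ 17 → σ₃ x = σ x := fun x hx h1 h2 =>
    (f₃ x (testP_mods t (Or.inr hx))).trans (f₂ x h1 h2)
  have h17₃ : σ₃ 17 0 = m := by
    rwa [f₃ _ (testP_mods t (by omega)), hσ₂, Memory.set_ne _ (by omega)]
  have h14₃ : σ₃ 14 0 = (V * 2 ^ 2 ^ m : ℕ) := by
    rw [f₃ _ (testP_mods t (by omega)), hσ₂, Memory.set_same]
  have h13₃ : σ₃ 13 0 = ((Q + 1 : ℕ) : ℤ) := by
    rw [f₃' _ (by omega) (by omega) (by omega), hQ]; push_cast; rfl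
  have h15₃ : σ₃ 15 0 = V := by
    rwa [f₃' _ (by omega) (by omega) (by omega)]
  have hval : (Expr.eq (sc 11) (sc 13)).val σ₃ = if σ₃ 11 0 = ((Q + 1 : ℕ) : ℤ) then 1 else 0 := by
    rw [← h13₃]
    simp [Expr.val]
  refine Tri.ite hR hM (b := .eq (sc 11) (sc 13)) ⟨by simp, by simp⟩
    (by simp [Expr.wt]; omega) (fun hne => ?_) (fun heq => ?_)
  · rw [hval] at hne
    rcases hbest.dichotomy with ⟨d1, d2, d3⟩ | ⟨d1, -⟩
    · refine (Tri.assign hR hM (e := sc 14) (by simp) (by simp; omega) ?_ ?_).mono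
        (by simp) fun _ _ h => h
      · rw [sc_val, h14₃, Nat.abs_cast]
        exact_mod_cast hle.trans hJR
      · rw [sc_val, h14₃]
        refine ⟨?_, ?_, V * 2 ^ 2 ^ m, Memory.set_same _ _ _ _, ?_, Nat.mul_pos hV1 hpos,
          Or.inr d3, ?_⟩
        · rwa [Memory.set_ne _ (by omega)]
        · rwa [Memory.set_ne _ (by omega)]
        · rw [mul_assoc, ← hpow]
          exact hVJ
        · rw [mul_assoc, ← hpow]
          -- The new lower guess times `2 ^ 2 ^ m` is the old upper guess, whose solution is still
          -- in array `5`.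
          exact hsol.congr (by rw [Memory.set_ne _ (by omega), d2, f₂ _ (by omega) (by omega)])
    · exact absurd (if_neg d1) hne
  · rw [hval] at heq
    rcases hbest.dichotomy with ⟨d1, -, -⟩ | ⟨d1, d2⟩
    · rw [if_pos d1] at heq
      exact absurd heq one_ne_zero
    · exact (Tri.skip ⟨h17₃, hz, V, h15₃, hle, hV1, hV, d2⟩).mono (by omega) fun _ _ h => h

include hJ hJR in
theorem searchP_tri {σ : Memory} (h : HasInput I a b σ) (hQ : σ 13 0 = Q + 1)
    (h19 : σ 19 0 = ((n + t) ^ t : ℕ)) (h9 : ∀ v < Q + 1, σ 9 v = 0)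
    (h17 : σ 17 0 = J) (h16 : ∀ j ≤ J, σ 16 j = (2 ^ 2 ^ j : ℕ))
    (hsucc : ∀ V, ∑ i ∈ Finset.range n, I.pN i < V → ¬ I.Fails Q V) :
    Tri M R (searchP t) σ ((J + 1) * (testCost n t Q + 50))
      fun τ => ∃ V, 1 ≤ V ∧ (V = 1 ∨ I.Fails Q V) ∧ HoldsSolution I Q (V * 2) τ := by
  have hR := hB.two_le
  have hM := hB.pow_le
  have hk := hB.wt_le
  refine ((Tri.assign hR hM (e := .lit 1) (Q := fun τ => τ = σ.set 15 0 1) trivial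
    (by simp [Expr.wt]; omega) (by simp [Expr.val]; omega) (by simp [Expr.val])).seq
    (T := 5 + (testCost n t Q + (J * (2 + 1 + (testCost n t Q + 40)) + 3))) ?_).mono
    (by simp [Expr.cost]; nlinarith) fun _ _ h => h
  rintro σ₁ - rfl
  set σ₁ := σ.set 15 0 1 with hσ₁
  have f₁ : ∀ x, x ≠ 15 → σ₁ x = σ x := fun x hx => Memory.set_ne _ hx _ _
  have e2 : (Expr.read 16 (sc 17)).val σ₁ = ((2 ^ 2 ^ J : ℕ) : ℤ) := by
    simp only [Expr.val, sc_val]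
    rw [f₁ _ (by omega), f₁ _ (by omega), h17, Int.toNat_natCast, h16 J le_rfl]
  refine ((Tri.assign hR hM (e := .read 16 (sc 17))
    (Q := fun τ => τ = σ₁.set 14 0 (2 ^ 2 ^ J : ℕ))
    ⟨by simp, by simp [f₁ 17 (by omega), h17]⟩ (by simp [Expr.wt]; omega) ?_
    (by rw [e2])).mono (by simp [Expr.cost]) fun _ _ h => h).seq ?_
  · rw [e2, Nat.abs_cast]
    exact_mod_cast hJR
  rintro σ₂ - rfl
  set σ₂ := σ₁.set 14 0 (2 ^ 2 ^ J : ℕ) with hσ₂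
  have f₂ : ∀ x, x ≠ 14 → x ≠ 15 → σ₂ x = σ x := fun x hx hx' =>
    (Memory.set_ne _ hx _ _).trans (f₁ x hx')
  refine (testP_tri hB (h.mono fun x hx => f₂ x (by omega) (by omega)) (V := 2 ^ 2 ^ J)
    (by rwa [f₂ _ (by omega) (by omega)]) (Memory.set_same _ _ _ _)
    (by rwa [f₂ _ (by omega) (by omega)]) (by rwa [f₂ _ (by omega) (by omega)])).seq ?_
  rintro σ₃ f₃ ⟨hbest, hz⟩
  have f₃' : ∀ x, 13 ≤ x ∨ x ≤ 4 → x ≠ 14 → x ≠ 15 → σ₃ x = σ x := fun x hx h1 h2 =>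
    (f₃ x (testP_mods t hx.symm)).trans (f₂ x h1 h2)
  have h15₃ : σ₃ 15 0 = 1 := by
    rw [f₃ _ (testP_mods t (by omega)), hσ₂, Memory.set_ne _ (by omega), hσ₁, Memory.set_same]
  have hmods : (stepP t).mods = [17, 14, 11, 6, 7, 8, 7, 7, 9, 7, 10, 7, 10, 7, 12, 11, 7, 5, 10,
    7, 6, 15] := rfl
  have hfr : ∀ τ : Memory, (∀ x ∉ (stepP t).mods, τ x = σ₃ x) → HasInput I a b τ ∧
      τ 13 0 = Q + 1 ∧ τ 19 0 = ((n + t) ^ t : ℕ) ∧ ∀ j ≤ J, τ 16 j = (2 ^ 2 ^ j : ℕ) := by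
    intro τ hτ
    rw [hmods] at hτ
    refine ⟨h.mono fun x hx => (hτ x (by simp; omega)).trans
      (f₃' x (by omega) (by omega) (by omega)), ?_, ?_, ?_⟩ <;>
    rwa [hτ _ (by simp), f₃' _ (by omega) (by omega) (by omega)]
  -- The first guess exceeds the sum of all profits and therefore cannot fail; from here on a
  -- solution is always stored.
  have hsol : HoldsSolution I Q (2 ^ 2 ^ J) σ₃ := by
    rcases hbest.dichotomy with ⟨-, -, d3⟩ | ⟨-, d2⟩
    · exact absurd d3 (hsucc _ hJ)
    · exact d2
  refine (Tri.loop hR hM (b := sc 17) (P := stepP t) (c := testCost n t Q + 40)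
    (by simp; omega)
    (fun m τ => m ≤ J ∧ τ 17 0 = m ∧ (∀ v < Q + 1, τ 9 v = 0) ∧ ∃ V' : ℕ, τ 15 0 = V' ∧
        V' * 2 ^ 2 ^ m ≤ 2 ^ 2 ^ J ∧ 1 ≤ V' ∧ (V' = 1 ∨ I.Fails Q V') ∧
        HoldsSolution I Q (V' * 2 ^ 2 ^ m) τ) σ₃ ?_ ?_ ?_ ?_ J (fun _ _ => rfl)
    ⟨le_rfl, ?_, hz, 1, h15₃, by omega, le_rfl, Or.inl rfl, by rwa [one_mul]⟩).mono ?_ ?_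
  · intro m τ _ _
    simp
  · rintro τ - ⟨-, h1, -⟩
    simpa using h1
  · rintro m τ - ⟨-, h1, -⟩
    rw [sc_val, h1]
    positivity
  · rintro m τ hτ ⟨hm, h1, h2, V, h3, h4, h5, h6, h7⟩
    obtain ⟨g1, g2, g3, g4⟩ := hfr τ hτ
    refine (stepP_tri hB hJR g1 g2 g3 h2 h1 g4 h3 h4 hm h5 h6 h7).mono le_rfl ?_
    rintro ρ - hρ
    exact ⟨by omega, hρ⟩
  · rwa [f₃' _ (by omega) (by omega) (by omega)]
  · simp
  · rintro τ - ⟨-, -, -, V, -, -, h5, h6, h7⟩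
    exact ⟨V, h5, h6, by simpa using h7⟩

include hJ hJmin hJR in
theorem mainP_tri (hQ : Q = (n + 1) * (3 * (1 + t) * (b / a + 1)))
    (hk : (sizesE t).wt + (countE t).wt ≤ k)
    (hsucc : ∀ V, ∑ i ∈ Finset.range n, I.pN i < V → ¬ I.Fails Q V) :
    Tri M R (mainP t) (I.input a b)
      ((J + 1) * (testCost n t Q + 200) + n * 100 + (sizesE t).cost + (countE t).cost)
      fun τ => ∃ V, 1 ≤ V ∧ (V = 1 ∨ I.Fails Q V) ∧ HoldsSolution I Q (V * 2) τ := by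
  have hR := hB.two_le
  have hM := hB.pow_le
  have hQR : Q + 1 ≤ R := by nlinarith [hB.table_le]
  have hin : HasInput I a b (I.input a b) := fun _ _ => rfl
  have h0 : ∀ x i, 5 ≤ x → I.input a b x i = 0 := fun x i hx => by
    rw [I.input_of_five_le a b hx]; rfl
  refine ((profitP_tri hB hJ hJR hin (h0 _ _ (by omega))).seq (T := ((sizesE t).cost + 2) +
    (((countE t).cost + 2) + ((J * 100 + 20) + (J + 1) * (testCost n t Q + 50)))) ?_).mono ?_
    fun _ _ h => h
  swap
  · nlinarith
  intro σ₁ f₁ h18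
  have f₁' : ∀ x, x ≠ 7 → x ≠ 18 → σ₁ x = I.input a b x := fun x h1 h2 =>
    f₁ x (by rw [show profitP.mods = [7, 18, 7] from rfl]; simp [h1, h2])
  have hin₁ : HasInput I a b σ₁ := hin.mono fun x hx => f₁' x (by omega) (by omega)
  have ev : (sizesE t).val σ₁ = ((Q + 1 : ℕ) : ℤ) := by
    change (nE.val σ₁ + 1) * (3 * (1 + t) * (σ₁ 0 3 / σ₁ 0 2 + 1)) + 1 = _
    rw [hin₁.nE_val, hin₁.a_eq, hin₁.b_eq, hQ]
    push_cast
    rfl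
  refine (Tri.assign hR hM (Q := fun τ => τ = σ₁.set 13 0 (Q + 1 : ℕ))
    (by simp [sizesE, Expr.Addr, Expr.val, HasInput.nE_addr]) (by omega) ?_ (by rw [ev])).seq ?_
  · rw [ev, Nat.abs_cast]
    exact_mod_cast hQR
  rintro σ₂ - rfl
  set σ₂ := σ₁.set 13 0 (Q + 1 : ℕ) with hσ₂
  have hin₂ : HasInput I a b σ₂ := hin₁.mono fun x hx => Memory.set_ne _ (by omega) _ _
  have ec : (countE t).val σ₂ = (((n + t) ^ t : ℕ) : ℤ) := by
    rw [countE, Expr.powE_val, hin₂.hypE_val]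
    push_cast
    rfl
  refine (Tri.assign hR hM (e := countE t) (Q := fun τ => τ = σ₂.set 19 0 ((n + t) ^ t : ℕ))
    (Expr.powE_addr HasInput.hypE_addr _) (by omega) ?_ (by rw [ec])).seq ?_
  · rw [ec, Nat.abs_cast]
    exact_mod_cast hB.count_le
  rintro σ₃ - rfl
  set σ₃ := σ₂.set 19 0 ((n + t) ^ t : ℕ) with hσ₃
  have f₃ : ∀ x, x ≠ 13 → x ≠ 19 → σ₃ x = σ₁ x := fun x h1 h2 => by
    rw [hσ₃, Memory.set_ne _ h2, hσ₂, Memory.set_ne _ h1]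
  refine (squareP_tri hB hJ hJmin hJR
    (by rw [f₃ _ (by omega) (by omega), f₁' _ (by omega) (by omega), h0 _ _ (by omega)])
    (by rwa [f₃ _ (by omega) (by omega)])).seq ?_
  rintro σ₄ f₄ ⟨h17, h16⟩
  have f₄' : ∀ x, x ≠ 16 → x ≠ 17 → σ₄ x = σ₃ x := fun x h1 h2 =>
    f₄ x (by rw [show squareP.mods = [16, 16, 17] from rfl]; simp [h1, h2])
  refine searchP_tri hB hJ hJR
    (hin₁.mono fun x hx => (f₄' x (by omega) (by omega)).trans (f₃ x (by omega) (by omega)))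
    ?_ ?_ ?_ h17 h16 hsucc
  · rw [f₄' _ (by omega) (by omega), hσ₃, Memory.set_ne _ (by omega), hσ₂, Memory.set_same]
    push_cast; rfl
  · rw [f₄' _ (by omega) (by omega), hσ₃, Memory.set_same]
  · intro v _
    rw [f₄' _ (by omega) (by omega), f₃ _ (by omega) (by omega), f₁' _ (by omega) (by omega),
      h0 _ _ (by omega)]

end

namespace Instance

variable {n t : ℕ} (I : Instance n t)

/-! ## Linear programming duality -/

/-- The left-hand side of the equation of the hyperplane with number `d`. -/
def lhs (d : ℕ) (v : Fin t → ℝ) : ℝ := ∑ j, (I.hyp d j : ℝ) * v j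

/-- The objective value of `v` in the dual of the linear relaxation of the packing problem that
remains after the interdiction `x`. -/
def dual (x : Fin n → Fin 2) (v : Fin t → ℝ) : ℝ :=
  ∑ j, (I.C j : ℝ) * v j +
    ∑ i : Fin n, max 0 ((I.pN i : ℝ) - I.lhs i v) * (1 - ((x i : ℕ) : ℝ))

theorem lhs_add_smul (d : ℕ) (v u : Fin t → ℝ) (s : ℝ) :
    I.lhs d (v + s • u) = I.lhs d v + s * I.lhs d u := by
  simp only [lhs, Pi.add_apply, Pi.smul_apply, smul_eq_mul, Finset.mul_sum,
    ← Finset.sum_add_distrib]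
  exact Finset.sum_congr rfl fun j _ => by ring

theorem lhs_neg (d : ℕ) (u : Fin t → ℝ) : I.lhs d (-u) = -I.lhs d u := by
  simp [lhs]

theorem lhs_item (i : Fin n) (v : Fin t → ℝ) : I.lhs i v = ∑ j, (I.w i j : ℝ) * v j := by
  refine Finset.sum_congr rfl fun j _ => ?_
  have : (i : ℕ) ≠ n + j := by omega
  simp [hyp, this]

theorem lhs_coord (j : Fin t) (v : Fin t → ℝ) : I.lhs (n + j) v = v j := by
  have h : ∀ j' : Fin t, (I.hyp (n + j) j' : ℝ) * v j' = if j = j' then v j' else 0 := by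
    intro j'
    simp [hyp, wN, Fin.val_inj]
  simp [lhs, h]

theorem pN_coord (j : Fin t) : I.pN (n + j) = 0 := by simp [pN]

theorem one_sub_nonneg (x : Fin 2) : 0 ≤ 1 - ((x : ℕ) : ℝ) := by
  fin_cases x <;> simp

theorem dual_nonneg (x : Fin n → Fin 2) {v : Fin t → ℝ} (hv : 0 ≤ v) : 0 ≤ I.dual x v :=
  add_nonneg (Finset.sum_nonneg fun j _ => mul_nonneg (by positivity) (hv j))
    (Finset.sum_nonneg fun i _ => mul_nonneg (le_max_left _ _) (one_sub_nonneg _))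

/-- Weak duality: each `pᵢ yᵢ` is at most its reduced profit, restricted to non-interdicted items,
plus `(wᵢ · v) yᵢ`. The latter terms sum to at most `C · v` by feasibility. -/
theorem K_le_dual (x : Fin n → Fin 2) {v : Fin t → ℝ} (hv : 0 ≤ v) : (I.K x : ℝ) ≤ I.dual x v := by
  obtain ⟨⟨y, ⟨hy1, hy2⟩, hyK⟩, -⟩ := I.K_isGreatest x
  rw [← hyK]
  have hC : ∑ j, (∑ i, (I.w i j : ℝ) * (y i : ℕ)) * v j ≤ ∑ j, (I.C j : ℝ) * v j :=
    Finset.sum_le_sum fun j _ => mul_le_mul_of_nonneg_right (by exact_mod_cast hy1 j) (hv j)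
  have hi : ∀ i : Fin n, (I.p i : ℝ) * (y i : ℕ) ≤
      max 0 ((I.pN i : ℝ) - I.lhs i v) * (1 - ((x i : ℕ) : ℝ)) + I.lhs i v * (y i : ℕ) := by
    intro i
    have h0 : (0 : ℝ) ≤ (y i : ℕ) := by positivity
    have h1 : ((y i : ℕ) : ℝ) ≤ 1 - ((x i : ℕ) : ℝ) := by
      have hx1 : (x i : ℕ) ≤ 1 := by omega
      have := hy2 i
      rw [le_sub_iff_add_le]
      exact_mod_cast (by omega : (y i : ℕ) + (x i : ℕ) ≤ 1)
    rw [pN_val]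
    have h2 := mul_le_mul_of_nonneg_right (le_max_right 0 ((I.p i : ℝ) - I.lhs i v)) h0
    have h3 := mul_le_mul_of_nonneg_left h1 (le_max_left 0 ((I.p i : ℝ) - I.lhs i v))
    linarith
  have hsum := Finset.sum_le_sum fun i (_ : i ∈ Finset.univ) => hi i
  rw [Finset.sum_add_distrib] at hsum
  have hsw : ∑ i : Fin n, I.lhs i v * (y i : ℕ) =
      ∑ j, (∑ i, (I.w i j : ℝ) * (y i : ℕ)) * v j := by
    simp only [lhs_item, Finset.sum_mul]
    rw [Finset.sum_comm]
    exact Finset.sum_congr rfl fun j _ => Finset.sum_congr rfl fun i _ => by ring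
  unfold dual
  push_cast
  linarith

/-! ### The integrality gap -/

/-- Feasibility in the linear relaxation of the packing problem. -/
def RelaxedPackable (x : Fin n → Fin 2) (y : Fin n → ℝ) : Prop :=
  (∀ i, 0 ≤ y i ∧ y i ≤ 1 - ((x i : ℕ) : ℝ)) ∧ ∀ j, ∑ i, (I.w i j : ℝ) * y i ≤ I.C j

/-- Rounding all fractional coordinates down preserves feasibility because the weights are
nonnegative. -/
theorem sum_p_le_K {x : Fin n → Fin 2} {y : Fin n → ℝ} (hy : I.RelaxedPackable x y) :
    ∑ i ∈ Finset.univ.filter (fun i => y i = 1), (I.p i : ℝ) ≤ I.K x := by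
  classical
  let y' : Fin n → Fin 2 := fun i => if y i = 1 then 1 else 0
  have hy' : ∀ i, ((y' i : ℕ) : ℝ) = if y i = 1 then 1 else 0 := fun i => by
    by_cases h : y i = 1 <;> simp [y', h]
  have hle : ∀ i, ((y' i : ℕ) : ℝ) ≤ y i := fun i => by
    rw [hy']
    split_ifs with h
    · exact h.ge
    · exact (hy.1 i).1
  have hP : I.Packable x y' := by
    refine ⟨fun j => ?_, fun i => ?_⟩
    · have : ∑ i, (I.w i j : ℝ) * (y' i : ℕ) ≤ I.C j :=
        (Finset.sum_le_sum fun i _ => mul_le_mul_of_nonneg_left (hle i) (by positivity)).trans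
          (hy.2 j)
      exact_mod_cast this
    · have h1 : ((y' i : ℕ) : ℝ) + ((x i : ℕ) : ℝ) ≤ 1 := by
        linarith [hle i, (hy.1 i).2]
      have h2 : (y' i : ℕ) + (x i : ℕ) ≤ 1 := by exact_mod_cast h1
      omega
  have := (I.K_isGreatest x).2 ⟨y', hP, rfl⟩
  calc ∑ i ∈ Finset.univ.filter (fun i => y i = 1), (I.p i : ℝ)
      = ∑ i, (I.p i : ℝ) * (y' i : ℕ) := by
        rw [Finset.sum_filter]
        exact Finset.sum_congr rfl fun i _ => by rw [hy']; split_ifs <;> simp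
    _ ≤ I.K x := by exact_mod_cast this

variable (hw : ∀ i j, I.w i j ≤ I.C j)

include hw in
-- The item alone is a packing; this is where `w i j ≤ C j` enters.
theorem p_le_K {x : Fin n → Fin 2} {i : Fin n} (hi : x i = 0) : I.p i ≤ I.K x := by
  classical
  refine (I.K_isGreatest x).2 ⟨Pi.single i 1, ⟨fun j => ?_, fun i' => ?_⟩, ?_⟩
  · rw [Finset.sum_eq_single i]
    · simpa using hw i j
    · intro i' _ h; simp [Pi.single_eq_of_ne h]
    · simp
  · by_cases h : i' = i
    · subst h; simp [hi]
    · simp [Pi.single_eq_of_ne h]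
  · rw [Finset.sum_eq_single i]
    · simp
    · intro i' _ h; simp [Pi.single_eq_of_ne h]
    · simp

/-- The fractional coordinates. -/
noncomputable def frac (y : Fin n → ℝ) : Finset (Fin n) :=
  Finset.univ.filter fun i => y i ≠ 0 ∧ y i ≠ 1

include hw in
-- The coordinates equal to `1` contribute at most `K x` together, and each of the at most `t`
-- fractional ones contributes at most `K x`.
theorem relaxed_le_of_card_frac_le {x : Fin n → Fin 2} {y : Fin n → ℝ}
    (hy : I.RelaxedPackable x y) (hf : (frac y).card ≤ t) :
    ∑ i, (I.p i : ℝ) * y i ≤ (1 + t) * I.K x := by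
  classical
  have h1 : ∀ i, (I.p i : ℝ) * y i ≤ (if y i = 1 then (I.p i : ℝ) else 0) +
      if i ∈ frac y then (I.K x : ℝ) else 0 := by
    intro i
    by_cases h1 : y i = 1
    · simp [h1, frac]
    by_cases h0 : y i = 0
    · simp [h0, frac]
    · have hmem : i ∈ frac y := by simp [frac, h0, h1]
      rw [if_neg h1, if_pos hmem, zero_add]
      have hpos : 0 < y i := lt_of_le_of_ne (hy.1 i).1 (Ne.symm h0)
      have hxi : x i = 0 := by
        by_contra hx
        have : (x i : ℕ) = 1 := by
          have := (x i).2
          have : (x i : ℕ) ≠ 0 := fun h => hx (Fin.ext h)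
          omega
        have := (hy.1 i).2
        simp_all
        linarith
      have hK : (I.p i : ℝ) ≤ I.K x := by exact_mod_cast I.p_le_K hw hxi
      have hle : y i ≤ 1 := by
        have := (hy.1 i).2
        simpa [hxi] using this
      calc (I.p i : ℝ) * y i ≤ I.p i * 1 := by gcongr
        _ ≤ _ := by linarith
  have h2 := Finset.sum_le_sum fun i (_ : i ∈ Finset.univ) => h1 i
  rw [Finset.sum_add_distrib, ← Finset.sum_filter, Finset.sum_ite_mem, Finset.univ_inter,
    Finset.sum_const, nsmul_eq_mul] at h2
  have h3 := I.sum_p_le_K hy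
  have h4 : ((frac y).card : ℝ) * I.K x ≤ t * I.K x := by gcongr
  linarith

/-- A feasible solution with more than `t` fractional coordinates can be moved to one with fewer. -/
theorem exists_frac_lt {x : Fin n → Fin 2} {y : Fin n → ℝ} (hy : I.RelaxedPackable x y)
    (hf : t < (frac y).card) : ∃ y', I.RelaxedPackable x y' ∧ (frac y').card < (frac y).card ∧
      ∑ i, (I.p i : ℝ) * y i ≤ ∑ i, (I.p i : ℝ) * y' i := by
  classical
  obtain ⟨d, hd0, hdW, hdf, hdp⟩ : ∃ d : Fin n → ℝ, d ≠ 0 ∧ (∀ j, ∑ i, (I.w i j : ℝ) * d i = 0) ∧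
      (∀ i ∉ frac y, d i = 0) ∧ 0 ≤ ∑ i, (I.p i : ℝ) * d i := by
    obtain ⟨d, hd0, hdW, hdf⟩ : ∃ d : Fin n → ℝ, d ≠ 0 ∧ (∀ j, ∑ i, (I.w i j : ℝ) * d i = 0) ∧
        (∀ i ∉ frac y, d i = 0) := by
      -- The conditions on `d` number `t + (n - |frac y|) < n`, so a nonzero solution exists.
      let φ : (Fin n → ℝ) →ₗ[ℝ] (Fin t → ℝ) × ({i // i ∉ frac y} → ℝ) :=
        LinearMap.prod (Matrix.mulVecLin (Matrix.of fun j i => (I.w i j : ℝ)))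
          (LinearMap.funLeft ℝ ℝ Subtype.val)
      have hker : LinearMap.ker φ ≠ ⊥ := by
        refine LinearMap.ker_ne_bot_of_finrank_lt ?_
        rw [Module.finrank_prod, Module.finrank_fintype_fun_eq_card,
          Module.finrank_fintype_fun_eq_card, Module.finrank_fintype_fun_eq_card,
          Fintype.card_subtype_compl, Fintype.card_coe, Fintype.card_fin, Fintype.card_fin]
        have := Finset.card_le_univ (frac y)
        rw [Fintype.card_fin] at this
        omega
      obtain ⟨d, hd, hd0⟩ := (Submodule.ne_bot_iff _).1 hker
      rw [LinearMap.mem_ker] at hd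
      refine ⟨d, hd0, fun j => ?_, fun i hi => ?_⟩
      · exact congrFun (congrArg Prod.fst hd) j
      · exact congrFun (congrArg Prod.snd hd) ⟨i, hi⟩
    -- Either `d` or `-d` does not decrease the profit.
    rcases le_total 0 (∑ i, (I.p i : ℝ) * d i) with h | h
    · exact ⟨d, hd0, hdW, hdf, h⟩
    · refine ⟨-d, by simpa using hd0, fun j => ?_, fun i hi => by simp [hdf i hi], ?_⟩
      · simpa using hdW j
      · simpa using h
  have hfr : ∀ i, d i ≠ 0 → 0 < y i ∧ y i < 1 ∧ x i = 0 := by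
    intro i hi
    have hmem : i ∈ frac y := by
      by_contra h
      exact hi (hdf i h)
    simp only [frac, Finset.mem_filter, Finset.mem_univ, true_and] at hmem
    have hpos : 0 < y i := lt_of_le_of_ne (hy.1 i).1 (Ne.symm hmem.1)
    have hle := (hy.1 i).2
    have hx : x i = 0 := by
      have hlt : ((x i : ℕ) : ℝ) < 1 := by linarith
      have : (x i : ℕ) < 1 := by exact_mod_cast hlt
      exact Fin.ext (by simpa using this)
    refine ⟨hpos, lt_of_le_of_ne ?_ hmem.2, hx⟩
    simpa [hx] using hle
  -- The step length at which coordinate `i` reaches `0` or `1`. The least one keeps all coordinates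
  -- in the box and makes one more of them integral.
  let b : Fin n → ℝ := fun i => if 0 < d i then (1 - y i) / d i else y i / (-d i)
  obtain ⟨i₀, hi₀, hmin⟩ := Finset.exists_min_image (Finset.univ.filter fun i => d i ≠ 0) b (by
    obtain ⟨i, hi⟩ := Function.ne_iff.1 hd0
    exact ⟨i, by simpa using hi⟩)
  simp only [Finset.mem_filter, Finset.mem_univ, true_and] at hi₀ hmin
  have hb : 0 ≤ b i₀ := by
    obtain ⟨h1, h2, -⟩ := hfr i₀ hi₀
    simp only [b]
    split_ifs with h
    · exact div_nonneg (by linarith) h.le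
    · exact div_nonneg h1.le (by linarith)
  have hbox : ∀ i, d i ≠ 0 → 0 ≤ y i + b i₀ * d i ∧ y i + b i₀ * d i ≤ 1 := by
    intro i hi
    obtain ⟨h1, h2, -⟩ := hfr i hi
    have h3 := hmin i hi
    by_cases h : 0 < d i
    · have h4 : b i₀ ≤ (1 - y i) / d i := by simpa only [b, if_pos h] using h3
      rw [le_div_iff₀ h] at h4
      exact ⟨by positivity, by linarith⟩
    · have hneg : 0 < -d i := by
        rcases lt_or_gt_of_ne hi with h' | h'
        · linarith
        · exact absurd h' h
      have h4 : b i₀ ≤ y i / (-d i) := by simpa only [b, if_neg h] using h3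
      rw [le_div_iff₀ hneg] at h4
      have h5 : 0 ≤ b i₀ * -d i := by positivity
      exact ⟨by linarith, by linarith⟩
  refine ⟨fun i => y i + b i₀ * d i, ⟨fun i => ?_, fun j => ?_⟩, ?_, ?_⟩
  · by_cases hi : d i = 0
    · simpa [hi] using hy.1 i
    · have := hbox i hi
      rw [(hfr i hi).2.2]
      simpa using this
  · have : ∑ i, (I.w i j : ℝ) * (y i + b i₀ * d i) =
        ∑ i, (I.w i j : ℝ) * y i + b i₀ * ∑ i, (I.w i j : ℝ) * d i := by
      rw [Finset.mul_sum, ← Finset.sum_add_distrib]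
      exact Finset.sum_congr rfl fun i _ => by ring
    rw [this, hdW j, mul_zero, add_zero]
    exact hy.2 j
  · refine Finset.card_lt_card (Finset.ssubset_iff_of_subset ?_ |>.2 ⟨i₀, ?_, ?_⟩)
    · intro i hi
      by_contra hni
      rw [frac, Finset.mem_filter, hdf i hni, mul_zero, add_zero] at hi
      exact hni (by simpa [frac] using hi)
    · by_contra h
      exact hi₀ (hdf _ h)
    · simp only [frac, Finset.mem_filter, Finset.mem_univ, true_and, not_and_or, not_not, b]
      split_ifs with h
      · right; field_simp; ring
      · left; field_simp; ring
  · have : ∑ i, (I.p i : ℝ) * (y i + b i₀ * d i) =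
        ∑ i, (I.p i : ℝ) * y i + b i₀ * ∑ i, (I.p i : ℝ) * d i := by
      rw [Finset.mul_sum, ← Finset.sum_add_distrib]
      exact Finset.sum_congr rfl fun i _ => by ring
    rw [this]
    nlinarith

include hw in
/-- The integrality gap of the packing problem is at most `1 + t`. -/
theorem relaxed_le {x : Fin n → Fin 2} (m : ℕ) {y : Fin n → ℝ} (hy : I.RelaxedPackable x y)
    (hm : (frac y).card ≤ m) : ∑ i, (I.p i : ℝ) * y i ≤ (1 + t) * I.K x := by
  induction m generalizing y with
  | zero => exact I.relaxed_le_of_card_frac_le hw hy (by omega)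
  | succ m ih =>
    rcases le_or_gt (frac y).card t with h | h
    · exact I.relaxed_le_of_card_frac_le hw hy h
    · obtain ⟨y', h1, h2, h3⟩ := I.exists_frac_lt hy h
      exact h3.trans (ih h1 (by omega))

include hw in
/-- Strong duality, combined with the bound for the integrality gap. -/
theorem le_K_of_le_dual {x : Fin n → Fin 2} {D : ℝ}
    (hD : ∀ v : Fin t → ℝ, 0 ≤ v → D ≤ I.dual x v) : D ≤ (1 + t) * I.K x := by
  classical
  by_contra! hlt
  -- The strict margin above `(1 + t) * K x` makes the image of the box disjoint from the points
  -- with weights at most `C` and profit at least `D'`.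
  obtain ⟨D', h1, h2⟩ := exists_between hlt
  have hD'0 : 0 < D' := lt_of_le_of_lt (by positivity) h1
  let box : Set (Fin n → ℝ) := Set.Icc 0 fun i => 1 - ((x i : ℕ) : ℝ)
  let φ : (Fin n → ℝ) →ₗ[ℝ] (Fin t → ℝ) × ℝ :=
    LinearMap.prod (Matrix.mulVecLin (Matrix.of fun j i => (I.w i j : ℝ)))
      (∑ i, (I.p i : ℝ) • LinearMap.proj i)
  have hφ1 : ∀ y j, (φ y).1 j = ∑ i, (I.w i j : ℝ) * y i := fun y j => rfl
  have hφ2 : ∀ y, (φ y).2 = ∑ i, (I.p i : ℝ) * y i := fun y => by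
    simp [φ]
  have hφc : Continuous φ := LinearMap.continuous_of_finiteDimensional φ
  let S : Set ((Fin t → ℝ) × ℝ) := Set.Iic (fun j => (I.C j : ℝ)) ×ˢ Set.Ici D'
  have hdisj : Disjoint (φ '' box) S := by
    rw [Set.disjoint_left]
    rintro _ ⟨y, hy, rfl⟩ ⟨hS1, hS2⟩
    have hP : I.RelaxedPackable x y :=
      ⟨fun i => ⟨hy.1 i, hy.2 i⟩, fun j => by rw [← hφ1]; exact hS1 j⟩
    have := I.relaxed_le hw _ hP le_rfl
    rw [← hφ2] at this
    exact absurd (h1.trans_le hS2) (not_lt.2 this)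
  obtain ⟨f, u, v, hf1, huv, hf2⟩ := geometric_hahn_banach_compact_closed
    ((convex_Icc _ _).linear_image φ) (isCompact_Icc.image hφc)
    ((convex_Iic _).prod (convex_Ici D')) (isClosed_Iic.prod isClosed_Ici) hdisj
  let α : Fin t → ℝ := fun j => f (Pi.single j 1, 0)
  let β : ℝ := f (0, 1)
  have hf : ∀ (c : Fin t → ℝ) (r : ℝ), f (c, r) = ∑ j, c j * α j + r * β := by
    intro c r
    have : (c, r) = ∑ j, c j • ((Pi.single j 1 : Fin t → ℝ), (0 : ℝ)) +
        r • ((0 : Fin t → ℝ), (1 : ℝ)) := by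
      ext j
      · simp [Prod.fst_sum, Finset.sum_apply, Pi.single_apply]
      · simp [Prod.snd_sum]
    rw [this, map_add, map_sum, map_smul, smul_eq_mul]
    simp only [map_smul, smul_eq_mul, α, β]
  have hCD : v < ∑ j, (I.C j : ℝ) * α j + D' * β := by
    rw [← hf]
    exact hf2 _ ⟨Set.mem_Iic.2 le_rfl, Set.mem_Ici.2 le_rfl⟩
  -- `S` is unbounded downwards in each weight coordinate and `f` is bounded below on it. The shift
  -- `s` is chosen to bring `f` down to exactly `v`.
  have hα : ∀ j, α j ≤ 0 := by
    intro j
    by_contra! hpos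
    set X := ∑ j, (I.C j : ℝ) * α j + D' * β with hX
    let s : ℝ := (X - v) / α j
    have hs : 0 ≤ s := div_nonneg (by linarith) hpos.le
    have := hf2 ((fun j' => (I.C j' : ℝ) - s * Pi.single (M := fun _ => ℝ) j 1 j'), D') ⟨by
      rw [Set.mem_Iic]
      intro j'
      have : 0 ≤ s * Pi.single (M := fun _ => ℝ) j 1 j' :=
        mul_nonneg hs (by rw [Pi.single_apply]; split_ifs <;> simp)
      simpa using this, Set.mem_Ici.2 le_rfl⟩
    rw [hf] at this
    simp only [sub_mul, Finset.sum_sub_distrib] at this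
    have e : ∑ j', s * Pi.single (M := fun _ => ℝ) j 1 j' * α j' = X - v := by
      rw [Finset.sum_eq_single j]
      · simp [s, hpos.ne']
      · intro j' _ h; simp [Pi.single_eq_of_ne h]
      · simp
    rw [e] at this
    linarith
  have h0 : 0 < u := by
    have := hf1 0 ⟨0, ⟨le_rfl, fun i => one_sub_nonneg _⟩, map_zero φ⟩
    simpa using this
  -- The origin lies in the image of the box, whence `0 < u < v`; as `C · α ≤ 0`, the profit
  -- coordinate must have positive coefficient. Normalizing by it yields the dual solution `l`.
  have hCα : ∑ j, (I.C j : ℝ) * α j ≤ 0 :=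
    Finset.sum_nonpos fun j _ => mul_nonpos_of_nonneg_of_nonpos (by positivity) (hα j)
  have hβ : 0 < β := by
    have : 0 < D' * β := by linarith
    exact pos_of_mul_pos_right this hD'0.le
  let l : Fin t → ℝ := fun j => -α j / β
  have hl : 0 ≤ l := fun j => div_nonneg (by linarith [hα j]) hβ.le
  have hαl : ∀ j, α j = -(β * l j) := fun j => by
    simp only [l]; field_simp
  -- The maximizer of the Lagrangian over the box; its value turns the separation into `I.dual x l <
  -- D'`.
  let y : Fin n → ℝ := fun i => if 0 < (I.pN i : ℝ) - I.lhs i l then 1 - ((x i : ℕ) : ℝ) else 0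
  have hy := hf1 (φ y) ⟨y, ⟨fun i => ?_, fun i => ?_⟩, rfl⟩
  rotate_left
  · simp only [y]
    split_ifs
    · exact one_sub_nonneg _
    · exact le_rfl
  · simp only [y]
    split_ifs
    · exact le_rfl
    · exact one_sub_nonneg _
  rw [← Prod.mk.eta (p := φ y), hf, hφ2] at hy
  simp only [hφ1, hαl] at hy hCD
  have e1 : ∑ j, (∑ i, (I.w i j : ℝ) * y i) * -(β * l j) = -(β * ∑ i : Fin n, I.lhs i l * y i) := by
    simp only [lhs_item, Finset.sum_mul, Finset.mul_sum, ← Finset.sum_neg_distrib]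
    rw [Finset.sum_comm]
    exact Finset.sum_congr rfl fun i _ => Finset.sum_congr rfl fun j _ => by ring
  have e2 : ∑ j, (I.C j : ℝ) * -(β * l j) = -(β * ∑ j, (I.C j : ℝ) * l j) := by
    simp only [Finset.mul_sum, ← Finset.sum_neg_distrib]
    exact Finset.sum_congr rfl fun j _ => by ring
  have e3 : I.dual x l = ∑ j, (I.C j : ℝ) * l j +
      (∑ i, (I.p i : ℝ) * y i - ∑ i : Fin n, I.lhs i l * y i) := by
    rw [dual, ← Finset.sum_sub_distrib]
    congr 1
    refine Finset.sum_congr rfl fun i _ => ?_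
    simp only [y, pN_val]
    split_ifs with h
    · rw [max_eq_right h.le]; ring
    · rw [max_eq_left (not_lt.1 h)]; ring
  have e4 := hD l hl
  rw [e1] at hy
  rw [e2] at hCD
  have e5 : β * I.dual x l < β * D' := by
    rw [e3]
    linarith
  have e6 := lt_of_mul_lt_mul_left e5 hβ.le
  linarith

end Instance

namespace Instance

variable {n t : ℕ} (I : Instance n t)

/-! ## Vertices of the dual -/

/-- The slope of `dual` at `v` in the direction `u`, as long as no hyperplane is crossed. -/
noncomputable def slope (x : Fin n → Fin 2) (v u : Fin t → ℝ) : ℝ :=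
  ∑ j, (I.C j : ℝ) * u j +
    ∑ i : Fin n, (if 0 < (I.pN i : ℝ) - I.lhs i v then -I.lhs i u else 0) * (1 - ((x i : ℕ) : ℝ))

/-- The one-sided formula is odd because hyperplanes through `v` contribute nothing. It is the true
slope only in directions parallel to all of them, which `htight` guarantees wherever it is used. -/
theorem slope_neg (x : Fin n → Fin 2) (v u : Fin t → ℝ) :
    I.slope x v (-u) = -I.slope x v u := by
  simp only [slope, lhs_neg, Pi.neg_apply, mul_neg, Finset.sum_neg_distrib, neg_add]
  congr 1
  rw [← Finset.sum_neg_distrib]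
  exact Finset.sum_congr rfl fun i _ => by split_ifs <;> ring

/-- The hyperplanes that are hit by the open ray from `v` in the direction `u`. -/
def Hit (v u : Fin t → ℝ) (d : Fin (n + t)) : Prop :=
  I.lhs d u ≠ 0 ∧ 0 < ((I.pN d : ℝ) - I.lhs d v) / I.lhs d u

variable {I} {x : Fin n → Fin 2} {v u : Fin t → ℝ} (hv : 0 ≤ v)
  (htight : ∀ d : Fin (n + t), I.lhs d v = I.pN d → I.lhs d u = 0)

include htight in
-- A nonparallel hyperplane is crossed only at its hitting parameter, and a tight one is parallel to
-- `u`.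
theorem same_side {s : ℝ} (hs : 0 ≤ s)
    (hhit : ∀ d, I.Hit v u d → s ≤ ((I.pN d : ℝ) - I.lhs d v) / I.lhs d u) (d : Fin (n + t)) :
    (0 < (I.pN d : ℝ) - I.lhs d v → 0 ≤ (I.pN d : ℝ) - I.lhs d v - s * I.lhs d u) ∧
      ((I.pN d : ℝ) - I.lhs d v ≤ 0 → (I.pN d : ℝ) - I.lhs d v - s * I.lhs d u ≤ 0) := by
  constructor
  · intro hA
    rcases le_or_gt (I.lhs d u) 0 with h | h
    · nlinarith
    · have := hhit d ⟨h.ne', div_pos hA h⟩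
      rw [le_div_iff₀ h] at this
      linarith
  · intro hA
    rcases hA.lt_or_eq with hA | hA
    · rcases le_or_gt 0 (I.lhs d u) with h | h
      · nlinarith
      · have := hhit d ⟨h.ne, div_pos_of_neg_of_neg hA h⟩
        rw [le_div_iff_of_neg h] at this
        linarith
    · rw [htight d (by linarith)]
      linarith

include hv htight in
-- No positive part changes its branch before the first hit, so the objective is affine there.
-- Nonnegativity persists because the coordinate hyperplanes are among those watched.
theorem dual_add_smul {s : ℝ} (hs : 0 ≤ s)
    (hhit : ∀ d, I.Hit v u d → s ≤ ((I.pN d : ℝ) - I.lhs d v) / I.lhs d u) :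
    0 ≤ v + s • u ∧ I.dual x (v + s • u) = I.dual x v + s * I.slope x v u := by
  have hside := same_side htight hs hhit
  constructor
  · intro j
    have h := (hside ⟨n + j, by omega⟩).2
    simp only [lhs_coord, pN_coord] at h
    have h0 : 0 ≤ v j := hv j
    have := h (by simpa using h0)
    simp only [Pi.zero_apply, Pi.add_apply, Pi.smul_apply, smul_eq_mul]
    push_cast at this
    linarith
  · have hi : ∀ i : Fin n, max 0 ((I.pN i : ℝ) - I.lhs i (v + s • u)) =
        max 0 ((I.pN i : ℝ) - I.lhs i v) +
          s * (if 0 < (I.pN i : ℝ) - I.lhs i v then -I.lhs i u else 0) := by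
      intro i
      have h := hside ⟨i, by omega⟩
      simp only at h
      rw [lhs_add_smul]
      split_ifs with hA
      · have := h.1 hA
        rw [max_eq_right hA.le, max_eq_right (by linarith)]
        ring
      · have := h.2 (not_lt.1 hA)
        rw [max_eq_left (not_lt.1 hA), max_eq_left (by linarith)]
        ring
    simp only [dual, slope, hi, Pi.add_apply, Pi.smul_apply, smul_eq_mul, mul_add, add_mul,
      Finset.sum_add_distrib, Finset.mul_sum]
    have e1 : ∑ j, (I.C j : ℝ) * (s * u j) = ∑ j, s * ((I.C j : ℝ) * u j) :=
      Finset.sum_congr rfl fun j _ => by ring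
    have e2 : ∑ i : Fin n, s * (if 0 < (I.pN i : ℝ) - I.lhs i v then -I.lhs i u else 0) *
          (1 - ((x i : ℕ) : ℝ)) =
        ∑ i : Fin n, s * ((if 0 < (I.pN i : ℝ) - I.lhs i v then -I.lhs i u else 0) *
          (1 - ((x i : ℕ) : ℝ))) :=
      Finset.sum_congr rfl fun i _ => by ring
    rw [e1, e2]
    ring

include hv htight in
/-- Moving downhill until a hyperplane is hit. -/
theorem exists_hit_of_slope_nonpos (hslope : I.slope x v u ≤ 0) (hne : ∃ d, I.Hit v u d) :
    ∃ s : ℝ, 0 ≤ v + s • u ∧ I.dual x (v + s • u) ≤ I.dual x v ∧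
      ∃ d : Fin (n + t), I.lhs d (v + s • u) = I.pN d ∧ I.lhs d u ≠ 0 := by
  classical
  obtain ⟨d, hd, hmin⟩ := Finset.exists_min_image (Finset.univ.filter fun d => I.Hit v u d)
    (fun d => ((I.pN d : ℝ) - I.lhs d v) / I.lhs d u) (by
      obtain ⟨d, hd⟩ := hne
      exact ⟨d, by simpa using hd⟩)
  simp only [Finset.mem_filter, Finset.mem_univ, true_and] at hd hmin
  obtain ⟨h1, h2⟩ := dual_add_smul (x := x) hv htight hd.2.le hmin
  refine ⟨_, h1, ?_, d, ?_, hd.1⟩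
  · rw [h2]
    nlinarith [hd.2]
  · rw [lhs_add_smul, div_mul_cancel₀ _ hd.1]
    ring

include hv htight in
-- A descending ray that meets no hyperplane would make the nonnegative objective negative; the step
-- chosen would give the value `-1`.
theorem slope_nonneg_of_no_hit (hno : ¬ ∃ d, I.Hit v u d) : 0 ≤ I.slope x v u := by
  by_contra! hneg
  have hs : 0 ≤ (I.dual x v + 1) / -I.slope x v u :=
    div_nonneg (by linarith [I.dual_nonneg x hv]) (by linarith)
  obtain ⟨h1, h2⟩ := dual_add_smul (x := x) hv htight hs fun d hd => absurd ⟨d, hd⟩ hno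
  have h3 := I.dual_nonneg x h1
  have h4 : (I.dual x v + 1) / -I.slope x v u * I.slope x v u = -(I.dual x v + 1) := by
    field_simp [hneg.ne]
  rw [h2, h4] at h3
  linarith

include hv htight in
-- A nonzero coordinate of `u` gives a coordinate hyperplane that is hit forwards or backwards. If
-- the downhill direction has no hit, its slope is also nonnegative, so the opposite direction does
-- not ascend and has a hit.
theorem exists_hit (hu : u ≠ 0) :
    ∃ s : ℝ, 0 ≤ v + s • u ∧ I.dual x (v + s • u) ≤ I.dual x v ∧
      ∃ d : Fin (n + t), I.lhs d (v + s • u) = I.pN d ∧ I.lhs d u ≠ 0 := by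
  have htight' : ∀ d : Fin (n + t), I.lhs d v = I.pN d → I.lhs d (-u) = 0 := fun d hd => by
    rw [lhs_neg, htight d hd, neg_zero]
  have hback : (I.slope x v (-u) ≤ 0 ∧ ∃ d, I.Hit v (-u) d) →
      ∃ s : ℝ, 0 ≤ v + s • u ∧ I.dual x (v + s • u) ≤ I.dual x v ∧
        ∃ d : Fin (n + t), I.lhs d (v + s • u) = I.pN d ∧ I.lhs d u ≠ 0 := by
    rintro ⟨h1, h2⟩
    obtain ⟨s, g1, g2, d, g3, g4⟩ := exists_hit_of_slope_nonpos hv htight' h1 h2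
    rw [smul_neg, ← neg_smul] at g1 g2 g3
    exact ⟨-s, g1, g2, d, g3, by simpa [lhs_neg] using g4⟩
  have hor : (∃ d, I.Hit v u d) ∨ ∃ d, I.Hit v (-u) d := by
    obtain ⟨j, hj⟩ := Function.ne_iff.1 hu
    have hd1 : I.lhs (n + j) u ≠ 0 := by rwa [lhs_coord]
    have hd2 : (I.pN (n + j) : ℝ) - I.lhs (n + j) v ≠ 0 := fun h0 =>
      hd1 (htight ⟨n + j, by omega⟩ (by simpa using (sub_eq_zero.1 h0).symm))
    rcases lt_or_gt_of_ne (div_ne_zero hd2 hd1) with h | h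
    · right
      refine ⟨⟨n + j, by omega⟩, ?_, ?_⟩
      · simpa [lhs_neg] using hd1
      · simp only [lhs_neg, div_neg]
        linarith
    · exact Or.inl ⟨⟨n + j, by omega⟩, hd1, h⟩
  by_cases h1 : ∃ d, I.Hit v u d
  · rcases le_or_gt (I.slope x v u) 0 with hs | hs
    · exact exists_hit_of_slope_nonpos hv htight hs h1
    · by_cases h2 : ∃ d, I.Hit v (-u) d
      · exact hback ⟨by rw [slope_neg]; linarith, h2⟩
      · have := slope_nonneg_of_no_hit (x := x) hv htight' h2
        rw [slope_neg] at this
        linarith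
  · have := slope_nonneg_of_no_hit (x := x) hv htight h1
    exact hback ⟨by rw [slope_neg]; linarith, hor.resolve_left h1⟩

variable (I x)

/-- The coefficients of the hyperplane with number `d` as a real vector. -/
def hypR (d : ℕ) (j : Fin t) : ℝ := I.hyp d j

/-- With fewer than `t` independent tight hyperplanes there is a direction `u` parallel to all of
them. Any tight hyperplane not parallel to `u` is independent of these; if none is tight yet, moving
along `u` makes one tight and keeps the others so. -/
theorem exists_independent_tight (k : ℕ) (hk : k ≤ t) {v₀ : Fin t → ℝ} (hv₀ : 0 ≤ v₀) :
    ∃ (v : Fin t → ℝ) (D : Fin k → Fin (n + t)), 0 ≤ v ∧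
      LinearIndependent ℝ (fun r => I.hypR (D r)) ∧ (∀ r, I.lhs (D r) v = I.pN (D r)) ∧
      I.dual x v ≤ I.dual x v₀ := by
  induction k with
  | zero => exact ⟨v₀, Fin.elim0, hv₀, linearIndependent_empty_type, fun r => r.elim0, le_rfl⟩
  | succ k ih =>
    obtain ⟨v, D, hv, hind, htight, hle⟩ := ih (by omega)
    obtain ⟨u, hu0, hu⟩ : ∃ u : Fin t → ℝ, u ≠ 0 ∧ ∀ r, I.lhs (D r) u = 0 := by
      let φ : (Fin t → ℝ) →ₗ[ℝ] (Fin k → ℝ) :=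
        Matrix.mulVecLin (Matrix.of fun r j => I.hypR (D r) j)
      have hker : LinearMap.ker φ ≠ ⊥ :=
        LinearMap.ker_ne_bot_of_finrank_lt (by simpa using hk)
      obtain ⟨u, hu, hu0⟩ := (Submodule.ne_bot_iff _).1 hker
      exact ⟨u, hu0, fun r => congrFun (LinearMap.mem_ker.1 hu) r⟩
    have hext : ∀ d : Fin (n + t), I.lhs d u ≠ 0 →
        LinearIndependent ℝ (fun r => I.hypR (Fin.snoc (α := fun _ => Fin (n + t)) D d r)) := by
      intro d hd
      have hfun : (fun r => I.hypR (Fin.snoc (α := fun _ => Fin (n + t)) D d r)) =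
          Fin.snoc (α := fun _ => Fin t → ℝ) (fun r => I.hypR (D r)) (I.hypR d) := by
        funext r
        refine Fin.lastCases ?_ (fun r => ?_) r <;> simp
      rw [hfun, linearIndependent_finSnoc]
      refine ⟨hind, fun hmem => hd ?_⟩
      -- Pairing with `u` annihilates the span of the old normals but not the new one.
      let ψ : (Fin t → ℝ) →ₗ[ℝ] ℝ := ∑ j, u j • LinearMap.proj j
      have hψ : ∀ d, ψ (I.hypR d) = I.lhs d u := fun d => by
        simp [ψ, lhs, hypR, mul_comm]
      rw [← hψ]
      have : Submodule.span ℝ (Set.range fun r => I.hypR (D r)) ≤ LinearMap.ker ψ := by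
        rw [Submodule.span_le]
        rintro _ ⟨r, rfl⟩
        simpa [hψ] using hu r
      exact this hmem
    by_cases hex : ∃ d : Fin (n + t), I.lhs d v = I.pN d ∧ I.lhs d u ≠ 0
    · obtain ⟨d, hd1, hd2⟩ := hex
      refine ⟨v, Fin.snoc (α := fun _ => Fin (n + t)) D d, hv, hext d hd2, fun r => ?_, hle⟩
      refine Fin.lastCases ?_ (fun r => ?_) r
      · simpa using hd1
      · simpa using htight r
    · push Not at hex
      obtain ⟨s, h1, h2, d, h3, h4⟩ := exists_hit (x := x) hv hex hu0
      refine ⟨v + s • u, Fin.snoc (α := fun _ => Fin (n + t)) D d, h1, hext d h4, fun r => ?_,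
        h2.trans hle⟩
      refine Fin.lastCases ?_ (fun r => ?_) r
      · simpa using h3
      · simp [lhs_add_smul, hu r, htight r]

/-- The candidate with code `q`. -/
noncomputable def point (q : ℕ) (j : Fin t) : ℝ := (I.num q j : ℝ) / I.den q

theorem point_nonneg (q : ℕ) : 0 ≤ I.point q := fun j => by
  unfold point
  positivity

/-- Cramer's rule. Taking absolute values of numerator and denominator is harmless because `v` is
nonnegative. -/
theorem eq_point {q : ℕ} {v : Fin t → ℝ} (hv : 0 ≤ v) (hdet : (I.mat q).det ≠ 0)
    (h : ∀ r, I.lhs (I.digit q r) v = I.pN (I.digit q r)) : v = I.point q := by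
  let f := Int.castRingHom ℝ
  let A : Matrix (Fin t) (Fin t) ℝ := (I.mat q).map f
  let bv : Fin t → ℝ := fun r => (I.rhs q r : ℝ)
  have hA : A.det = ((I.mat q).det : ℝ) := by
    exact (RingHom.map_det f (I.mat q)).symm
  have hA0 : A.det ≠ 0 := by rw [hA]; exact_mod_cast hdet
  have hAv : A.mulVec v = bv := by
    funext r
    have := h r
    simp only [lhs] at this
    simpa [Matrix.mulVec, dotProduct, A, f, mat, bv, rhs] using this
  have hcr : A.cramer bv = A.det • v := by
    have h1 : A.mulVec (A.cramer bv) = A.mulVec (A.det • v) := by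
      rw [Matrix.mulVec_cramer, Matrix.mulVec_smul, hAv]
    have hu : IsUnit A := (Matrix.isUnit_iff_isUnit_det A).2 (isUnit_iff_ne_zero.2 hA0)
    exact Matrix.mulVec_injective_of_isUnit hu h1
  have hcol : ∀ j, A.cramer bv j = (((I.mat q).updateCol j (I.rhs q)).det : ℝ) := by
    intro j
    rw [Matrix.cramer_apply]
    have h1 := RingHom.map_det f ((I.mat q).updateCol j (I.rhs q))
    have h2 : f.mapMatrix ((I.mat q).updateCol j (I.rhs q)) = A.updateCol j bv := by
      ext r j'
      simp only [RingHom.mapMatrix_apply, Matrix.map_apply, Matrix.updateCol_apply, A, bv]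
      split_ifs <;> simp [f]
    rw [h2] at h1
    simpa [f] using h1.symm
  funext j
  have hj := congrFun hcr j
  rw [hcol, Pi.smul_apply, smul_eq_mul, hA] at hj
  have hnum : (I.num q j : ℝ) = |((I.mat q).det : ℝ)| * v j := by
    rw [num, Nat.cast_natAbs, Int.cast_abs, hj, abs_mul, abs_of_nonneg (hv j)]
  have hden : (I.den q : ℝ) = |((I.mat q).det : ℝ)| := by
    rw [den, if_neg hdet, add_zero, Nat.cast_natAbs, Int.cast_abs]
  have hpos : |((I.mat q).det : ℝ)| ≠ 0 := by
    rw [abs_ne_zero]; exact_mod_cast hdet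
  rw [point, hnum, hden, mul_div_cancel_left₀ _ hpos]

/-- The `t` independent hyperplanes below `v₀` are encoded as digits in base `n + t`; independence
makes the determinant nonzero. -/
theorem exists_point_le {v₀ : Fin t → ℝ} (hv₀ : 0 ≤ v₀) :
    ∃ q < (n + t) ^ t, I.dual x (I.point q) ≤ I.dual x v₀ := by
  obtain ⟨v, D, hv, hind, htight, hle⟩ := I.exists_independent_tight x t le_rfl hv₀
  let q : Fin ((n + t) ^ t) := finFunctionFinEquiv D
  have hdig : ∀ r, I.digit q r = D r := by
    intro r
    have : finFunctionFinEquiv.symm q r = D r := by simp [q]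
    rw [← this]
    rfl
  have hdet : (I.mat q).det ≠ 0 := by
    intro h0
    have hu : IsUnit (Matrix.of fun r j => I.hypR (D r) j) :=
      Matrix.linearIndependent_rows_iff_isUnit.1 hind
    rw [Matrix.isUnit_iff_isUnit_det, isUnit_iff_ne_zero] at hu
    apply hu
    have h1 := RingHom.map_det (Int.castRingHom ℝ) (I.mat q)
    rw [h0, map_zero] at h1
    rw [h1]
    congr 1
    ext r j
    simp [mat, hdig, hypR]
  refine ⟨q, q.2, ?_⟩
  rw [← I.eq_point hv hdet fun r => by rw [hdig]; exact htight r]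
  exact hle

/-- Some candidate is an optimal dual solution. -/
theorem exists_point_min :
    ∃ q < (n + t) ^ t, ∀ v : Fin t → ℝ, 0 ≤ v → I.dual x (I.point q) ≤ I.dual x v := by
  obtain ⟨q₁, hq₁, -⟩ := I.exists_point_le x (v₀ := 0) le_rfl
  obtain ⟨q, hq, hmin⟩ := Finset.exists_min_image (Finset.range ((n + t) ^ t))
    (fun q => I.dual x (I.point q)) ⟨q₁, Finset.mem_range.2 hq₁⟩
  refine ⟨q, Finset.mem_range.1 hq, fun v hv => ?_⟩
  obtain ⟨q', hq', hle⟩ := I.exists_point_le x hv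
  exact (hmin q' (Finset.mem_range.2 hq')).trans hle

end Instance

namespace Instance

variable {n t : ℕ} (I : Instance n t)

/-! ## Rounding -/

theorem base_div_den (q : ℕ) :
    (I.base q : ℝ) / I.den q = ∑ j, (I.C j : ℝ) * I.point q j := by
  simp only [base, point, Nat.cast_sum, Nat.cast_mul, Finset.sum_div]
  exact Finset.sum_congr rfl fun j _ => by ring

theorem gain_div_den (q : ℕ) (i : Fin n) :
    (I.gain q i : ℝ) / I.den q = max 0 ((I.pN i : ℝ) - I.lhs i (I.point q)) := by
  have hd : (0 : ℝ) < I.den q := by exact_mod_cast I.den_pos q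
  have h1 : I.lhs i (I.point q) = ((∑ j, I.num q j * I.wN i j : ℕ) : ℝ) / I.den q := by
    simp only [lhs_item, point, Nat.cast_sum, Nat.cast_mul, Finset.sum_div, wN_val]
    exact Finset.sum_congr rfl fun j _ => by ring
  have h2 : (I.gain q i : ℝ) =
      max 0 ((I.den q : ℝ) * I.pN i - (∑ j, I.num q j * I.wN i j : ℕ)) := by
    rw [gain]
    rcases le_total (∑ j, I.num q j * I.wN i j) (I.den q * I.pN i) with h | h
    · rw [Nat.cast_sub h, max_eq_right (by rw [sub_nonneg]; exact_mod_cast h)]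
      push_cast
      rfl
    · rw [Nat.sub_eq_zero_of_le h, max_eq_left (by rw [sub_nonpos]; exact_mod_cast h)]
      simp
  rw [h1, h2, ← max_div_div_right hd.le, zero_div, sub_div, mul_div_cancel_left₀ _ hd.ne']

variable {Q V : ℕ}

theorem floor_bounds (g d : ℕ) (hd : 0 < d) (hV : 0 < V) :
    ((g * Q / (V * d) : ℕ) : ℝ) ≤ Q / V * ((g : ℝ) / d) ∧
      Q / V * ((g : ℝ) / d) ≤ ((g * Q / (V * d) : ℕ) : ℝ) + 1 := by
  have e : Q / V * ((g : ℝ) / d) = ((g * Q : ℕ) : ℝ) / ((V * d : ℕ) : ℝ) := by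
    push_cast
    field_simp
  rw [e]
  refine ⟨Nat.cast_div_le, ?_⟩
  have hpos : (0 : ℝ) < ((V * d : ℕ) : ℝ) := by exact_mod_cast Nat.mul_pos hV hd
  rw [div_le_iff₀ hpos]
  exact_mod_cast (Nat.lt_mul_of_div_lt (Nat.lt_succ_self _) (Nat.mul_pos hV hd)).le

variable {x : Fin n → Fin 2} {y : ℕ → ℕ} (hxy : ∀ i : Fin n, y i = x i) (hV : 0 < V)

include hxy in
theorem cast_one_sub (i : Fin n) : ((1 - y i : ℕ) : ℝ) = 1 - ((x i : ℕ) : ℝ) := by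
  rw [hxy, Nat.cast_sub (by omega), Nat.cast_one]

include hxy hV in
theorem roundedValue_le (q : ℕ) :
    (I.roundedValue Q V q y : ℝ) ≤ Q / V * I.dual x (I.point q) := by
  have hd := I.den_pos q
  rw [roundedValue, Finset.sum_range, dual, mul_add,
    Finset.mul_sum (s := (Finset.univ : Finset (Fin n)))]
  push_cast
  refine add_le_add ?_ (Finset.sum_le_sum fun i _ => ?_)
  · rw [← base_div_den]
    refine le_trans ?_ (floor_bounds _ _ hd hV).1
    exact_mod_cast min_le_left _ _
  · rw [cast_one_sub hxy, ← gain_div_den, ← mul_assoc]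
    exact mul_le_mul_of_nonneg_right (floor_bounds _ _ hd hV).1 (one_sub_nonneg _)

include hxy hV in
-- There are `n + 1` floors, each losing less than one unit. A value of at most `Q` shows that the
-- base was not truncated.
theorem le_roundedValue (q : ℕ) (hle : I.roundedValue Q V q y ≤ Q) :
    Q / V * I.dual x (I.point q) ≤ I.roundedValue Q V q y + (n + 1) := by
  have hd := I.den_pos q
  have hbase : I.scaledBase Q V q = I.base q * Q / (V * I.den q) := by
    have : I.scaledBase Q V q ≤ Q := le_trans (Nat.le_add_right _ _) hle
    unfold scaledBase at this ⊢
    omega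
  rw [roundedValue, Finset.sum_range, dual, mul_add,
    Finset.mul_sum (s := (Finset.univ : Finset (Fin n))), hbase]
  push_cast
  have h1 := (floor_bounds (Q := Q) (I.base q) _ hd hV).2
  rw [base_div_den] at h1
  have h2 : ∀ i : Fin n, Q / V * (max 0 ((I.pN i : ℝ) - I.lhs i (I.point q)) *
      (1 - ((x i : ℕ) : ℝ))) ≤ (I.scaled Q V q i : ℝ) * ((1 - y i : ℕ) : ℝ) + 1 := by
    intro i
    rw [cast_one_sub hxy, ← gain_div_den, ← mul_assoc]
    have h3 := mul_le_mul_of_nonneg_right (floor_bounds (Q := Q) (I.gain q i) _ hd hV).2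
      (one_sub_nonneg (x i))
    have h4 : (1 - ((x i : ℕ) : ℝ)) ≤ 1 := by
      have : (0 : ℝ) ≤ ((x i : ℕ) : ℝ) := by positivity
      linarith
    unfold scaled
    linarith
  have h5 := Finset.sum_le_sum fun i (_ : i ∈ Finset.univ) => h2 i
  rw [Finset.sum_add_distrib] at h5
  simp only [Finset.sum_const, Finset.card_univ, Fintype.card_fin, nsmul_eq_mul, mul_one] at h5
  linarith

theorem affordableN_iff (hy : ∀ i, y i ≤ 1) (hxy : ∀ i : Fin n, y i = x i) :
    I.AffordableN y ↔ I.Affordable x := by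
  rw [AffordableN, Affordable, Finset.sum_range]
  simp [hxy, hy]

theorem exists_extension (x : Fin n → Fin 2) :
    ∃ y : ℕ → ℕ, (∀ i, y i ≤ 1) ∧ ∀ i : Fin n, y i = x i :=
  ⟨fun i => if h : i < n then x ⟨i, h⟩ else 0, fun i => by
    dsimp only
    split_ifs <;> omega, fun i => by simp⟩

theorem sum_pN : ∑ i ∈ Finset.range n, I.pN i = ∑ i, I.p i := by
  simp [Finset.sum_range]

/-- An optimal solution and a candidate that certifies its value. -/
theorem exists_certificate (hw : ∀ i j, I.w i j ≤ I.C j) :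
    ∃ (x : Fin n → Fin 2) (q : ℕ), I.Affordable x ∧ q < (n + t) ^ t ∧
      0 ≤ I.dual x (I.point q) ∧ I.dual x (I.point q) ≤ (1 + t) * I.opt ∧
      I.dual x (I.point q) ≤ (∑ i, I.p i : ℕ) := by
  obtain ⟨x, hx, hK⟩ := I.opt_isLeast.1
  obtain ⟨q, hq, hmin⟩ := I.exists_point_min x
  -- The last bound compares with `v = 0`, where the dual value is the profit of the items that are
  -- not interdicted.
  refine ⟨x, q, hx, hq, I.dual_nonneg x (I.point_nonneg q), ?_, (hmin 0 le_rfl).trans ?_⟩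
  · rw [← hK]
    exact I.le_K_of_le_dual hw hmin
  · simp only [dual, Pi.zero_apply, mul_zero, Finset.sum_const_zero, zero_add, lhs, sub_zero]
    push_cast
    refine Finset.sum_le_sum fun i _ => ?_
    rw [pN_val, max_eq_right (by positivity)]
    have : (0 : ℝ) ≤ ((x i : ℕ) : ℝ) := by positivity
    nlinarith [(by positivity : (0 : ℝ) ≤ I.p i)]

theorem not_fails (hw : ∀ i j, I.w i j ≤ I.C j) (V : ℕ)
    (hlt : ∑ i ∈ Finset.range n, I.pN i < V) : ¬ I.Fails Q V := by
  intro hf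
  obtain ⟨x, q, hx, hq, h0, -, hp⟩ := I.exists_certificate hw
  obtain ⟨y, hy, hxy⟩ := exists_extension x
  have hV : 0 < V := by omega
  have h1 := I.roundedValue_le (Q := Q) hxy hV q
  have h2 : ((Q + 1 : ℕ) : ℝ) ≤ I.roundedValue Q V q y := by
    exact_mod_cast hf q hq y ((I.affordableN_iff hy hxy).2 hx)
  have h3 : I.dual x (I.point q) ≤ V := by
    rw [sum_pN] at hlt
    exact hp.trans (by exact_mod_cast hlt.le)
  have hV' : (0 : ℝ) < V := by exact_mod_cast hV
  have h4 : (Q : ℝ) / V * I.dual x (I.point q) ≤ Q := by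
    calc (Q : ℝ) / V * I.dual x (I.point q) ≤ Q / V * V := by gcongr
      _ = Q := by field_simp
  push_cast at h2
  linarith

/-- Rounding costs at most `2 * V / κ`, with `κ = Q / (n + 1)`. Failure of `V` gives `V < M ≤ (1 +
t) OPT`, so this error is relative to the optimum; the case `V = 1` is covered by integrality. -/
theorem approximation (hw : ∀ i j, I.w i j ≤ I.C j) {a b : ℕ} (ha : 0 < a) (hb : 0 < b)
    (hQ : Q = (n + 1) * (3 * (1 + t) * (b / a + 1))) (hV : 1 ≤ V) (hVf : V = 1 ∨ I.Fails Q V)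
    (hxy : ∀ i : Fin n, y i = x i) (hbest : I.IsBest Q (V * 2) y) :
    (I.K x : ℝ) ≤ (1 + t + (a : ℝ) / b) * I.opt := by
  obtain ⟨-, q', hle, hmin⟩ := hbest
  obtain ⟨x₀, q, hx₀, hq, h0, hopt, -⟩ := I.exists_certificate hw
  obtain ⟨y₀, hy₀, hxy₀⟩ := exists_extension x₀
  set M := I.dual x₀ (I.point q) with hM
  have hV0 : 0 < V := hV
  have hVR : (1 : ℝ) ≤ V := by exact_mod_cast hV
  have haff := (I.affordableN_iff hy₀ hxy₀).2 hx₀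
  have hQpos : 0 < Q := by rw [hQ]; positivity
  have hQR : (0 : ℝ) < Q := by exact_mod_cast hQpos
  -- A failing guess has rounded value at least `Q + 1`, which is at most `Q / V * M`.
  have hVM : V = 1 ∨ (V : ℝ) < M := by
    refine hVf.imp id fun hf => ?_
    have h1 := I.roundedValue_le (Q := Q) hxy₀ hV0 q
    have h2 : ((Q + 1 : ℕ) : ℝ) ≤ I.roundedValue Q V q y₀ := by exact_mod_cast hf q hq y₀ haff
    push_cast at h2
    have h3 : (Q : ℝ) < Q / V * M := by linarith
    rw [div_mul_eq_mul_div, lt_div_iff₀ (by linarith)] at h3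
    exact lt_of_mul_lt_mul_left h3 hQR.le
  set κ : ℝ := 3 * (1 + t) * ((b / a : ℕ) + 1) with hκ
  have hQκ : (Q : ℝ) = (n + 1) * κ := by rw [hQ, hκ]; push_cast; ring
  have hκ3 : 3 * (1 + (t : ℝ)) ≤ κ := by
    rw [hκ]
    have : (0 : ℝ) ≤ (b / a : ℕ) := by positivity
    have ht : (0 : ℝ) ≤ t := by positivity
    nlinarith
  have ht0 : (0 : ℝ) ≤ t := by positivity
  have hκpos : 0 < κ := by linarith
  -- Rounded values are compared at guess `V * 2`, where a unit is `2 * V / Q` and `n + 1` units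
  -- amount to `2 * V / κ`.
  have hK : (I.K x : ℝ) ≤ M + 2 * V / κ := by
    have h1 := I.le_roundedValue hxy (by omega : 0 < V * 2) q' hle
    have h2 : (I.roundedValue Q (V * 2) q' y : ℝ) ≤ I.roundedValue Q (V * 2) q y₀ := by
      exact_mod_cast hmin q hq y₀ haff
    have h3 := I.roundedValue_le (Q := Q) hxy₀ (by omega : 0 < V * 2) q
    have h4 : (Q : ℝ) / (V * 2 : ℕ) * I.dual x (I.point q') ≤
        (Q : ℝ) / (V * 2 : ℕ) * M + (n + 1) := by linarith
    have h5 : (Q : ℝ) / (V * 2 : ℕ) * (M + 2 * V / κ) =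
        (Q : ℝ) / (V * 2 : ℕ) * M + (n + 1) := by
      rw [mul_add, hQκ]
      push_cast
      field_simp
    rw [← h5] at h4
    exact (I.K_le_dual x (I.point_nonneg q')).trans (le_of_mul_le_mul_left h4 (by positivity))
  have hεpos : (0 : ℝ) < a / b := by positivity
  rcases Nat.eq_zero_or_pos I.opt with h | h
  · rw [h] at hopt ⊢
    simp only [Nat.cast_zero, mul_zero] at hopt ⊢
    -- For optimum `0` the error is at most `2 / κ < 1` because `κ ≥ 3 (1 + t)`, so the integer `K
    -- x` vanishes.
    have hV1 : V = 1 := hVM.resolve_right (by linarith)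
    have h1 : 2 * (V : ℝ) / κ < 1 := by
      rw [hV1, div_lt_one hκpos]
      push_cast
      linarith
    have h2 : (I.K x : ℝ) < 1 := by linarith
    have h3 : I.K x < 1 := by exact_mod_cast h2
    have h4 : I.K x = 0 := by omega
    simp [h4]
  · have hopt1 : (1 : ℝ) ≤ I.opt := by exact_mod_cast h
    have hVo : (V : ℝ) ≤ (1 + t) * I.opt := by
      rcases hVM with h | h
      · rw [h]; push_cast; nlinarith
      · linarith
    have hab : (b : ℝ) / a ≤ (b / a : ℕ) + 1 := by
      rw [div_le_iff₀ (by exact_mod_cast ha)]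
      have h1 := Nat.div_add_mod b a
      have h2 := Nat.mod_lt b ha
      exact_mod_cast (by nlinarith : b ≤ (b / a + 1) * a)
    have hκab : 3 * (1 + (t : ℝ)) * (b / a) ≤ κ := by
      rw [hκ]; gcongr
    have h1 : 2 * (V : ℝ) / κ ≤ a / b * I.opt := by
      rw [div_le_iff₀ hκpos]
      have haR : (0 : ℝ) < a := by exact_mod_cast ha
      have hbR : (0 : ℝ) < b := by exact_mod_cast hb
      calc 2 * (V : ℝ) ≤ 3 * ((1 + t) * I.opt) := by linarith
        _ = a / b * I.opt * (3 * (1 + (t : ℝ)) * (b / a)) := by field_simp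
        _ ≤ a / b * I.opt * κ := by gcongr
    linarith

/-! ## Bounds for the numbers and for the running time -/

section Magnitude

variable (a b : ℕ)

theorem magnitude_bounds : 2 ≤ I.magnitude a b ∧ n + 1 ≤ I.magnitude a b ∧
    b + 1 ≤ I.magnitude a b ∧ ∑ i ∈ Finset.range n, I.cN i ≤ I.magnitude a b ∧
    ∑ i ∈ Finset.range n, I.pN i ≤ I.magnitude a b := by
  have hc : ∑ i ∈ Finset.range n, I.cN i = ∑ i, I.c i := by simp [Finset.sum_range]
  rw [hc, sum_pN]
  unfold magnitude
  refine ⟨?_, ?_, ?_, ?_, ?_⟩ <;> omega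

theorem input_le (x i : ℕ) : |I.input a b x i| ≤ I.magnitude a b := by
  have key : ∀ (m : ℕ) (f : Fin m → ℕ), (∀ i, f i ≤ I.magnitude a b) →
      |arrayOf f i| ≤ I.magnitude a b := by
    intro m f hf
    unfold arrayOf
    split_ifs with h
    · rw [Nat.abs_cast]
      exact_mod_cast hf _
    · simp
  have hsum : ∀ (m : ℕ) (f : Fin m → ℕ) (i : Fin m), f i ≤ ∑ i, f i := fun m f i =>
    Finset.single_le_sum (fun _ _ => Nat.zero_le _) (Finset.mem_univ i)
  rcases lt_or_ge x 5 with hx | hx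
  · interval_cases x
    · refine key 4 _ fun i => ?_
      fin_cases i <;> simp [magnitude] <;> omega
    · refine key n _ fun i => (hsum _ I.p i).trans ?_
      unfold magnitude; omega
    · refine key n _ fun i => (hsum _ I.c i).trans ?_
      unfold magnitude; omega
    · refine key (n * t) (fun k => I.w (finProdFinEquiv.symm k).1 (finProdFinEquiv.symm k).2)
        fun k => ?_
      refine (hsum _ (I.w (finProdFinEquiv.symm k).1) (finProdFinEquiv.symm k).2).trans
        ((hsum _ (fun i => ∑ j, I.w i j) (finProdFinEquiv.symm k).1).trans ?_)
      unfold magnitude; omega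
    · refine key t _ fun j => (hsum _ I.C j).trans ?_
      unfold magnitude; omega
  · rw [I.input_of_five_le a b hx]
    simp

end Magnitude

end Instance

/-- The exponent of the bound for the contents of the memory. -/
def cellExponent (t : ℕ) : ℕ := 8 + 3 * t + (t + 1) * t

/-- A bound for the weights of all expressions in `mainP t`. -/
def wordExponent (t : ℕ) : ℕ :=
  100 + (scaledE t).wt + (scaledBaseE t).wt + (sizesE t).wt + (countE t).wt

theorem bounds_magnitude {n t : ℕ} (I : Instance n t) (a b : ℕ) {Q : ℕ}
    (hQ : Q = (n + 1) * (3 * (1 + t) * (b / a + 1))) :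
    Bounds I Q (I.magnitude a b ^ (cellExponent t * wordExponent t))
      (I.magnitude a b ^ cellExponent t) (wordExponent t) := by
  obtain ⟨h2, hn, hb, hc, hp⟩ := I.magnitude_bounds a b
  set N := I.magnitude a b with hN
  have hpow : ∀ {k l : ℕ}, k ≤ l → N ^ k ≤ N ^ l := fun h => Nat.pow_le_pow_right (by omega) h
  -- Constants depending on `t` are absorbed into exponents depending on `t`.
  have hconst : ∀ m : ℕ, m ≤ N ^ m := fun m =>
    Nat.lt_two_pow_self.le.trans (Nat.pow_le_pow_left h2 m)
  have hQN : Q ≤ N ^ (5 + 3 * t) := by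
    have h1 : b / a + 1 ≤ N := (Nat.add_le_add_right (Nat.div_le_self b a) 1).trans hb
    calc Q ≤ N * (N ^ (3 * (1 + t)) * N) := by
          rw [hQ]
          exact Nat.mul_le_mul hn (Nat.mul_le_mul (hconst _) h1)
      _ = N ^ (5 + 3 * t) := by ring
  have hQ1 : Q + 1 ≤ N ^ (6 + 3 * t) := by
    have : 1 ≤ N ^ (5 + 3 * t) := Nat.one_le_pow _ _ (by omega)
    calc Q + 1 ≤ N ^ (5 + 3 * t) * 2 := by omega
      _ ≤ N ^ (5 + 3 * t) * N := Nat.mul_le_mul_left _ h2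
      _ = N ^ (6 + 3 * t) := by ring
  refine ⟨?_, by rw [pow_mul], by unfold wordExponent; omega, ?_, ?_, ?_, ?_⟩
  · calc 2 ≤ N ^ 1 := by simpa using h2
      _ ≤ _ := hpow (by unfold cellExponent; omega)
  · calc (n + 1) * (Q + 1) ≤ N * N ^ (6 + 3 * t) := Nat.mul_le_mul hn hQ1
      _ = N ^ (7 + 3 * t) := by ring
      _ ≤ _ := hpow (by unfold cellExponent; omega)
  · calc _ ≤ N ^ 1 := by simpa using hc
      _ ≤ _ := hpow (by unfold cellExponent; omega)
  · intro i
    have hi : I.pN i ≤ N := by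
      by_cases h : i < n
      · exact (Finset.single_le_sum (f := I.pN) (fun _ _ => Nat.zero_le _)
          (Finset.mem_range.2 h)).trans hp
      · simp [Instance.pN, h]
    calc I.pN i * Q ≤ N * N ^ (5 + 3 * t) := Nat.mul_le_mul hi hQN
      _ = N ^ (6 + 3 * t) := by ring
      _ ≤ _ := hpow (by unfold cellExponent; omega)
  · have h1 : n + t ≤ N ^ (t + 1) := by
      have h3 : t + 1 ≤ N ^ t := Nat.lt_two_pow_self.trans_le (Nat.pow_le_pow_left h2 t)
      calc n + t ≤ (n + 1) * (t + 1) := by nlinarith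
        _ ≤ N * N ^ t := Nat.mul_le_mul hn h3
        _ = N ^ (t + 1) := by ring
    calc (n + t) ^ t ≤ (N ^ (t + 1)) ^ t := Nat.pow_le_pow_left h1 t
      _ = N ^ ((t + 1) * t) := by rw [pow_mul]
      _ ≤ _ := hpow (by unfold cellExponent; omega)

/-- By minimality the largest tabulated power is the square of one that is at most `S`, so it still
fits into a cell. -/
theorem exists_square_exponent (S : ℕ) :
    ∃ J, S < 2 ^ 2 ^ J ∧ (∀ j < J, 2 ^ 2 ^ j ≤ S) ∧ 2 ^ 2 ^ J ≤ max 2 (S * S) := by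
  classical
  have hex : ∃ J, S < 2 ^ 2 ^ J :=
    ⟨S, Nat.lt_two_pow_self.trans (Nat.pow_lt_pow_right (by omega) Nat.lt_two_pow_self)⟩
  refine ⟨Nat.find hex, Nat.find_spec hex, fun j hj => not_lt.1 (Nat.find_min hex hj), ?_⟩
  have hmin : ∀ j < Nat.find hex, 2 ^ 2 ^ j ≤ S := fun j hj => not_lt.1 (Nat.find_min hex hj)
  generalize Nat.find hex = J at hmin
  rcases J with _ | J
  · simp
  · have h := hmin J (by omega)
    refine le_max_of_le_right ?_
    calc 2 ^ 2 ^ (J + 1) = 2 ^ 2 ^ J * 2 ^ 2 ^ J := by ring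
      _ ≤ S * S := Nat.mul_le_mul h h

/-- The number of guesses is doubly logarithmic. -/
theorem square_exponent_le {S J : ℕ} (hJ : ∀ j < J, 2 ^ 2 ^ j ≤ S) {E : ℝ} (hE : 1 ≤ E) :
    (J : ℝ) + 1 ≤ 5 * max 1 (Real.log (E * Real.log S)) := by
  set L := max 1 (Real.log (E * Real.log S)) with hL
  have hL1 : 1 ≤ L := le_max_left _ _
  rcases J with _ | J
  · push_cast
    linarith
  · have h1 : ((2 ^ 2 ^ J : ℕ) : ℝ) ≤ S := by exact_mod_cast hJ J (by omega)
    have hl2 : (1 / 2 : ℝ) < Real.log 2 := by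
      have := Real.log_two_gt_d9
      linarith
    have h2 : (2 : ℝ) ^ J * Real.log 2 ≤ Real.log S := by
      have := Real.log_le_log (by positivity) h1
      push_cast at this
      rw [Real.log_pow] at this
      exact_mod_cast this
    have hpos : 0 < (2 : ℝ) ^ J * Real.log 2 := by positivity
    have h3 : (2 : ℝ) ^ J * Real.log 2 ≤ E * Real.log S := by nlinarith
    have h4 : (J : ℝ) * Real.log 2 + Real.log (Real.log 2) ≤ L := by
      refine le_trans ?_ (le_max_right _ _)
      rw [← Real.log_pow, ← Real.log_mul (by positivity) (by positivity)]
      exact Real.log_le_log hpos h3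
    -- Since `log 2 > 1 / 2`, the term `log (log 2)` costs no more than one `log 2`.
    have h5 : -Real.log 2 ≤ Real.log (Real.log 2) := by
      rw [← Real.log_inv]
      exact Real.log_le_log (by norm_num) (by linarith)
    have hJ0 : (0 : ℝ) ≤ J := by positivity
    push_cast
    rcases le_or_gt (J : ℝ) 1 with h | h
    · linarith
    · have h6 : ((J : ℝ) - 1) * (1 / 2) ≤ ((J : ℝ) - 1) * Real.log 2 :=
        mul_le_mul_of_nonneg_left hl2.le (by linarith)
      linarith

/-- The constant in the bound for the running time. -/
noncomputable def timeConstant (t : ℕ) : ℝ :=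
  5 * ((1 + t) ^ t * (72 * (1 + t) * candidateCost t + 12) + 316 + (sizesE t).cost + (countE t).cost)

theorem testCost_le {n t a b Q : ℕ} (hn : 1 ≤ n) {E : ℝ} (hE1 : 1 ≤ E)
    (hba : ((b / a : ℕ) : ℝ) ≤ 2 * E) (hQ : Q = (n + 1) * (3 * (1 + t) * (b / a + 1))) (c : ℕ) :
    (((n + t) ^ t * (c * ((n + 1) * (Q + 1)) + 12) + 16 : ℕ) : ℝ) ≤
      ((1 + t) ^ t * (72 * (1 + t) * c + 12) + 16) * ((n : ℝ) ^ (t + 2) * E) := by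
  have hnR : (1 : ℝ) ≤ n := by exact_mod_cast hn
  have ht0 : (0 : ℝ) ≤ t := by positivity
  have hκ : 3 * (1 + (t : ℝ)) * ((b / a : ℕ) + 1) ≤ 3 * (1 + t) * (3 * E) := by
    gcongr
    linarith
  -- From `b / a ≤ 2 E` and `n + 1 ≤ 2 n` one gets `Q ≤ 18 (1 + t) E n`; the constant `36` leaves
  -- room for the `+ 1`.
  have hQR : (Q : ℝ) + 1 ≤ 36 * (1 + t) * E * n := by
    have hQe : (Q : ℝ) = (n + 1) * (3 * (1 + (t : ℝ)) * ((b / a : ℕ) + 1)) := by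
      rw [hQ]; push_cast; ring
    have h1 : (Q : ℝ) ≤ 2 * n * (3 * (1 + t) * (3 * E)) := by
      rw [hQe]
      gcongr
      linarith
    have h2 : (1 : ℝ) ≤ (1 + t) * E * n := by
      calc (1 : ℝ) = 1 * 1 * 1 := by norm_num
        _ ≤ (1 + t) * E * n := by gcongr; linarith
    linarith
  have hm : (((n + t) ^ t : ℕ) : ℝ) ≤ (1 + t) ^ t * (n : ℝ) ^ t := by
    rw [← mul_pow]
    push_cast
    gcongr
    nlinarith
  have h1 : ((n : ℝ) + 1) * (Q + 1) ≤ 2 * n * (36 * (1 + t) * E * n) := by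
    gcongr
    linarith
  have h2 : (1 : ℝ) ≤ (n : ℝ) ^ 2 * E :=
    one_le_mul_of_one_le_of_one_le (one_le_pow₀ hnR) hE1
  have h3 : (c : ℝ) * (((n : ℝ) + 1) * (Q + 1)) + 12 ≤
      (72 * (1 + t) * c + 12) * ((n : ℝ) ^ 2 * E) := by
    have h4 : (c : ℝ) * (((n : ℝ) + 1) * (Q + 1)) ≤ c * (2 * n * (36 * (1 + t) * E * n)) :=
      mul_le_mul_of_nonneg_left h1 (by positivity)
    linarith
  have hX1 : 1 ≤ (n : ℝ) ^ (t + 2) * E :=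
    one_le_mul_of_one_le_of_one_le (one_le_pow₀ hnR) hE1
  have h5 := mul_le_mul hm h3 (by positivity) (by positivity)
  push_cast at h5 ⊢
  calc _ ≤ (1 + (t : ℝ)) ^ t * (n : ℝ) ^ t * ((72 * (1 + t) * c + 12) * ((n : ℝ) ^ 2 * E)) +
        16 * ((n : ℝ) ^ (t + 2) * E) := by linarith
    _ = _ := by ring

theorem total_le {T J c c₁ c₂ C n X L : ℝ} (hX : 1 ≤ X) (hL : 1 ≤ L) (hnX : n ≤ X)
    (hJ : J + 1 ≤ 5 * L) (hJ0 : 0 ≤ J) (hc₁ : 0 ≤ c₁) (hc₂ : 0 ≤ c₂) (hC : 0 ≤ C)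
    (hc : c ≤ (C + 16) * X)
    (hT : T ≤ (J + 1) * (c + 200) + n * 100 + c₁ + c₂) :
    T ≤ 5 * (C + 316 + c₁ + c₂) * (X * L) := by
  have h1 : (J + 1) * (c + 200) ≤ 5 * L * ((C + 216) * X) := by
    have h2 : c + 200 ≤ (C + 216) * X := by linarith
    exact (mul_le_mul_of_nonneg_left h2 (by linarith)).trans
      (mul_le_mul_of_nonneg_right hJ (by positivity))
  have h3 : (100 + c₁ + c₂) * X ≤ L * ((100 + c₁ + c₂) * X) :=
    le_mul_of_one_le_left (by positivity) hL
  have h4 : c₁ + c₂ ≤ (c₁ + c₂) * X := le_mul_of_one_le_right (by linarith) hX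
  have h5 : 0 ≤ L * ((100 + c₁ + c₂) * X) := by positivity
  linarith

theorem time_le {n t a b Q J S T : ℕ} (hn : 1 ≤ n) {ε : ℝ} (hε : 0 < ε) (ha : 0 < a)
    (hab : ε ≤ 2 * ((a : ℝ) / b)) (hQ : Q = (n + 1) * (3 * (1 + t) * (b / a + 1)))
    (hJ : ∀ j < J, 2 ^ 2 ^ j ≤ S)
    (hT : T ≤ (J + 1) * (testCost n t Q + 200) + n * 100 + (sizesE t).cost + (countE t).cost) :
    (T : ℝ) ≤ timeConstant t * ((n : ℝ) ^ (t + 2) * max 1 ε⁻¹ *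
      max 1 (Real.log (max 1 ε⁻¹ * Real.log S))) := by
  have hE1 : 1 ≤ max 1 ε⁻¹ := le_max_left _ _
  have hnR : (1 : ℝ) ≤ n := by exact_mod_cast hn
  have hba : ((b / a : ℕ) : ℝ) ≤ 2 * max 1 ε⁻¹ := by
    -- The lower bound `a / b ≥ ε / 2` is what limits the table size: `b / a ≤ 2 / ε`.
    refine Nat.cast_div_le.trans (le_trans ?_
      (mul_le_mul_of_nonneg_left (le_max_right 1 ε⁻¹) (by norm_num)))
    rcases Nat.eq_zero_or_pos b with rfl | hb
    · simpa using hε.le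
    · have haR : (0 : ℝ) < a := by exact_mod_cast ha
      have hbR : (0 : ℝ) < b := by exact_mod_cast hb
      rw [← div_eq_mul_inv, div_le_div_iff₀ haR hε]
      have := mul_le_mul_of_nonneg_left hab hbR.le
      field_simp at this
      linarith
  have hnX : (n : ℝ) ≤ (n : ℝ) ^ (t + 2) * max 1 ε⁻¹ :=
    (le_self_pow₀ hnR (by omega)).trans (le_mul_of_one_le_right (by positivity) hE1)
  have htest := testCost_le hn hE1 hba hQ (candidateCost t)
  rw [← testCost] at htest
  have hT' : (T : ℝ) ≤ ((J : ℝ) + 1) * ((testCost n t Q : ℝ) + 200) + n * 100 +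
      ((sizesE t).cost : ℝ) + ((countE t).cost : ℝ) := by exact_mod_cast hT
  rw [timeConstant]
  generalize (sizesE t).cost = c₁ at hT' ⊢
  generalize (countE t).cost = c₂ at hT' ⊢
  generalize testCost n t Q = c at hT' htest
  generalize candidateCost t = c₃ at htest ⊢
  exact total_le (hnR.trans hnX) (le_max_left _ _) hnX (square_exponent_le hJ hE1)
    (Nat.cast_nonneg _) (Nat.cast_nonneg _) (Nat.cast_nonneg _) (by positivity) htest hT'

end KnapsackInterdiction

/-- For every fixed number `t` of capacity constraints there are one program, one word-size factor
`k` and one constant `A` that serve all instances and all accuracies `ε`. The real number `ε` is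
given to the machine as a rational number `a / b ∈ [ε / 2, ε]`. The maxima with `1` have no effect
as soon as `ε ≤ 1` and `ε⁻¹ log (∑ pᵢ) ≥ e`. -/
theorem mainTheorem3 (t : ℕ) :
    ∃ (P : KnapsackInterdiction.Program) (k : ℕ) (A : ℝ),
      ∀ (n : ℕ) (_ : 1 ≤ n) (I : KnapsackInterdiction.Instance n t)
        (_ : ∀ i j, I.w i j ≤ I.C j)
        (ε : ℝ) (_ : 0 < ε) (a b : ℕ) (_ : 0 < a) (_ : 0 < b)
        (_ : (a : ℝ) / b ≤ ε) (_ : ε ≤ 2 * ((a : ℝ) / b)),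
        ∃ (τ : KnapsackInterdiction.Memory) (T : ℕ) (x : Fin n → Fin 2),
          KnapsackInterdiction.Run (I.magnitude a b ^ k) P (I.input a b) τ T ∧
          KnapsackInterdiction.IsOutput τ x ∧
          I.Affordable x ∧
          (I.K x : ℝ) ≤ (1 + t + ε) * I.opt ∧
          (T : ℝ) ≤ A * ((n : ℝ) ^ (t + 2) * max 1 ε⁻¹ *
            max 1 (Real.log (max 1 ε⁻¹ * Real.log ((∑ i, I.p i : ℕ) : ℝ)))) := by
  open KnapsackInterdiction in
  refine ⟨mainP t, cellExponent t * wordExponent t, timeConstant t, ?_⟩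
  intro n hn I hw ε hε a b ha hb hab hab'
  obtain ⟨Q, hQ⟩ : ∃ Q, Q = (n + 1) * (3 * (1 + t) * (b / a + 1)) := ⟨_, rfl⟩
  have hB := bounds_magnitude I a b hQ
  obtain ⟨h2, -, -, -, hp⟩ := I.magnitude_bounds a b
  obtain ⟨J, hJ, hJmin, hJmax⟩ := exists_square_exponent (∑ i ∈ Finset.range n, I.pN i)
  have hcell : I.magnitude a b * I.magnitude a b ≤ I.magnitude a b ^ cellExponent t := by
    rw [← pow_two]
    exact Nat.pow_le_pow_right (by omega) (by unfold cellExponent; omega)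
  have hJR : 2 ^ 2 ^ J ≤ I.magnitude a b ^ cellExponent t :=
    (hJmax.trans (max_le (by nlinarith) (Nat.mul_le_mul hp hp))).trans hcell
  obtain ⟨τ, T, hrun, hT, -, -, V, hV, hVf, y, hbest, hy5⟩ := mainP_tri hB hJ hJmin hJR hQ
    (by unfold wordExponent; omega) (fun V hV => I.not_fails hw V hV) fun x i =>
      (I.input_le a b x i).trans (by exact_mod_cast (by nlinarith :
        I.magnitude a b ≤ I.magnitude a b ^ cellExponent t))
  have hy1 := hbest.1.1
  let x : Fin n → Fin 2 := fun i => ⟨y i, Nat.lt_succ_of_le (hy1 i)⟩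
  have hxy : ∀ i : Fin n, y i = x i := fun i => rfl
  refine ⟨τ, T, x, hrun, fun i => hy5 i i.2, (I.affordableN_iff hy1 hxy).1 hbest.1, ?_, ?_⟩
  -- The machine works with accuracy `a / b`, which is at most `ε`.
  · refine (I.approximation hw ha hb hQ hV hVf hxy hbest).trans ?_
    gcongr
  · have hS := I.sum_pN
    rw [← hS]
    exact time_le hn hε ha hab' hQ hJmin hT
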